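/- Let $\mathbb{T}^d=\mathbb{R}^d/\mathbb{Z}^d$ and let $W\in C^2(\mathbb{T}^d;\mathbb{R})$. Let $\Phi_t=(\Phi^X_t,\Phi^V_t)$ be the flow on $\mathbb{T}^d\times\mathbb{R}^d$ of $\dot X=V$, $\dot V=-\nabla W(X)$, and let $T_t\mu=(\Phi_t)_\#\mu$ be the associated transport semigroup on measures. Set $\mathcal{M}(v)=(2\pi)^{-d/2}e^{-|v|^2/2}$, $\nu_v=\mathcal{M}(v)\,dv$, $\nu_x=Z^{-1}e^{-W(x)}\,dx$ with $Z=\int_{\mathbb{T}^d}e^{-W}\,dx$, and $\nu=\nu_x\otimes\nu_v$. For probability measures put $\|\mu-\mu'\|_{TV}=\sup\{\int\phi\,d\mu-\int\phi\,d\mu' : \phi\in C_b,\ \|\phi\|_\infty\le 1\}$. There is $T_{***}>0$, depending only on $d$ and $W$, such that for every nonincreasing $M:[0,\infty)\to(0,\infty)$ and every $T>0$ there is $\beta_{***}\in(0,1)$, depending only on $d$, $W$, $M$ and $T$, with the following two properties. (1) For all $t\in[T_{***},T_{***}+T]$ and all $x_0\in\mathbb{T}^d$, $$\int_{\mathbb{R}^d}T_t(\delta_{x_0}\otimes\nu_v)\,dv\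 \ge\ \beta_{***}\,\nu_x ,$$ the left-hand side denoting the marginal in $x$. (2) Let $p:\mathbb{R}^d\times\mathbb{R}^d\to[0,\infty)$ be a measurable scattering function with $\int p(v,v')\,dv=1$ for all $v'$, with $p(v,v')\ge M(|v|)$ for all $v,v'$, and for which the Maxwellian is an equilibrium, i.e. $\int p(v,v')\mathcal{M}(v')\,dv'=\mathcal{M}(v)$ for almost every $v$ (for instance $p(v,v')=\mathcal{M}(v)$). Let $\sigma\in C^0(\mathbb{T}^d)$, $\sigma\ge 0$, and $\kappa>0$ satisfy the geometric control condition $$\inf_{(x,v)\in\mathbb{T}^d\times\mathbb{R}^d}\int_0^T\sigma(\Phi^X_t(x,v))\,dt\ \ge\ \kappa .$$ Let $\mu_0$ be a probability measure on $\mathbb{T}^d\times\mathbb{R}^d$ and $(\mu_t)_{t\ge0}$ a measure solution with initial datum $\mu_0$ of $$\partial_t\mu+v\cdot\nabla_x\mu-\nabla W\cdot\nabla_v\mu=\sigma\,(L^+\mu-\mu),\qquad L^+\mu(dx,dv)=\Big(\int p(v,v')\,\mu(dx,dv')\Big)dv ,$$ that is, a weakly continuous family of probability measures such that for every $\tau>0$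 and every $\phi\in C^1_c([0,\tau)\times\mathbb{T}^d\times\mathbb{R}^d)$ $$\int_0^\tau\!\!\iint\Big(\partial_t\phi+v\cdot\nabla_x\phi-\nabla W\cdot\nabla_v\phi+\sigma(x)\Big(\int p(w,v)\phi(t,x,w)\,dw-\phi\Big)\Big)d\mu_t\,dt=-\iint\phi(0,x,v)\,d\mu_0 .$$ Then $$\|\mu_t-\nu\|_{TV}\le e^{-\lambda(t-2T-T_{***})}\,\|\mu_0-\nu\|_{TV}\qquad\text{for all }t\ge0,$$ with the rate $$\lambda=-\frac{1}{2T+T_{***}}\log\Big(1-\beta_{***}\kappa^2e^{-(2T+T_{***})\|\sigma\|_\infty}\Big)>0 .$$ -/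

import Mathlib

open MeasureTheory

namespace LinearBoltzmann

/-! ### The torus, derivatives on the torus -/

/-- The velocity space `ℝ^d`, with its Euclidean norm. -/
abbrev Vel (d : ℕ) : Type := EuclideanSpace ℝ (Fin d)

/-- The torus `𝕋^d = ℝ^d / ℤ^d`; its `volume` is the Lebesgue measure, of total mass one. -/
abbrev Torus (d : ℕ) : Type := UnitAddTorus (Fin d)

/-- The canonical projection `ℝ^d → 𝕋^d`. -/
def proj {d : ℕ} (y : Vel d) : Torus d := fun i => (y i : UnitAddCircle)

/-- `W` is of class `C²` on the torus: its periodic lift to `ℝ^d` is of class `C²`. -/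
def TorusC2 {d : ℕ} (W : Torus d → ℝ) : Prop :=
  ContDiff ℝ 2 (fun y : Vel d => W (proj y))

/-- The gradient `∇ₓ f (x)` of a function on the torus, computed in the chart `y ↦ x + y`
centred at `x`. -/
noncomputable def torusGrad {d : ℕ} (f : Torus d → ℝ) (x : Torus d) : Vel d :=
  gradient (fun y : Vel d => f (x + proj y)) 0

/-! ### The characteristic flow -/

/-- `γ = (Y, V)` describes the characteristic issued from `(x, v)`: the position at time `t` is
`x + Y t`, where `Y` is the displacement in `ℝ^d`, and `Y' = V`, `V' = -∇W(x + Y)`,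
`Y 0 = 0`, `V 0 = v`. -/
def IsCharacteristic {d : ℕ} (W : Torus d → ℝ) (x : Torus d) (v : Vel d)
    (γ : ℝ → Vel d × Vel d) : Prop :=
  γ 0 = (0, v) ∧
    ∀ t : ℝ, HasDerivAt γ ((γ t).2, -torusGrad W (x + proj (γ t).1)) t

theorem proj_add {d : ℕ} (y z : Vel d) : proj (y + z) = proj y + proj z := by
  funext i; simp [proj]

theorem proj_surjective {d : ℕ} : Function.Surjective (proj (d := d)) := by
  intro x
  choose a ha using fun i => QuotientAddGroup.mk_surjective (x i)
  exact ⟨WithLp.toLp 2 a, funext fun i => ha i⟩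

/-- A globally Lipschitz vector field of class `C¹` has global integral curves. -/
theorem exists_global_curve {E : Type*} [NormedAddCommGroup E] [NormedSpace ℝ E]
    [CompleteSpace E] {f : E → E} {K : NNReal} (hf : ContDiff ℝ 1 f) (hK : LipschitzWith K f)
    (x : E) : ∃ γ : ℝ → E, γ 0 = x ∧ ∀ t, HasDerivAt γ (f (γ t)) t := by
  have hv : ContMDiff (modelWithCornersSelf ℝ E) (modelWithCornersSelf ℝ E).tangent 1
      (fun x : E => (⟨x, f x⟩ : TangentBundle (modelWithCornersSelf ℝ E) E)) :=
    contMDiff_vectorSpace_iff_contDiff.2 hf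
  have hpos : (0 : ℝ) < 1 / (2 * (K + 1)) := by positivity
  obtain ⟨γ, h0, hγ⟩ := exists_isMIntegralCurve_of_isMIntegralCurveOn hv hpos (fun z => by
    set ε : ℝ := 1 / (2 * (K + 1)) with hε
    let a : NNReal := ‖f z‖₊ + 1
    have hz : (0 : ℝ) ∈ Set.Icc (-ε) ε := ⟨by linarith, hpos.le⟩
    have hPL : IsPicardLindelof (fun _ => f) (⟨0, hz⟩ : Set.Icc (-ε) ε) z a 0
        (‖f z‖₊ + K * a) K := by
      refine IsPicardLindelof.of_time_independent ?_ (hK.lipschitzOnWith) ?_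
      · intro y hy
        have h1 : ‖f y - f z‖ ≤ K * a := by
          rw [← dist_eq_norm]
          exact (hK.dist_le_mul y z).trans
            (mul_le_mul_of_nonneg_left (Metric.mem_closedBall.1 hy) K.2)
        have h2 : ‖f y‖ ≤ ‖f z‖ + ‖f y - f z‖ := by
          simpa using norm_add_le (f z) (f y - f z)
        push_cast
        linarith
      · have hK0 : (0 : ℝ) ≤ K := K.2
        have hn : (0 : ℝ) ≤ ‖f z‖ := norm_nonneg _
        simp only [sub_zero, zero_sub, neg_neg, max_self, a]
        push_cast
        rw [hε, mul_one_div, div_le_iff₀ (by positivity)]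
        nlinarith [mul_nonneg hK0 hn]
    obtain ⟨α, hα0, hα⟩ := hPL.exists_eq_forall_mem_Icc_hasDerivWithinAt₀
    refine ⟨α, hα0, fun t ht => ?_⟩
    have := (hα t (Set.Ioo_subset_Icc_self ht)).mono Set.Ioo_subset_Icc_self
    exact this.hasFDerivWithinAt.hasMFDerivWithinAt) x
  refine ⟨γ, h0, fun t => ?_⟩
  have h : HasFDerivAt γ ((1 : ℝ →L[ℝ] ℝ).smulRight (f (γ t))) t :=
    hasMFDerivAt_iff_hasFDerivAt.1 (hγ t)
  simpa using h.hasDerivAt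

theorem contDiff_shift {d : ℕ} {W : Torus d → ℝ} (hW : TorusC2 W) (x : Torus d) :
    ContDiff ℝ 2 (fun y : Vel d => W (x + proj y)) := by
  obtain ⟨z, rfl⟩ := proj_surjective x
  simp only [← proj_add]
  exact ContDiff.comp (g := fun y : Vel d => W (proj y)) hW (contDiff_const.add contDiff_id)

theorem torusGrad_shift {d : ℕ} (W : Torus d → ℝ) (x : Torus d) (y : Vel d) :
    torusGrad W (x + proj y) = gradient (fun z : Vel d => W (x + proj z)) y := by
  unfold torusGrad gradient
  congr 1
  have h : (fun z : Vel d => W (x + proj y + proj z))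
      = fun z => (fun z : Vel d => W (x + proj z)) (y + z) := by
    funext z; simp only [proj_add, add_assoc]
  have h1 := fderiv_comp_add_left (𝕜 := ℝ) (f := fun z : Vel d => W (x + proj z))
    (x := (0 : Vel d)) y
  rw [add_zero] at h1
  rw [h, h1]

theorem contDiff_torusGrad {d : ℕ} {W : Torus d → ℝ} (hW : TorusC2 W) (x : Torus d) :
    ContDiff ℝ 1 (fun y : Vel d => torusGrad W (x + proj y)) := by
  simp only [torusGrad_shift]
  unfold gradient
  exact (InnerProductSpace.toDual ℝ (Vel d)).symm.toContinuousLinearEquiv.contDiff.comp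
    ((contDiff_shift hW x).fderiv_right (m := 1) (by norm_num))

/-- A periodic `C¹` map on `ℝ^d` is globally Lipschitz. -/
theorem exists_lipschitz {d : ℕ} {W : Torus d → ℝ} (hW : TorusC2 W) (x : Torus d) :
    ∃ K : NNReal, LipschitzWith K (fun y : Vel d => torusGrad W (x + proj y)) := by
  set g : Vel d → Vel d := fun y => torusGrad W (x + proj y) with hg
  have hg1 : ContDiff ℝ 1 g := contDiff_torusGrad hW x
  have hcpt : IsCompact (WithLp.toLp 2 '' (Set.Icc (0 : Fin d → ℝ) 1) : Set (Vel d)) :=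
    isCompact_Icc.image (PiLp.continuous_toLp 2 _)
  obtain ⟨C, hC⟩ := hcpt.exists_bound_of_continuousOn
    (hg1.continuous_fderiv (by norm_num)).continuousOn
  have hbound : ∀ y, ‖fderiv ℝ g y‖ ≤ C := by
    intro y
    let q : Vel d := WithLp.toLp 2 (fun i => Int.fract (y i))
    have hq : q ∈ (WithLp.toLp 2 '' (Set.Icc (0 : Fin d → ℝ) 1) : Set (Vel d)) :=
      ⟨fun i => Int.fract (y i), ⟨fun i => Int.fract_nonneg _,
        fun i => (Int.fract_lt_one _).le⟩, rfl⟩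
    have hpq : proj q = proj y := by
      funext i
      change ((Int.fract (y i) : ℝ) : UnitAddCircle) = ((y i : ℝ) : UnitAddCircle)
      rw [QuotientAddGroup.eq]
      refine AddSubgroup.mem_zmultiples_iff.2 ⟨⌊y i⌋, ?_⟩
      have := Int.floor_add_fract (y i)
      simp only [zsmul_eq_mul, mul_one]
      linarith
    have hshift : fderiv ℝ g y = fderiv ℝ g q := by
      have h1 := fderiv_comp_add_left (𝕜 := ℝ) (f := g) (x := (0 : Vel d)) y
      have h2 := fderiv_comp_add_left (𝕜 := ℝ) (f := g) (x := (0 : Vel d)) q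
      rw [add_zero] at h1 h2
      rw [← h1, ← h2]
      congr 1
      funext z
      simp only [hg, proj_add, hpq]
    rw [hshift]
    exact hC q hq
  refine ⟨C.toNNReal, lipschitzWith_of_nnnorm_fderiv_le (hg1.differentiable (by norm_num))
    fun y => ?_⟩
  rw [← NNReal.coe_le_coe, coe_nnnorm]
  exact (hbound y).trans (Real.le_coe_toNNReal C)

/-- Global existence and uniqueness of the characteristics of a `C²` potential. -/
theorem existsUnique_characteristic {d : ℕ} {W : Torus d → ℝ} (hW : TorusC2 W)
    (x : Torus d) (v : Vel d) : ∃! γ, IsCharacteristic W x v γ := by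
  obtain ⟨K, hK⟩ := exists_lipschitz hW x
  let f : Vel d × Vel d → Vel d × Vel d := fun z => (z.2, -torusGrad W (x + proj z.1))
  have hf : ContDiff ℝ 1 f :=
    contDiff_snd.prodMk ((contDiff_torusGrad hW x).comp contDiff_fst).neg
  have hL : LipschitzWith (max 1 (K * 1)) f :=
    LipschitzWith.prod_snd.prodMk (hK.comp LipschitzWith.prod_fst).neg
  obtain ⟨γ, h0, hγ⟩ := exists_global_curve hf hL (0, v)
  refine ⟨γ, ⟨h0, hγ⟩, fun η hη => ?_⟩
  exact ODE_solution_unique_univ (v := fun _ => f) (s := fun _ => Set.univ) (t₀ := 0)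
    (fun _ => hL.lipschitzOnWith) (fun t => ⟨hη.2 t, trivial⟩) (fun t => ⟨hγ t, trivial⟩)
    (hη.1.trans h0.symm)

/-- The characteristic flow `Φ_t (x, v) = (Φ^X_t (x, v), Φ^V_t (x, v))` of the potential `W`. -/
noncomputable def flow {d : ℕ} {W : Torus d → ℝ} (hW : TorusC2 W) (t : ℝ)
    (z : Torus d × Vel d) : Torus d × Vel d :=
  let γ := (existsUnique_characteristic hW z.1 z.2).exists.choose
  (z.1 + proj (γ t).1, (γ t).2)

/-- The transport semigroup on measures: `T_t μ` is the image of `μ` under `Φ_t`, that is, the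
solution at time `t` of `∂_t μ + v · ∇ₓ μ - ∇W · ∇ᵥ μ = 0` issued from `μ`. -/
noncomputable def transport {d : ℕ} {W : Torus d → ℝ} (hW : TorusC2 W) (t : ℝ)
    (μ : Measure (Torus d × Vel d)) : Measure (Torus d × Vel d) :=
  μ.map (flow hW t)

/-- The geometric control condition, with time `T` and constant `κ`. -/
def GeometricControl {d : ℕ} {W : Torus d → ℝ} (hW : TorusC2 W) (σ : C(Torus d, ℝ))
    (T κ : ℝ) : Prop :=
  0 < T ∧ 0 < κ ∧ ∀ z : Torus d × Vel d, κ ≤ ∫ t in (0 : ℝ)..T, σ (flow hW t z).1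

/-! ### The equilibrium -/

/-- The normalised Maxwellian `(2π)^{-d/2} exp(-|v|²/2)`. -/
noncomputable def maxwellian {d : ℕ} (v : Vel d) : ℝ :=
  (2 * Real.pi) ^ (-(d : ℝ) / 2) * Real.exp (-‖v‖ ^ 2 / 2)

/-- `ν_v`, the Maxwellian measure on `ℝ^d`. -/
noncomputable def nuV (d : ℕ) : Measure (Vel d) :=
  volume.withDensity (fun v => ENNReal.ofReal (maxwellian v))

/-- `ν_x = Z⁻¹ e^{-W(x)} dx`, with `Z = ∫ e^{-W(x)} dx`. -/
noncomputable def nuX {d : ℕ} (W : Torus d → ℝ) : Measure (Torus d) :=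
  volume.withDensity
    (fun x => ENNReal.ofReal (Real.exp (-W x) / ∫ y : Torus d, Real.exp (-W y)))

/-- The equilibrium `ν = ν_x ⊗ ν_v`. -/
noncomputable def nu {d : ℕ} (W : Torus d → ℝ) : Measure (Torus d × Vel d) :=
  (nuX W).prod (nuV d)

/-! ### Scattering kernels and measure solutions -/

/-- `p v v'` is the density at `v` of the velocity after a jump from velocity `v'`; `p` is
measurable, nonnegative and conserves mass. -/
structure IsScatteringKernel {d : ℕ} (p : Vel d → Vel d → ℝ) : Prop where
  measurable : Measurable (fun z : Vel d × Vel d => p z.1 z.2)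
  nonneg : ∀ v v', 0 ≤ p v v'
  mass : ∀ v', ∫ v, p v v' = 1

/-- The Maxwellian is an equilibrium of the scattering operator:
`∫ p(v, v') 𝓜(v') dv' = 𝓜(v)` for almost every `v`. -/
def PreservesMaxwellian {d : ℕ} (p : Vel d → Vel d → ℝ) : Prop :=
  ∀ᵐ v : Vel d, ∫ v', p v v' * maxwellian v' = maxwellian v

/-- Test functions in `C¹_c([0, τ) × 𝕋^d × ℝ^d)` (as restrictions to `t ≥ 0` of `C¹` functions
defined for all times). -/
structure IsTestFunction {d : ℕ} (τ : ℝ) (φ : ℝ → Torus d → Vel d → ℝ) : Prop where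
  contDiff : ContDiff ℝ 1 (fun z : ℝ × Vel d × Vel d => φ z.1 (proj z.2.1) z.2.2)
  compact : HasCompactSupport (fun z : ℝ × Torus d × Vel d => φ z.1 z.2.1 z.2.2)
  support : ∀ z ∈ tsupport (fun z : ℝ × Torus d × Vel d => φ z.1 z.2.1 z.2.2), z.1 < τ

/-- The (backward) operator of the equation applied to `φ` at `(t, x, v)`:
`∂_t φ + v · ∇ₓ φ - ∇W · ∇ᵥ φ + σ (∫ p(w, v) φ(t, x, w) dw - φ)`. -/
noncomputable def backwardOp {d : ℕ} (W : Torus d → ℝ) (σ : C(Torus d, ℝ))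
    (p : Vel d → Vel d → ℝ) (φ : ℝ → Torus d → Vel d → ℝ)
    (t : ℝ) (x : Torus d) (v : Vel d) : ℝ :=
  deriv (fun s => φ s x v) t
    + inner ℝ v (torusGrad (fun y => φ t y v) x)
    - inner ℝ (torusGrad W x) (gradient (fun w => φ t x w) v)
    + σ x * ((∫ w, p w v * φ t x w) - φ t x v)

/-- `μ` is a measure solution on `[0, τ]`, with initial datum `μ₀`, of
`∂_t μ + v · ∇ₓ μ - ∇W · ∇ᵥ μ = σ (L⁺ μ - μ)`, where
`L⁺ μ (dx, dv) = (∫ p(v, v') μ(dx, dv')) dv`: it is weakly continuous in time with values in the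
probability measures, and satisfies the equation against all test functions. -/
def IsMeasureSolutionOn {d : ℕ} (W : Torus d → ℝ) (σ : C(Torus d, ℝ)) (p : Vel d → Vel d → ℝ)
    (τ : ℝ) (μ₀ : ProbabilityMeasure (Torus d × Vel d))
    (μ : ℝ → ProbabilityMeasure (Torus d × Vel d)) : Prop :=
  ContinuousOn μ (Set.Icc 0 τ) ∧
    ∀ φ : ℝ → Torus d → Vel d → ℝ, IsTestFunction τ φ →
      ∫ t in (0 : ℝ)..τ, (∫ z, backwardOp W σ p φ t z.1 z.2 ∂(μ t : Measure (Torus d × Vel d)))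
        = -∫ z, φ 0 z.1 z.2 ∂(μ₀ : Measure (Torus d × Vel d))

/-- `(μ_t)_{t ≥ 0}` is a measure solution with initial datum `μ₀`. -/
def IsMeasureSolution {d : ℕ} (W : Torus d → ℝ) (σ : C(Torus d, ℝ)) (p : Vel d → Vel d → ℝ)
    (μ₀ : ProbabilityMeasure (Torus d × Vel d))
    (μ : ℝ → ProbabilityMeasure (Torus d × Vel d)) : Prop :=
  ∀ τ : ℝ, 0 < τ → IsMeasureSolutionOn W σ p τ μ₀ μ

/-! ### Total variation, and the rate -/

/-- `‖μ - ν‖_TV = sup {∫ φ dμ - ∫ φ dν : φ ∈ C_b, ‖φ‖_∞ ≤ 1}`, for finite measures `μ`, `ν`. -/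
noncomputable def tvDist {X : Type*} [TopologicalSpace X] [MeasurableSpace X]
    (μ ν : Measure X) : ℝ :=
  sSup {r : ℝ | ∃ φ : BoundedContinuousFunction X ℝ,
    ‖φ‖ ≤ 1 ∧ r = (∫ x, φ x ∂μ) - ∫ x, φ x ∂ν}

/-- `λ = -(2T + T₀)⁻¹ log(1 - β κ² e^{-(2T + T₀) s})`. -/
noncomputable def decayRate (T T₀ β κ s : ℝ) : ℝ :=
  -(1 / (2 * T + T₀)) * Real.log (1 - β * κ ^ 2 * Real.exp (-(2 * T + T₀) * s))

end LinearBoltzmann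

open LinearBoltzmann

/-! The argument is Doeblin's. Over a time `2 * T + T₀` the evolution, whatever the starting state,
dominates one fixed measure of mass at least `β κ² e^{-(2T+T₀)‖σ‖}`. Two solutions therefore lose
that share of their total variation distance (`GapLE.contract`). Since the equilibrium is itself a
solution, iterating over whole periods gives the rate (`tvDist_nu_le`).

The common lower bound comes from trajectories with exactly two collisions
(`ofReal_mul_minorant_le_dysonSeries`). The first occurs at a time `r < T`; by geometric control the
rate integrated along the trajectory is at least `κ`, and the new velocity has density at least `M
R` on the ball of radius `R`. The flow then runs for a time `s - r` between `T₀` and `2 * T + T₀`,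
after which the position has a law bounded below by a multiple of `ν_x`, uniformly in the starting
point. The second collision, at `s` between `T + T₀` and `2 * T + T₀`, makes the velocity forget its
past as well. The mass of the resulting measure contains `T ∫ σ dν_x`, and integrating the control
condition against the invariant measure `ν` bounds this below by `κ`: this is the second factor `κ`
(`le_minorant_univ`).

The spreading of positions (`exists_le_map_flow`) holds for every positive time, with no
invertibility of the velocity-to-position map. On the universal cover this map stays at bounded
distance from `w ↦ t w`, because `∇W` is bounded, so it is onto by a Brouwer-type theorem
(`surjective_of_lipschitzWith_of_norm_sub_le`). It is Lipschitz, so it expands volume by a bounded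
factor. Being onto and expanding little, it must push Lebesgue measure on a ball of velocities to a
measure bounded below on the torus.

The solutions are only weak, so the probabilistic picture has to be recovered from the equation.
Testing against `θ(s) ψ(Φ_{t-s})` removes the transport term; such functions are merely Lipschitz
and are mollified in time and phase space, the error being a commutator of first order in the
mollification scale (`exists_isTestFunction_approx`). A scalar weak differential equation
(`eq_of_weak_ode`) then yields Duhamel's formula. Fictitious jumps at rate `c - σ` make the total
jump rate a constant `c`, so that the measures `e^{ct} μ_t` satisfy a formula whose terms are all
nonnegative; iterating it expresses `e^{ct} μ_t` as a Dyson series in the number of jumps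
(`IsMild.lintegral_eq_dysonSeries`), whose term with two jumps is the one minorised above. -/

namespace LinearBoltzmann

/-! ### Lipschitz perturbations of the identity are onto -/

/-- The radial retraction of a normed space onto its closed ball of radius `R`. -/
noncomputable def clamp {E : Type*} [NormedAddCommGroup E] [NormedSpace ℝ E] (R : ℝ) (w : E) : E :=
  (R / max R ‖w‖) • w

section Clamp

variable {E : Type*} [NormedAddCommGroup E] [NormedSpace ℝ E] {R : ℝ}

theorem clamp_of_le (hR : 0 < R) {w : E} (hw : ‖w‖ ≤ R) : clamp R w = w := by
  simp [clamp, max_eq_left hw, div_self hR.ne']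

theorem norm_clamp_of_le (hR : 0 < R) {w : E} (hw : R ≤ ‖w‖) : ‖clamp R w‖ = R := by
  have : 0 < ‖w‖ := hR.trans_le hw
  rw [clamp, max_eq_right hw, norm_smul, Real.norm_of_nonneg (by positivity)]
  field_simp

/-- One unit of the constant comes from moving the vector at a fixed scaling factor, the other from
the change of the factor, which the reverse triangle inequality controls. -/
theorem lipschitzWith_clamp (hR : 0 < R) : LipschitzWith 2 (clamp R : E → E) := by
  refine LipschitzWith.of_dist_le_mul fun w u => ?_
  rw [dist_eq_norm, dist_eq_norm, clamp, clamp]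
  set a := max R ‖w‖ with ha
  set b := max R ‖u‖ with hb
  have ha0 : 0 < a := hR.trans_le (le_max_left _ _)
  have hb0 : 0 < b := hR.trans_le (le_max_left _ _)
  have hab : |b - a| ≤ ‖w - u‖ := by
    have h1 := abs_max_sub_max_le_abs ‖u‖ ‖w‖ R
    rw [max_comm ‖u‖, max_comm ‖w‖] at h1
    refine h1.trans ?_
    rw [norm_sub_rev]
    exact abs_norm_sub_norm_le u w
  have key : (R / a) • w - (R / b) • u = (R / a) • (w - u) + ((R / a) * ((b - a) / b)) • u := by
    have : (R / a) * ((b - a) / b) = R / a - R / b := by field_simp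
    rw [this]; module
  have h1 : R / a ≤ 1 := (div_le_one ha0).2 (le_max_left _ _)
  have h1' : 0 ≤ R / a := by positivity
  have h2 : ‖u‖ / b ≤ 1 := (div_le_one hb0).2 (le_max_right _ _)
  rw [key]
  refine (norm_add_le _ _).trans ?_
  rw [norm_smul, norm_smul, Real.norm_eq_abs, Real.norm_eq_abs, abs_mul,
    abs_of_nonneg h1', abs_div, abs_of_pos hb0]
  have h3 : R / a * (|b - a| / b) * ‖u‖ ≤ ‖w - u‖ := by
    calc R / a * (|b - a| / b) * ‖u‖ = R / a * (|b - a| * (‖u‖ / b)) := by ring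
      _ ≤ 1 * (|b - a| * 1) := by gcongr
      _ ≤ _ := by simpa using hab
  have h4 : R / a * ‖w - u‖ ≤ 1 * ‖w - u‖ := by gcongr
  push_cast
  linarith

end Clamp

/-- A Lipschitz map multiplies Lebesgue measure by at most the `dim`-th power of its constant. -/
theorem addHaar_image_le_of_lipschitzWith {E : Type*} [NormedAddCommGroup E] [NormedSpace ℝ E]
    [FiniteDimensional ℝ E] [MeasurableSpace E] [BorelSpace E] (μ : Measure E)
    [μ.IsAddHaarMeasure] {f : E → E} {K : NNReal} (hf : LipschitzWith K f) (s : Set E) :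
    μ (f '' s) ≤ (K : ENNReal) ^ Module.finrank ℝ E * μ s := by
  -- Haar measure is a multiple of the Hausdorff measure of full dimension, whose behaviour under
  -- Lipschitz maps is immediate from its definition.
  have h := Measure.isAddLeftInvariant_eq_smul μ (Measure.hausdorffMeasure (Module.finrank ℝ E : ℝ))
  have h1 := hf.hausdorffMeasure_image_le (d := (Module.finrank ℝ E : ℝ)) (by positivity) s
  rw [h]
  simp only [Measure.smul_apply, ENNReal.smul_def, smul_eq_mul]
  rw [ENNReal.rpow_natCast] at h1
  rw [mul_left_comm]
  gcongr

/-- The value of `det (1 + A)` is a fixed combination of values of `det (1 + s A)` at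
arbitrarily small parameters `s`. -/
theorem exists_det_interpolation (E : Type*) [NormedAddCommGroup E] [NormedSpace ℝ E]
    [FiniteDimensional ℝ E] {δ : ℝ} (hδ : 0 < δ) :
    ∃ (n : ℕ) (s a : ℕ → ℝ), (∀ i, 0 < s i ∧ s i ≤ δ) ∧ ∑ i ∈ Finset.range n, a i = 1 ∧
      ∀ A : E →L[ℝ] E, (1 + A).det = ∑ i ∈ Finset.range n, a i * (1 + s i • A).det := by
  classical
  let s : ℕ → ℝ := fun i => δ / (i + 1)
  have hs : Function.Injective s := by
    intro i j hij
    have h2 : (0 : ℝ) < i + 1 := by positivity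
    have h3 : (0 : ℝ) < j + 1 := by positivity
    simp only [s] at hij
    rw [div_eq_div_iff h2.ne' h3.ne'] at hij
    have := mul_left_cancel₀ hδ.ne' hij
    exact_mod_cast (add_right_cancel this).symm
  -- `det (1 + s A)` is a polynomial in `s` of degree at most the dimension, so this many distinct
  -- nodes determine it. The weights are the Lagrange basis polynomials evaluated at `1`, hence
  -- independent of `A`.
  set n := Module.finrank ℝ E + 1
  have hsn : Set.InjOn s (Finset.range n : Set ℕ) := hs.injOn
  refine ⟨n, s, fun i => (Lagrange.basis (Finset.range n) s i).eval 1, fun i => ⟨by positivity, ?_⟩,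
    ?_, fun A => ?_⟩
  · exact div_le_self hδ.le (by simp)
  · rw [← Polynomial.eval_finsetSum, Lagrange.sum_basis hsn (by simp [n]), Polynomial.eval_one]
  · let b := Module.finBasis ℝ E
    let q : Polynomial ℝ := ((Polynomial.X : Polynomial ℝ) • (LinearMap.toMatrix b b (A : E →ₗ[ℝ] E)).map Polynomial.C
      + (1 : Matrix (Fin (Module.finrank ℝ E)) (Fin (Module.finrank ℝ E)) ℝ).map Polynomial.C).det
    have hq : ∀ t : ℝ, q.eval t = (1 + t • A).det := by
      intro t
      have h1 : (1 + t • A).det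
          = (t • LinearMap.toMatrix b b (A : E →ₗ[ℝ] E) + 1).det := by
        rw [ContinuousLinearMap.det, ← LinearMap.det_toMatrix b]
        congr 1
        rw [add_comm]
        simp [LinearMap.toMatrix_one]
      rw [h1]
      simp only [q]
      rw [← Polynomial.coe_evalRingHom, RingHom.map_det]
      congr 1
      ext i j
      rcases eq_or_ne i j with rfl | hij
      · simp [mul_comm t]
      · simp [hij, mul_comm t]
    have hdeg : q.degree < (Finset.range n).card := by
      rw [Finset.card_range]
      have := Polynomial.natDegree_det_X_add_C_le (LinearMap.toMatrix b b (A : E →ₗ[ℝ] E)) 1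
      rw [Fintype.card_fin] at this
      exact (Polynomial.degree_le_of_natDegree_le this).trans_lt (by exact_mod_cast Nat.lt_succ_self _)
    have h2 := congrArg (Polynomial.eval 1) (Lagrange.eq_interpolate hsn hdeg)
    rw [Lagrange.interpolate_apply, Polynomial.eval_finsetSum] at h2
    simp only [Polynomial.eval_mul, Polynomial.eval_C, hq, one_smul] at h2
    rw [h2]
    exact Finset.sum_congr rfl fun i _ => mul_comm _ _

/-- There is no Lipschitz retraction of a ball onto its boundary sphere. -/
theorem not_exists_lipschitz_retraction {E : Type*} [NormedAddCommGroup E] [InnerProductSpace ℝ E]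
    [FiniteDimensional ℝ E] [MeasurableSpace E] [BorelSpace E] {g : E → E} {K : NNReal}
    (hg : LipschitzWith K g) {R : ℝ} (hR : 0 < R) (h0 : ∀ w, R ≤ ‖w‖ → g w = 0)
    (hsph : ∀ w, ‖w‖ < R → ‖w + g w‖ = R) : False := by
  let μ : Measure E := volume
  have hdet : ∃ r > 0, ∀ A : E →L[ℝ] E, ‖A‖ < r → 0 < (1 + A).det := by
    have hc : Continuous fun A : E →L[ℝ] E => (1 + A).det :=
      ContinuousLinearMap.continuous_det.comp (continuous_const.add continuous_id)
    have h1 : ∀ᶠ A in nhds (0 : E →L[ℝ] E), 0 < (1 + A).det := by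
      refine hc.continuousAt.eventually (lt_mem_nhds ?_)
      simp [ContinuousLinearMap.det]
    obtain ⟨r, hr, h⟩ := Metric.eventually_nhds_iff.1 h1
    exact ⟨r, hr, fun A hA => h (by simpa using hA)⟩
  obtain ⟨r, hr, hdet⟩ := hdet
  -- For `t ≤ δ` the first bound makes `t • g` a strict contraction, the second keeps `t • Dg` in
  -- the neighbourhood of `0` where the determinant is positive.
  set δ : ℝ := min (1 / (2 * (K + 1))) (r / (2 * (K + 1))) with hδdef
  have hK0 : (0 : ℝ) ≤ K := K.2
  have hδ : 0 < δ := by positivity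
  obtain ⟨n, s, a, hs, ha, hint⟩ := exists_det_interpolation E hδ
  set D : Set E := {w | DifferentiableAt ℝ g w} with hD
  have hDm : MeasurableSet D := measurableSet_of_differentiableAt ℝ g
  have hDn : μ Dᶜ = 0 := hg.ae_differentiableAt
  set B : Set E := Metric.ball 0 R with hB
  have hnorm : ∀ w, ‖fderiv ℝ g w‖ ≤ K := fun w => norm_fderiv_le_of_lipschitz ℝ hg
  -- For small `t` the map `w + t • g w` is a bijection of `E`, by the contraction principle, and is
  -- the identity outside the ball; so it maps the ball onto itself and its Jacobian integrates to
  -- the volume of the ball.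
  have hmain : ∀ t : ℝ, 0 < t → t ≤ δ →
      IntegrableOn (fun w => (1 + t • fderiv ℝ g w).det) (B ∩ D) μ ∧
      ∫ w in B ∩ D, (1 + t • fderiv ℝ g w).det ∂μ = (μ B).toReal := by
    intro t ht htδ
    have htK : t * K < 1 := by
      have : t ≤ 1 / (2 * (K + 1)) := htδ.trans (min_le_left _ _)
      rw [le_div_iff₀ (by positivity)] at this
      nlinarith
    have htr : t * K < r := by
      have : t ≤ r / (2 * (K + 1)) := htδ.trans (min_le_right _ _)
      rw [le_div_iff₀ (by positivity)] at this
      nlinarith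
    set f : E → E := fun w => w + t • g w with hf
    have hgt : LipschitzWith (t.toNNReal * K) fun w => t • g w := by
      refine LipschitzWith.of_dist_le_mul fun w u => ?_
      rw [dist_eq_norm, ← smul_sub, norm_smul, ← dist_eq_norm, Real.norm_of_nonneg ht.le]
      push_cast
      rw [Real.coe_toNNReal _ ht.le, mul_assoc]
      exact mul_le_mul_of_nonneg_left (hg.dist_le_mul w u) ht.le
    have hc1 : t.toNNReal * K < 1 := by
      rw [← NNReal.coe_lt_coe]; push_cast; rwa [Real.coe_toNNReal _ ht.le]
    have hinj : Function.Injective f := by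
      intro w u hwu
      have h1 : w - u = t • g u - t • g w := by
        have : w + t • g w = u + t • g u := hwu
        rw [sub_eq_sub_iff_add_eq_add, this, add_comm]
      have h2 := hgt.dist_le_mul u w
      rw [dist_eq_norm, ← h1, dist_eq_norm, norm_sub_rev u w] at h2
      push_cast at h2
      rw [Real.coe_toNNReal _ ht.le] at h2
      have : ‖w - u‖ = 0 := by
        by_contra hne
        have : 0 < ‖w - u‖ := lt_of_le_of_ne (norm_nonneg _) (Ne.symm hne)
        nlinarith
      exact sub_eq_zero.1 (norm_eq_zero.1 this)
    have hsurj : Function.Surjective f := by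
      intro y
      have hcon : ContractingWith (t.toNNReal * K) fun w => y - t • g w := by
        refine ⟨hc1, LipschitzWith.of_dist_le_mul fun w u => ?_⟩
        rw [dist_sub_left]
        exact hgt.dist_le_mul w u
      refine ⟨hcon.fixedPoint, ?_⟩
      have h1 := hcon.fixedPoint_isFixedPt
      have h2 : y - t • g hcon.fixedPoint = hcon.fixedPoint := h1
      simp only [hf]
      nth_rewrite 1 [← h2]
      simp
    have hout : ∀ w, R ≤ ‖w‖ → f w = w := fun w hw => by simp [hf, h0 w hw]
    have himg : f '' B = B := by
      ext y
      simp only [hB, Set.mem_image, mem_ball_zero_iff]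
      constructor
      · rintro ⟨w, hw, rfl⟩
        by_contra hcon
        have := hinj (hout _ (not_lt.1 hcon))
        rw [this] at hcon
        exact hcon hw
      · intro hy
        obtain ⟨w, rfl⟩ := hsurj y
        refine ⟨w, ?_, rfl⟩
        by_contra hcon
        rw [hout w (not_lt.1 hcon)] at hy
        exact hcon hy
    have hfl : LipschitzWith (1 + t.toNNReal * K) f := LipschitzWith.id.add hgt
    have hvol : μ (f '' (B ∩ D)) = μ B := by
      apply le_antisymm
      · calc μ (f '' (B ∩ D)) ≤ μ (f '' B) := by gcongr; exact Set.inter_subset_left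
          _ = μ B := by rw [himg]
      -- By Rademacher's theorem the set where `g` is not differentiable is null, and a Lipschitz
      -- map sends null sets to null sets.
      · have hnull : μ (f '' Dᶜ) = 0 := by
          have := addHaar_image_le_of_lipschitzWith μ hfl Dᶜ
          rw [hDn, mul_zero] at this
          exact le_antisymm this bot_le
        calc μ B = μ (f '' B) := by rw [himg]
          _ ≤ μ (f '' (B ∩ D) ∪ f '' Dᶜ) := by
            gcongr
            rw [← Set.image_union]
            apply Set.image_mono
            intro w hw
            by_cases hwD : w ∈ D
            · exact Or.inl ⟨hw, hwD⟩
            · exact Or.inr hwD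
          _ ≤ μ (f '' (B ∩ D)) + 0 := by rw [← hnull]; exact measure_union_le _ _
          _ = _ := add_zero _
    have hderiv : ∀ w ∈ B ∩ D,
        HasFDerivWithinAt f (1 + t • fderiv ℝ g w) (B ∩ D) w := fun w hw =>
      ((hasFDerivAt_id w).add (hw.2.hasFDerivAt.const_smul t)).hasFDerivWithinAt
    have hBD : MeasurableSet (B ∩ D) := measurableSet_ball.inter hDm
    have hl := lintegral_abs_det_fderiv_eq_addHaar_image μ hBD hderiv hinj.injOn
    rw [hvol] at hl
    have hpos : ∀ w, 0 < (1 + t • fderiv ℝ g w).det := fun w => hdet _ (by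
      rw [norm_smul, Real.norm_of_nonneg ht.le]
      exact (mul_le_mul_of_nonneg_left (hnorm w) ht.le).trans_lt htr)
    simp only [abs_of_pos (hpos _)] at hl
    have hmeas : Measurable fun w => (1 + t • fderiv ℝ g w).det :=
      ContinuousLinearMap.continuous_det.measurable.comp
        (((measurable_fderiv ℝ g).const_smul t).const_add 1)
    have hfin : μ B ≠ ⊤ := measure_ball_lt_top.ne
    refine ⟨⟨hmeas.aestronglyMeasurable, ?_⟩, ?_⟩
    · rw [hasFiniteIntegral_iff_ofReal (Filter.Eventually.of_forall fun w => (hpos w).le), hl]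
      exact measure_ball_lt_top
    · rw [integral_eq_lintegral_of_nonneg_ae (Filter.Eventually.of_forall fun w => (hpos w).le)
        hmeas.aestronglyMeasurable, hl]
  -- At `t = 1` the map takes values in the sphere, so its derivative has range orthogonal to `w + g
  -- w`. An invertible derivative would have that nonzero vector in its range.
  have hzero : ∀ w ∈ B ∩ D, (1 + fderiv ℝ g w).det = 0 := by
    intro w hw
    by_contra hne
    have hwB : ‖w‖ < R := by simpa [hB] using hw.1
    obtain ⟨A, hA⟩ : ∃ A : E →L[ℝ] E, A = 1 + fderiv ℝ g w := ⟨_, rfl⟩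
    rw [← hA] at hne
    have hG : HasFDerivAt (fun u => u + g u) A w := hA ▸ (hasFDerivAt_id w).add hw.2.hasFDerivAt
    obtain ⟨h, hh⟩ := (LinearMap.equivOfDetNeZero (A : E →ₗ[ℝ] E) hne).surjective (w + g w)
    have hh' : A h = w + g w := hh
    have h1 : HasFDerivAt (fun u => ‖u + g u‖ ^ 2) (2 • (innerSL ℝ (w + g w)).comp A) w :=
      hG.norm_sq
    have h2 : (fun u => ‖u + g u‖ ^ 2) =ᶠ[nhds w] fun _ => R ^ 2 := by
      filter_upwards [Metric.isOpen_ball.mem_nhds hw.1] with u hu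
      rw [hsph u (by simpa using hu)]
    have h3 := (h1.congr_of_eventuallyEq h2.symm).unique (hasFDerivAt_const (R ^ 2) w)
    have h4 := congrArg (fun B : E →L[ℝ] ℝ => B h) h3
    simp only [smul_apply, ContinuousLinearMap.comp_apply,
      hh', innerSL_apply_apply, zero_apply, real_inner_self_eq_norm_sq,
      hsph w hwB] at h4
    rw [two_smul] at h4
    nlinarith [sq_pos_of_pos hR]
  -- The integrated Jacobian is polynomial in `t`; the interpolation formula carries its value from
  -- small `t` to `t = 1`, where the Jacobian was just seen to vanish.
  have hfinal : ∫ w in B ∩ D, (1 + fderiv ℝ g w).det ∂μ = (μ B).toReal := by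
    rw [integral_congr_ae (Filter.Eventually.of_forall fun w => hint (fderiv ℝ g w))]
    rw [integral_finsetSum _ fun i _ => ((hmain (s i) (hs i).1 (hs i).2).1.const_mul (a i))]
    simp_rw [integral_const_mul]
    rw [Finset.sum_congr rfl fun i _ => by rw [(hmain (s i) (hs i).1 (hs i).2).2],
      ← Finset.sum_mul, ha, one_mul]
  rw [setIntegral_congr_fun (measurableSet_ball.inter hDm) hzero] at hfinal
  simp only [integral_zero] at hfinal
  have : 0 < (μ B).toReal :=
    ENNReal.toReal_pos (Metric.measure_ball_pos μ 0 hR).ne' measure_ball_lt_top.ne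
  linarith

/-- A Lipschitz map at bounded distance from the identity is onto. -/
theorem surjective_of_lipschitzWith_of_norm_sub_le {E : Type*} [NormedAddCommGroup E]
    [InnerProductSpace ℝ E] [FiniteDimensional ℝ E] [MeasurableSpace E] [BorelSpace E]
    {F : E → E} {K : NNReal} (hF : LipschitzWith K F) {C : ℝ} (hC : ∀ w, ‖F w - w‖ ≤ C) :
    Function.Surjective F := by
  intro y
  by_contra hy
  push Not at hy
  have hC0 : 0 ≤ C := (norm_nonneg _).trans (hC 0)
  have hy0 : (0 : ℝ) ≤ ‖y‖ := norm_nonneg _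
  -- the displacement of `F - y` and its cutoff
  set e : E → E := fun w => F w - y - w with he
  have hel : LipschitzWith (K + 1) e := by
    have := (hF.sub (LipschitzWith.const y)).sub LipschitzWith.id
    simpa [he] using this
  have heC : ∀ w, ‖e w‖ ≤ C + ‖y‖ := fun w => by
    have : e w = (F w - w) - y := by simp only [he]; abel
    rw [this]
    exact (norm_sub_le _ _).trans (by gcongr; exact hC w)
  set C' := C + ‖y‖ with hC'
  -- The cutoff acts in the shell between `R - 1 = C' + 1` and `R`, where a displacement of size at
  -- most `C'` cannot bring `w` to `0`.
  set R : ℝ := C' + 2 with hRdef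
  have hR : 0 < R := by positivity
  let χ : E → ℝ := fun w => min 1 (max 0 (R - ‖w‖))
  have hχ : ∀ w u, |χ w - χ u| ≤ ‖w - u‖ := by
    intro w u
    have h1 := abs_min_sub_min_le_max 1 (max 0 (R - ‖w‖)) 1 (max 0 (R - ‖u‖))
    have h2 := abs_max_sub_max_le_max 0 (R - ‖w‖) 0 (R - ‖u‖)
    have h3 : |R - ‖w‖ - (R - ‖u‖)| ≤ ‖w - u‖ := by
      rw [sub_sub_sub_cancel_left, norm_sub_rev]; exact abs_norm_sub_norm_le _ _
    simp only [sub_self, abs_zero] at h1 h2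
    have h4 := norm_nonneg (w - u)
    exact h1.trans (max_le h4 (h2.trans (max_le h4 h3)))
  have hχ0 : ∀ w, 0 ≤ χ w := fun w => le_min zero_le_one (le_max_left _ _)
  have hχ1 : ∀ w, χ w ≤ 1 := fun w => min_le_left _ _
  -- `H` interpolates between `F - y` inside and the identity outside the ball. If `y` is not
  -- attained, `H` never vanishes.
  set H : E → E := fun w => w + χ w • e w with hH
  have hHl : LipschitzWith (1 + (C'.toNNReal + (K + 1))) H := by
    refine LipschitzWith.id.add (LipschitzWith.of_dist_le_mul fun w u => ?_)
    have h1 : χ w • e w - χ u • e u = (χ w - χ u) • e w + χ u • (e w - e u) := by module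
    rw [dist_eq_norm, h1, dist_eq_norm]
    refine (norm_add_le _ _).trans ?_
    rw [norm_smul, norm_smul, Real.norm_eq_abs, Real.norm_of_nonneg (hχ0 u)]
    have h2 := hel.dist_le_mul w u
    rw [dist_eq_norm, dist_eq_norm] at h2
    push_cast at h2 ⊢
    rw [Real.coe_toNNReal _ (by positivity : 0 ≤ C'), add_mul]
    have h3 : |χ w - χ u| * ‖e w‖ ≤ ‖w - u‖ * C' := by
      gcongr
      · exact hχ w u
      · exact heC w
    have h4 : χ u * ‖e w - e u‖ ≤ 1 * ‖e w - e u‖ := by gcongr; exact hχ1 u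
    linarith
  have hHout : ∀ w, R ≤ ‖w‖ → H w = w := by
    intro w hw
    have : χ w = 0 := by
      simp only [χ]
      rw [max_eq_left (by linarith)]; simp
    simp [hH, this]
  have hHne : ∀ w, H w ≠ 0 := by
    intro w hw
    rcases le_or_gt ‖w‖ (R - 1) with h | h
    · have h1 : χ w = 1 := by
        simp only [χ]
        rw [max_eq_right (by linarith), min_eq_left (by linarith)]
      apply hy w
      have : F w - y = 0 := by
        rw [← hw]; simp only [hH, h1, he, one_smul]; abel
      exact sub_eq_zero.1 this
    · have h1 : w = -(χ w • e w) := eq_neg_of_add_eq_zero_left hw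
      have h2 : ‖w‖ ≤ C' := by
        rw [h1, norm_neg, norm_smul, Real.norm_of_nonneg (hχ0 w)]
        calc χ w * ‖e w‖ ≤ 1 * C' := by
              gcongr
              · exact hχ1 w
              · exact heC w
          _ = C' := one_mul _
      linarith
  obtain ⟨δ, hδ, hδH⟩ : ∃ δ > 0, ∀ w, δ ≤ ‖H w‖ := by
    obtain ⟨w₀, hw₀, hmin⟩ := (isCompact_closedBall (0 : E) R).exists_isMinOn
      ⟨0, by simpa using hR.le⟩ hHl.continuous.norm.continuousOn
    refine ⟨min ‖H w₀‖ R, lt_min (norm_pos_iff.2 (hHne _)) hR, fun w => ?_⟩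
    rcases le_total ‖w‖ R with h | h
    · exact (min_le_left _ _).trans (hmin (by simpa using h))
    · rw [hHout w h]; exact (min_le_right _ _).trans h
  -- Since `‖H‖ ≥ δ` everywhere, clamping at `δ` and rescaling sends `H` to the sphere of radius `R`
  -- by a Lipschitz map. On that sphere `H` is the identity, so the clamping of the argument makes
  -- `g` vanish outside the ball.
  set g : E → E := fun w => (R / δ) • clamp δ (H (clamp R w)) - clamp R w with hg
  have hgl : ∃ L, LipschitzWith L g := by
    have h1 := (lipschitzWith_clamp (E := E) hδ).comp (hHl.comp (lipschitzWith_clamp hR))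
    exact ⟨_, ((lipschitzWith_smul (R / δ)).comp h1).sub (lipschitzWith_clamp hR)⟩
  obtain ⟨L, hgl⟩ := hgl
  refine not_exists_lipschitz_retraction hgl hR (fun w hw => ?_) (fun w hw => ?_)
  · have h1 := norm_clamp_of_le hR hw
    simp only [hg]
    rw [hHout _ h1.ge]
    have h2 : δ ≤ R := by
      have := hδH (clamp R w)
      rwa [hHout _ h1.ge, h1] at this
    set u := clamp R w
    rw [clamp, h1, max_eq_right h2, smul_smul]
    rw [show R / δ * (δ / R) = 1 by field_simp, one_smul, sub_self]
  · simp only [hg]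
    rw [clamp_of_le hR hw.le, add_sub_cancel, norm_smul, norm_clamp_of_le hδ (hδH w),
      Real.norm_of_nonneg (by positivity)]
    field_simp

end LinearBoltzmann

namespace LinearBoltzmann

theorem _root_.HasDerivAt.prod_fst {E F : Type*} [NormedAddCommGroup E] [NormedSpace ℝ E]
    [NormedAddCommGroup F] [NormedSpace ℝ F] {f : ℝ → E × F} {f' : E × F} {t : ℝ}
    (h : HasDerivAt f f' t) : HasDerivAt (fun s => (f s).1) f'.1 t :=
  (ContinuousLinearMap.fst ℝ E F).hasFDerivAt.comp_hasDerivAt t h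

theorem _root_.HasDerivAt.prod_snd {E F : Type*} [NormedAddCommGroup E] [NormedSpace ℝ E]
    [NormedAddCommGroup F] [NormedSpace ℝ F] {f : ℝ → E × F} {f' : E × F} {t : ℝ}
    (h : HasDerivAt f f' t) : HasDerivAt (fun s => (f s).2) f'.2 t :=
  (ContinuousLinearMap.snd ℝ E F).hasFDerivAt.comp_hasDerivAt t h

/-! ### The characteristic flow on the universal cover -/

section Flow

variable {d : ℕ} {W : Torus d → ℝ}

/-- The vector field `(y, v) ↦ (v, -∇W(y))` on the universal cover of phase space. -/
noncomputable def liftField (W : Torus d → ℝ) (z : Vel d × Vel d) : Vel d × Vel d :=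
  (z.2, -torusGrad W (proj z.1))

/-- The lift of the characteristic flow to the universal cover of phase space. -/
noncomputable def liftFlow (hW : TorusC2 W) (t : ℝ) (z : Vel d × Vel d) : Vel d × Vel d :=
  let γ := (existsUnique_characteristic hW (proj z.1) z.2).exists.choose
  (z.1 + (γ t).1, (γ t).2)

/-- Continuity on the torus is checked on the universal cover through this map. Openness is kept
track of because open quotient maps, unlike general ones, are stable under products. -/
theorem isOpenQuotientMap_proj : IsOpenQuotientMap (proj (d := d)) := by
  have h1 : IsOpenQuotientMap (Pi.map fun (_ : Fin d) (a : ℝ) => (a : UnitAddCircle)) :=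
    IsOpenQuotientMap.piMap fun _ => QuotientAddGroup.isOpenQuotientMap_mk
  have h2 : IsOpenQuotientMap (WithLp.ofLp : Vel d → (Fin d → ℝ)) :=
    (PiLp.homeomorph 2 fun _ : Fin d => ℝ).isOpenQuotientMap
  exact h1.comp h2

theorem continuous_proj : Continuous (proj (d := d)) := isOpenQuotientMap_proj.continuous

theorem proj_zero : proj (0 : Vel d) = 0 := by funext i; simp [proj]

theorem dist_proj_le (y z : Vel d) : dist (proj y) (proj z) ≤ dist y z := by
  refine (dist_pi_le_iff dist_nonneg).2 fun i => ?_
  have h1 : dist (proj y i) (proj z i) ≤ dist (y i) (z i) := by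
    have h2 : proj y i - proj z i = ((y i - z i : ℝ) : UnitAddCircle) := by simp [proj]
    rw [dist_eq_norm, h2, dist_eq_norm, Real.norm_eq_abs, AddCircle.norm_eq]
    have := round_le (y i - z i) 0
    simpa using this
  exact h1.trans (by simpa [dist_eq_norm] using PiLp.norm_apply_le (y - z) i)

/-- The projection of the universal cover of phase space. -/
def projPhase (z : Vel d × Vel d) : Torus d × Vel d := (proj z.1, z.2)

theorem isOpenQuotientMap_projPhase : IsOpenQuotientMap (projPhase (d := d)) :=
  isOpenQuotientMap_proj.prodMap IsOpenQuotientMap.id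

theorem dist_projPhase_le (y z : Vel d × Vel d) : dist (projPhase y) (projPhase z) ≤ dist y z :=
  max_le_max (dist_proj_le _ _) le_rfl

theorem continuous_torusGrad (hW : TorusC2 W) : Continuous (torusGrad W) := by
  rw [isOpenQuotientMap_proj.isQuotientMap.continuous_iff]
  have := (contDiff_torusGrad hW 0).continuous
  simpa [Function.comp_def] using this

theorem exists_norm_torusGrad_le (hW : TorusC2 W) : ∃ C, 0 ≤ C ∧ ∀ x, ‖torusGrad W x‖ ≤ C := by
  obtain ⟨C, hC⟩ := (isCompact_univ (X := Torus d)).exists_bound_of_continuousOn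
    (continuous_torusGrad hW).continuousOn
  exact ⟨C, (norm_nonneg _).trans (hC 0 trivial), fun x => hC x trivial⟩

theorem exists_lipschitzWith_liftField (hW : TorusC2 W) : ∃ K, LipschitzWith K (liftField W) := by
  obtain ⟨K, hK⟩ := exists_lipschitz hW 0
  simp only [zero_add] at hK
  exact ⟨_, LipschitzWith.prod_snd.prodMk (hK.comp LipschitzWith.prod_fst).neg⟩

theorem flow_projPhase (hW : TorusC2 W) (t : ℝ) (z : Vel d × Vel d) :
    flow hW t (projPhase z) = projPhase (liftFlow hW t z) := by
  simp only [flow, liftFlow, projPhase, proj_add]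

@[simp]
theorem liftFlow_zero (hW : TorusC2 W) (z : Vel d × Vel d) : liftFlow hW 0 z = z := by
  have h := (existsUnique_characteristic hW (proj z.1) z.2).exists.choose_spec.1
  simp only [liftFlow, h, add_zero]

theorem hasDerivAt_liftFlow (hW : TorusC2 W) (z : Vel d × Vel d) (t : ℝ) :
    HasDerivAt (fun s => liftFlow hW s z) (liftField W (liftFlow hW t z)) t := by
  have h := (existsUnique_characteristic hW (proj z.1) z.2).exists.choose_spec.2 t
  have h1 := (h.prod_fst.const_add z.1).prodMk h.prod_snd
  simpa only [liftField, liftFlow, proj_add] using! h1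

theorem eq_liftFlow (hW : TorusC2 W) {γ : ℝ → Vel d × Vel d}
    (hγ : ∀ t, HasDerivAt γ (liftField W (γ t)) t) (t : ℝ) : γ t = liftFlow hW t (γ 0) := by
  obtain ⟨K, hK⟩ := exists_lipschitzWith_liftField hW
  exact congrFun (ODE_solution_unique_univ (v := fun _ => liftField W) (s := fun _ => Set.univ)
    (t₀ := 0) (f := γ) (g := fun s => liftFlow hW s (γ 0))
    (fun _ => hK.lipschitzOnWith) (fun t => ⟨hγ t, trivial⟩)
    (fun t => ⟨hasDerivAt_liftFlow hW _ t, trivial⟩) (by simp)) t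

theorem liftFlow_add (hW : TorusC2 W) (s t : ℝ) (z : Vel d × Vel d) :
    liftFlow hW (s + t) z = liftFlow hW s (liftFlow hW t z) := by
  have h := eq_liftFlow hW (γ := fun s => liftFlow hW (s + t) z)
    (fun s => (hasDerivAt_liftFlow hW z (s + t)).comp_add_const s t) s
  simpa using h

theorem projPhase_surjective : Function.Surjective (projPhase (d := d)) :=
  isOpenQuotientMap_projPhase.surjective

@[simp]
theorem flow_zero (hW : TorusC2 W) (z : Torus d × Vel d) : flow hW 0 z = z := by
  obtain ⟨z, rfl⟩ := projPhase_surjective z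
  rw [flow_projPhase, liftFlow_zero]

theorem flow_add (hW : TorusC2 W) (s t : ℝ) (z : Torus d × Vel d) :
    flow hW (s + t) z = flow hW s (flow hW t z) := by
  obtain ⟨z, rfl⟩ := projPhase_surjective z
  simp only [flow_projPhase, liftFlow_add]

/-- Grönwall's inequality; for negative times it is applied to the reversed curves, which follow the
opposite field. -/
theorem dist_liftFlow_le (hW : TorusC2 W) {K : NNReal} (hK : LipschitzWith K (liftField W))
    (t : ℝ) (z z' : Vel d × Vel d) :
    dist (liftFlow hW t z) (liftFlow hW t z') ≤ Real.exp (K * |t|) * dist z z' := by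
  rcases le_total 0 t with ht | ht
  · have h := dist_le_of_trajectories_ODE (v := fun _ => liftField W) (K := K)
      (f := fun s => liftFlow hW s z) (g := fun s => liftFlow hW s z') (a := 0) (b := t)
      (δ := dist z z') (fun _ x y => hK x y)
      (fun s _ => (hasDerivAt_liftFlow hW z s).continuousAt.continuousWithinAt)
      (fun s _ => (hasDerivAt_liftFlow hW z s).hasDerivWithinAt)
      (fun s _ => (hasDerivAt_liftFlow hW z' s).continuousAt.continuousWithinAt)
      (fun s _ => (hasDerivAt_liftFlow hW z' s).hasDerivWithinAt) (by simp) t ⟨ht, le_rfl⟩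
    rw [abs_of_nonneg ht]
    rwa [sub_zero, mul_comm] at h
  · have hd : ∀ (z : Vel d × Vel d) (s : ℝ),
        HasDerivAt (fun s => liftFlow hW (-s) z) (-liftField W (liftFlow hW (-s) z)) s := by
      intro z s
      have := HasDerivAt.scomp s (hasDerivAt_liftFlow hW z (-s)) (hasDerivAt_neg s)
      simpa only [neg_smul, one_smul] using! this
    have h := dist_le_of_trajectories_ODE (v := fun _ z => -liftField W z) (K := K)
      (f := fun s => liftFlow hW (-s) z) (g := fun s => liftFlow hW (-s) z') (a := 0) (b := -t)
      (δ := dist z z') (fun _ x y => hK.neg x y)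
      (fun s _ => (hd z s).continuousAt.continuousWithinAt)
      (fun s _ => (hd z s).hasDerivWithinAt)
      (fun s _ => (hd z' s).continuousAt.continuousWithinAt)
      (fun s _ => (hd z' s).hasDerivWithinAt) (by simp) (-t) ⟨by linarith, le_rfl⟩
    rw [abs_of_nonpos ht]
    simp only [neg_neg] at h
    rwa [sub_zero, mul_comm] at h

/-- The mean value inequality for a curve on the line. -/
theorem norm_sub_le_of_hasDerivAt {E : Type*} [NormedAddCommGroup E] [NormedSpace ℝ E]
    {f f' : ℝ → E} {t C : ℝ} (hf : ∀ s, HasDerivAt f (f' s) s) (hC : ∀ s, |s| ≤ |t| → ‖f' s‖ ≤ C) :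
    ‖f t - f 0‖ ≤ C * |t| := by
  have hs : ∀ s ∈ Set.uIcc 0 t, |s| ≤ |t| := fun s hs => by
    have := Set.abs_sub_left_of_mem_uIcc hs
    simpa using this
  have := (convex_uIcc (0 : ℝ) t).norm_image_sub_le_of_norm_hasDerivWithin_le
    (fun s _ => (hf s).hasDerivWithinAt) (fun s h => hC s (hs s h)) Set.left_mem_uIcc
    Set.right_mem_uIcc
  simpa using this

/-- The flow minus the identity has Lipschitz constant of order `|t|`. This gain of a factor `|t|`
controls the commutator between mollification and transport. -/
theorem norm_liftFlow_sub_sub_le (hW : TorusC2 W) {K : NNReal}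
    (hK : LipschitzWith K (liftField W)) {t : ℝ} (ht : |t| ≤ 1) (z z' : Vel d × Vel d) :
    ‖(liftFlow hW t z - liftFlow hW t z') - (z - z')‖ ≤ K * Real.exp K * ‖z - z'‖ * |t| := by
  have h := norm_sub_le_of_hasDerivAt (t := t) (C := K * Real.exp K * ‖z - z'‖)
    (fun s => (hasDerivAt_liftFlow hW z s).sub (hasDerivAt_liftFlow hW z' s)) (fun s hs => by
      rw [← dist_eq_norm, ← dist_eq_norm, mul_assoc]
      refine (hK.dist_le_mul _ _).trans ?_
      gcongr
      refine (dist_liftFlow_le hW hK s z z').trans ?_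
      gcongr
      have : (0 : ℝ) ≤ K := K.2
      nlinarith)
  simpa using h

theorem norm_liftFlow_snd_sub_le (hW : TorusC2 W) {C : ℝ} (hC : ∀ x, ‖torusGrad W x‖ ≤ C)
    (t : ℝ) (z : Vel d × Vel d) : ‖(liftFlow hW t z).2 - z.2‖ ≤ C * |t| := by
  have h := norm_sub_le_of_hasDerivAt (t := t) (C := C)
    (fun s => (hasDerivAt_liftFlow hW z s).prod_snd) (fun s _ => by
      simpa [liftField] using hC _)
  simpa using h

/-- The force is bounded, so the deviation from free motion is bounded uniformly in the velocity.
This is what makes the velocity-to-position map onto. -/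
theorem norm_liftFlow_fst_sub_le (hW : TorusC2 W) {C : ℝ} (hC : ∀ x, ‖torusGrad W x‖ ≤ C)
    (t : ℝ) (z : Vel d × Vel d) :
    ‖(liftFlow hW t z).1 - z.1 - t • z.2‖ ≤ C * |t| * |t| := by
  have hC0 : 0 ≤ C := (norm_nonneg _).trans (hC 0)
  have h := norm_sub_le_of_hasDerivAt (t := t) (C := C * |t|)
    (f := fun s => (liftFlow hW s z).1 - s • z.2) (f' := fun s => (liftFlow hW s z).2 - z.2)
    (fun s => by
      have h1 := (hasDerivAt_liftFlow hW z s).prod_fst.sub ((hasDerivAt_id s).smul_const z.2)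
      simpa only [one_smul] using! h1) (fun s hs => by
      refine (norm_liftFlow_snd_sub_le hW hC s z).trans ?_
      gcongr)
  simp only [liftFlow_zero, zero_smul, sub_zero] at h
  rwa [sub_right_comm]

theorem continuous_liftFlow (hW : TorusC2 W) :
    Continuous fun q : ℝ × Vel d × Vel d => liftFlow hW q.1 q.2 := by
  obtain ⟨K, hK⟩ := exists_lipschitzWith_liftField hW
  rw [continuous_iff_continuousAt]
  rintro ⟨t₀, z₀⟩
  rw [ContinuousAt, tendsto_iff_dist_tendsto_zero]
  have hlim : Filter.Tendsto (fun q : ℝ × Vel d × Vel d =>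
      Real.exp (K * |q.1|) * dist q.2 z₀ + dist (liftFlow hW q.1 z₀) (liftFlow hW t₀ z₀))
      (nhds (t₀, z₀)) (nhds 0) := by
    have h1 : Continuous fun t => liftFlow hW t z₀ :=
      continuous_iff_continuousAt.2 fun t => (hasDerivAt_liftFlow hW z₀ t).continuousAt
    have h2 : Continuous fun q : ℝ × Vel d × Vel d =>
        Real.exp (K * |q.1|) * dist q.2 z₀ + dist (liftFlow hW q.1 z₀) (liftFlow hW t₀ z₀) := by
      have := h1.comp (continuous_fst (X := ℝ) (Y := Vel d × Vel d))
      fun_prop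
    have := h2.tendsto (t₀, z₀)
    simpa using this
  refine squeeze_zero (fun _ => dist_nonneg) (fun q => ?_) hlim
  exact (dist_triangle _ (liftFlow hW q.1 z₀) _).trans
    (add_le_add (dist_liftFlow_le hW hK _ _ _) le_rfl)

theorem continuous_flow (hW : TorusC2 W) :
    Continuous fun q : ℝ × Torus d × Vel d => flow hW q.1 q.2 := by
  have hq : IsOpenQuotientMap (Prod.map id (projPhase (d := d)) : ℝ × Vel d × Vel d → _) :=
    IsOpenQuotientMap.id.prodMap isOpenQuotientMap_projPhase
  rw [hq.isQuotientMap.continuous_iff]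
  have h : (fun q : ℝ × Torus d × Vel d => flow hW q.1 q.2) ∘ Prod.map id projPhase
      = projPhase ∘ fun q : ℝ × Vel d × Vel d => liftFlow hW q.1 q.2 := by
    funext q; simp [flow_projPhase]
  rw [h]
  exact isOpenQuotientMap_projPhase.continuous.comp (continuous_liftFlow hW)

theorem measurable_flow (hW : TorusC2 W) (t : ℝ) : Measurable (flow hW t) :=
  ((continuous_flow hW).comp (Continuous.prodMk_right t)).measurable

end Flow

end LinearBoltzmann

namespace LinearBoltzmann

/-! ### The equilibrium measures -/

section Equilibrium

variable {d : ℕ} {W : Torus d → ℝ}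

theorem continuous_of_torusC2 (hW : TorusC2 W) : Continuous W := by
  rw [isOpenQuotientMap_proj.isQuotientMap.continuous_iff]
  exact hW.continuous

theorem maxwellian_pos (v : Vel d) : 0 < maxwellian v := by
  unfold maxwellian; positivity

theorem continuous_maxwellian : Continuous (maxwellian (d := d)) := by
  unfold maxwellian; fun_prop

theorem integral_maxwellian : ∫ v : Vel d, maxwellian v = 1 := by
  have h := GaussianFourier.integral_rexp_neg_mul_sq_norm (V := Vel d) (b := 1 / 2) (by norm_num)
  have h1 : ∀ v : Vel d, maxwellian v
      = (2 * Real.pi) ^ (-(d : ℝ) / 2) * Real.exp (-(1 / 2) * ‖v‖ ^ 2) := fun v => by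
    unfold maxwellian; congr 2; ring
  simp only [h1]
  rw [integral_const_mul, h, finrank_euclideanSpace_fin, neg_div, Real.rpow_neg (by positivity)]
  rw [show Real.pi / (1 / 2) = 2 * Real.pi by ring]
  exact inv_mul_cancel₀ (by positivity)

/-- A function whose Bochner integral is nonzero is integrable, the integral being `0` by default
otherwise. -/
theorem integrable_maxwellian : Integrable (maxwellian (d := d)) :=
  not_imp_comm.1 integral_undef (by rw [integral_maxwellian]; norm_num)

theorem lintegral_maxwellian : ∫⁻ v : Vel d, ENNReal.ofReal (maxwellian v) = 1 := by
  rw [← ofReal_integral_eq_lintegral_ofReal integrable_maxwellian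
    (Filter.Eventually.of_forall fun v => (maxwellian_pos v).le), integral_maxwellian,
    ENNReal.ofReal_one]

instance : IsProbabilityMeasure (nuV d) :=
  ⟨by rw [nuV, withDensity_apply _ MeasurableSet.univ, setLIntegral_univ, lintegral_maxwellian]⟩

instance : IsProbabilityMeasure (volume : Measure (Torus d)) :=
  ⟨by rw [volume_pi, Measure.pi_univ]; simp⟩

instance : (volume : Measure (Torus d)).IsAddHaarMeasure :=
  inferInstanceAs (Measure.pi fun _ : Fin d => (volume : Measure UnitAddCircle)).IsAddHaarMeasure

instance : (volume : Measure (Torus d)).IsAddLeftInvariant :=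
  Measure.IsAddHaarMeasure.toIsAddLeftInvariant

theorem integrable_of_continuous_torus {f : Torus d → ℝ} (hf : Continuous f) :
    Integrable f :=
  hf.integrable_of_hasCompactSupport (HasCompactSupport.of_compactSpace f)

theorem partition_pos (hW : TorusC2 W) : 0 < ∫ y : Torus d, Real.exp (-W y) := by
  have hc : Continuous fun y : Torus d => Real.exp (-W y) := by
    have := continuous_of_torusC2 hW; fun_prop
  rw [integral_pos_iff_support_of_nonneg (fun y => (Real.exp_pos _).le)
    (integrable_of_continuous_torus hc)]
  have : Function.support (fun y : Torus d => Real.exp (-W y)) = Set.univ := by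
    ext y; simp [Real.exp_ne_zero]
  rw [this]; simp

theorem isProbabilityMeasure_nuX (hW : TorusC2 W) : IsProbabilityMeasure (nuX W) := by
  have hc : Continuous fun y : Torus d => Real.exp (-W y) := by
    have := continuous_of_torusC2 hW; fun_prop
  have hZ := partition_pos hW
  refine ⟨?_⟩
  rw [nuX, withDensity_apply _ MeasurableSet.univ, setLIntegral_univ,
    ← ofReal_integral_eq_lintegral_ofReal
      ((integrable_of_continuous_torus hc).div_const _)
      (Filter.Eventually.of_forall fun v => by positivity), integral_div, div_self hZ.ne',
    ENNReal.ofReal_one]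

theorem isProbabilityMeasure_nu (hW : TorusC2 W) : IsProbabilityMeasure (nu W) := by
  have := isProbabilityMeasure_nuX hW
  unfold nu; infer_instance

theorem exists_nuX_le (hW : TorusC2 W) :
    ∃ C : ℝ, 0 < C ∧ ∀ A : Set (Torus d), MeasurableSet A →
      nuX W A ≤ ENNReal.ofReal C * volume A := by
  have hc : Continuous fun x : Torus d => Real.exp (-W x) / ∫ y : Torus d, Real.exp (-W y) := by
    have := continuous_of_torusC2 hW; fun_prop
  obtain ⟨C, hC⟩ := (isCompact_univ (X := Torus d)).exists_bound_of_continuousOn hc.continuousOn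
  refine ⟨max C 1, by positivity, fun A hA => ?_⟩
  rw [nuX, withDensity_apply _ hA, ← setLIntegral_const]
  refine lintegral_mono fun x => ENNReal.ofReal_le_ofReal ?_
  exact (le_abs_self _).trans ((hC x trivial).trans (le_max_left _ _))

/-- The fundamental cell of the torus. -/
def cell (d : ℕ) : Set (Vel d) := {y | ∀ i, y i ∈ Set.Ioc (0 : ℝ) 1}

/-- The half-open cell is a fundamental domain on which the projection preserves volume, and the
shift by `x₀` is harmless by invariance of the measure. -/
theorem volume_cell_inter (x₀ : Torus d) {A : Set (Torus d)} (hA : MeasurableSet A) :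
    volume {y | y ∈ cell d ∧ x₀ + proj y ∈ A} = volume A := by
  have hA' : MeasurableSet ((fun x : Torus d => x₀ + x) ⁻¹' A) := measurable_const_add x₀ hA
  have h1 : MeasurePreserving (fun (x : Fin d → ℝ) (i : Fin d) => (x i : UnitAddCircle))
      (Measure.pi fun _ : Fin d => (volume : Measure ℝ).restrict (Set.Ioc (0 : ℝ) (0 + 1)))
      (Measure.pi fun _ : Fin d => (volume : Measure UnitAddCircle)) :=
    measurePreserving_pi _ _ fun _ => UnitAddCircle.measurePreserving_mk 0
  have h2 := h1.measure_preimage hA'.nullMeasurableSet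
  rw [← Measure.restrict_pi_pi, Measure.restrict_apply (h1.measurable hA')] at h2
  have h3 : (volume : Measure (Torus d)) ((fun x : Torus d => x₀ + x) ⁻¹' A) = volume A :=
    measure_preimage_add (volume : Measure (Torus d)) x₀ A
  rw [← h3]
  refine Eq.trans ?_ h2
  have hm : MeasurableSet ((fun (x : Fin d → ℝ) (i : Fin d) => (x i : UnitAddCircle)) ⁻¹'
      ((fun x : Torus d => x₀ + x) ⁻¹' A) ∩ Set.univ.pi fun _ : Fin d => Set.Ioc (0 : ℝ) (0 + 1)) :=
    (h1.measurable hA').inter (MeasurableSet.univ_pi fun i => measurableSet_Ioc)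
  refine Eq.trans ?_ ((PiLp.volume_preserving_ofLp (Fin d)).measure_preimage hm.nullMeasurableSet)
  congr 1
  ext y
  simp only [cell, Set.mem_ofPred_eq, Set.mem_inter_iff, Set.mem_preimage, Set.mem_univ_pi, zero_add]
  exact and_comm

theorem exists_norm_le_of_mem_cell (d : ℕ) : ∃ D : ℝ, 0 ≤ D ∧ ∀ y ∈ cell d, ‖y‖ ≤ D := by
  have hcpt : IsCompact (WithLp.toLp 2 '' (Set.Icc (0 : Fin d → ℝ) 1) : Set (Vel d)) :=
    isCompact_Icc.image (PiLp.continuous_toLp 2 _)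
  obtain ⟨D, hD⟩ := hcpt.isBounded.exists_norm_le
  refine ⟨max D 0, le_max_right _ _, fun y hy => (hD y ?_).trans (le_max_left _ _)⟩
  exact ⟨y.ofLp, ⟨fun i => (hy i).1.le, fun i => (hy i).2⟩, rfl⟩

/-- From any position, a ball of initial velocities covers the whole torus, uniformly for times
in a compact interval. -/
theorem exists_le_map_flow (hW : TorusC2 W) {a b : ℝ} (ha : 0 < a) (hab : a ≤ b) :
    ∃ R β : ℝ, 0 < R ∧ 0 < β ∧ ∀ t ∈ Set.Icc a b, ∀ x₀ : Torus d,
      ENNReal.ofReal β • nuX W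
        ≤ (volume.restrict (Metric.ball (0 : Vel d) R)).map fun w => (flow hW t (x₀, w)).1 := by
  obtain ⟨K, hK⟩ := exists_lipschitzWith_liftField hW
  obtain ⟨C, hC0, hC⟩ := exists_norm_torusGrad_le hW
  obtain ⟨D, hD0, hD⟩ := exists_norm_le_of_mem_cell d
  obtain ⟨B, hB0, hB⟩ := exists_nuX_le hW
  have hb : 0 < b := ha.trans_le hab
  set L : ℝ := Real.exp (K * b) with hL
  have hL0 : 0 < L := Real.exp_pos _
  -- A velocity `w` whose displacement at time `t` lies in the cell satisfies `t ‖w‖ ≤ D + C t²`,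
  -- hence the radius; the `+ 1` puts it in an open ball. The mass is lost to the volume expansion,
  -- at most `L ^ d`, and to the density of `ν_x`, at most `B`.
  refine ⟨(D + C * b * b) / a + 1, (B * L ^ d)⁻¹, by positivity, by positivity,
    fun t ht x₀ => ?_⟩
  set R := (D + C * b * b) / a + 1 with hR
  have ht0 : 0 < t := ha.trans_le ht.1
  obtain ⟨y₀, rfl⟩ := proj_surjective x₀
  set F : Vel d → Vel d := fun w => (liftFlow hW t (y₀, w)).1 - y₀ with hF
  have hFl : LipschitzWith L.toNNReal F := by
    refine LipschitzWith.of_dist_le_mul fun w u => ?_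
    rw [Real.coe_toNNReal _ hL0.le]
    simp only [hF, dist_sub_right]
    refine (le_max_left _ (dist (liftFlow hW t (y₀, w)).2 (liftFlow hW t (y₀, u)).2)).trans ?_
    refine (dist_liftFlow_le hW hK t _ _).trans ?_
    have h1 : dist (y₀, w) (y₀, u) = dist w u := by simp [Prod.dist_eq]
    rw [h1, abs_of_pos ht0, hL]
    have := ht.2
    have : (0 : ℝ) ≤ K := K.2
    gcongr
  have hFt : ∀ w, ‖F w - t • w‖ ≤ C * t * t := fun w => by
    have := norm_liftFlow_fst_sub_le hW hC t (y₀, w)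
    rwa [abs_of_pos ht0] at this
  -- After division by `t` the displacement is within `C * t` of the identity, so it is onto,
  -- however large `t` is.
  have hsurj : Function.Surjective F := by
    have h1 : Function.Surjective fun w => t⁻¹ • F w := by
      refine surjective_of_lipschitzWith_of_norm_sub_le
        ((lipschitzWith_smul t⁻¹).comp hFl) (C := C * t) fun w => ?_
      have : t⁻¹ • F w - w = t⁻¹ • (F w - t • w) := by
        rw [smul_sub t⁻¹ (F w) (t • w), smul_smul, inv_mul_cancel₀ ht0.ne', one_smul]
      rw [this, norm_smul, norm_inv, Real.norm_of_nonneg ht0.le, inv_mul_le_iff₀ ht0]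
      exact (hFt w).trans (by linarith)
    intro y
    obtain ⟨w, hw⟩ := h1 (t⁻¹ • y)
    exact ⟨w, smul_right_injective _ (inv_ne_zero ht0.ne') hw⟩
  have hflow : ∀ w, (flow hW t (proj y₀, w)).1 = proj y₀ + proj (F w) := fun w => by
    have := flow_projPhase hW t (y₀, w)
    simp only [projPhase] at this
    rw [this, ← proj_add]
    simp [hF]
  refine Measure.le_iff.2 fun A hA => ?_
  have hmeas : Measurable fun w => (flow hW t (proj y₀, w)).1 :=
    ((measurable_flow hW t).comp measurable_prodMk_left).fst
  rw [Measure.map_apply hmeas hA, Measure.restrict_apply (hmeas hA)]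
  -- Every lift of `A` in the cell is reached from an admissible velocity, so the Lipschitz bound on
  -- volumes, read backwards, bounds the set of these velocities from below.
  have hsub : {y | y ∈ cell d ∧ proj y₀ + proj y ∈ A} ⊆
      F '' ((fun w => (flow hW t (proj y₀, w)).1) ⁻¹' A ∩ Metric.ball 0 R) := by
    rintro y ⟨hy, hyA⟩
    obtain ⟨w, rfl⟩ := hsurj y
    refine ⟨w, ⟨by simpa [hflow] using hyA, ?_⟩, rfl⟩
    rw [mem_ball_zero_iff]
    have h1 : t * ‖w‖ ≤ D + C * b * b := by
      have h2 : ‖t • w‖ ≤ ‖F w‖ + ‖F w - t • w‖ := by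
        have := norm_sub_le (F w) (F w - t • w)
        simpa using this
      rw [norm_smul, Real.norm_of_nonneg ht0.le] at h2
      have h3 : C * t * t ≤ C * b * b := by
        have := ht.2
        gcongr
      linarith [hD _ hy, hFt w]
    have h4 : ‖w‖ ≤ (D + C * b * b) / a := by
      rw [le_div_iff₀ ha]
      have := mul_le_mul_of_nonneg_right ht.1 (norm_nonneg w)
      linarith
    linarith
  have h5 := (measure_mono hsub).trans (addHaar_image_le_of_lipschitzWith volume hFl _)
  rw [volume_cell_inter _ hA, finrank_euclideanSpace_fin] at h5
  rw [Measure.smul_apply, smul_eq_mul]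
  calc ENNReal.ofReal (B * L ^ d)⁻¹ * nuX W A
      ≤ ENNReal.ofReal (B * L ^ d)⁻¹ * (ENNReal.ofReal B * (ENNReal.ofReal L ^ d *
        volume ((fun w => (flow hW t (proj y₀, w)).1) ⁻¹' A ∩ Metric.ball 0 R))) := by
        gcongr
        refine (hB A hA).trans ?_
        gcongr
        exact h5
    _ = ENNReal.ofReal ((B * L ^ d)⁻¹ * (B * L ^ d)) *
        volume ((fun w => (flow hW t (proj y₀, w)).1) ⁻¹' A ∩ Metric.ball 0 R) := by
        rw [← ENNReal.ofReal_pow hL0.le, ENNReal.ofReal_mul (by positivity),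
          ENNReal.ofReal_mul (by positivity), ← mul_assoc, ← mul_assoc, ← mul_assoc]
    _ = _ := by rw [inv_mul_cancel₀ (by positivity), ENNReal.ofReal_one, one_mul]

/-- The lower bound for the spatial marginal of the transported Maxwellian. -/
theorem exists_le_map_fst_transport (hW : TorusC2 W) {a b : ℝ} (ha : 0 < a) (hab : a ≤ b) :
    ∃ β : ℝ, 0 < β ∧ ∀ t ∈ Set.Icc a b, ∀ x₀ : Torus d,
      ENNReal.ofReal β • nuX W
        ≤ (transport hW t ((Measure.dirac x₀).prod (nuV d))).map Prod.fst := by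
  obtain ⟨R, β, hR, hβ, h⟩ := exists_le_map_flow hW ha hab
  set m : ℝ := (2 * Real.pi) ^ (-(d : ℝ) / 2) * Real.exp (-R ^ 2 / 2) with hm
  have hm0 : 0 < m := by positivity
  refine ⟨m * β, by positivity, fun t ht x₀ => ?_⟩
  have hmeas : Measurable fun w => (flow hW t (x₀, w)).1 :=
    ((measurable_flow hW t).comp measurable_prodMk_left).fst
  have hle : ENNReal.ofReal m • volume.restrict (Metric.ball (0 : Vel d) R) ≤ nuV d := by
    refine Measure.le_iff.2 fun A hA => ?_
    rw [Measure.smul_apply, Measure.restrict_apply hA, smul_eq_mul, nuV, withDensity_apply _ hA]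
    calc ENNReal.ofReal m * volume (A ∩ Metric.ball 0 R)
        = ∫⁻ _ in A ∩ Metric.ball 0 R, ENNReal.ofReal m := by rw [setLIntegral_const]
      _ ≤ ∫⁻ v in A ∩ Metric.ball 0 R, ENNReal.ofReal (maxwellian v) := by
        refine setLIntegral_mono' (hA.inter measurableSet_ball) fun v hv => ?_
        apply ENNReal.ofReal_le_ofReal
        have hv' : ‖v‖ < R := by simpa using hv.2
        unfold maxwellian
        rw [hm]
        gcongr
      _ ≤ _ := lintegral_mono_set Set.inter_subset_left
  have heq : (transport hW t ((Measure.dirac x₀).prod (nuV d))).map Prod.fst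
      = (nuV d).map fun w => (flow hW t (x₀, w)).1 := by
    rw [transport, Measure.dirac_prod, Measure.map_map measurable_fst (measurable_flow hW t),
      Measure.map_map (measurable_fst.comp (measurable_flow hW t)) measurable_prodMk_left]
    rfl
  rw [heq, ENNReal.ofReal_mul hm0.le, mul_smul]
  calc ENNReal.ofReal m • ENNReal.ofReal β • nuX W
      ≤ ENNReal.ofReal m • (volume.restrict (Metric.ball (0 : Vel d) R)).map
          fun w => (flow hW t (x₀, w)).1 := by
        gcongr; exact h t ht x₀
    _ = (ENNReal.ofReal m • volume.restrict (Metric.ball (0 : Vel d) R)).map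
          fun w => (flow hW t (x₀, w)).1 := by rw [Measure.map_smul]
    _ ≤ _ := Measure.map_mono hle hmeas

end Equilibrium

end LinearBoltzmann

namespace LinearBoltzmann

/-! ### The transport operator on test functions -/

section TestFunctions

variable {d : ℕ} {W : Torus d → ℝ}

/-- The transport part `∂_t φ + v · ∇ₓ φ - ∇W · ∇ᵥ φ` of the backward operator. -/
noncomputable def transportOp (W : Torus d → ℝ) (φ : ℝ → Torus d → Vel d → ℝ)
    (t : ℝ) (x : Torus d) (v : Vel d) : ℝ :=
  deriv (fun s => φ s x v) t
    + inner ℝ v (torusGrad (fun y => φ t y v) x)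
    - inner ℝ (torusGrad W x) (gradient (fun w => φ t x w) v)

theorem inner_gradient_right {E : Type*} [NormedAddCommGroup E] [InnerProductSpace ℝ E]
    [CompleteSpace E] (f : E → ℝ) (x v : E) : inner ℝ v (gradient f x) = fderiv ℝ f x v := by
  rw [real_inner_comm, gradient, InnerProductSpace.toDual_symm_apply]

/-- The lift of a time-dependent function on phase space to the universal cover. -/
def liftFun (φ : ℝ → Torus d → Vel d → ℝ) (z : ℝ × Vel d × Vel d) : ℝ :=
  φ z.1 (proj z.2.1) z.2.2

theorem deriv_proj_eq {φ : ℝ → Torus d → Vel d → ℝ} {t : ℝ} {y v : Vel d}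
    (hφ : DifferentiableAt ℝ (liftFun φ) (t, y, v)) :
    deriv (fun s => φ s (proj y) v) t = fderiv ℝ (liftFun φ) (t, y, v) (1, 0, 0) := by
  have hc : HasDerivAt (fun s : ℝ => (s, y, v)) ((1 : ℝ), (0 : Vel d), (0 : Vel d)) t :=
    (hasDerivAt_id t).prodMk (hasDerivAt_const t (y, v))
  exact (hφ.hasFDerivAt.comp_hasDerivAt t hc).deriv

theorem inner_torusGrad_proj_eq {φ : ℝ → Torus d → Vel d → ℝ} {t : ℝ} {y v : Vel d}
    (hφ : DifferentiableAt ℝ (liftFun φ) (t, y, v)) (a : Vel d) :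
    inner ℝ a (torusGrad (fun x => φ t x v) (proj y))
      = fderiv ℝ (liftFun φ) (t, y, v) (0, a, 0) := by
  rw [torusGrad, inner_gradient_right]
  have hc : HasFDerivAt (fun y' : Vel d => (t, y + y', v))
      ((0 : Vel d →L[ℝ] ℝ).prod ((ContinuousLinearMap.id ℝ (Vel d)).prod 0)) 0 :=
    (hasFDerivAt_const t _).prodMk
      (((hasFDerivAt_id (0 : Vel d)).const_add y).prodMk (hasFDerivAt_const v _))
  have hF' : HasFDerivAt (liftFun φ) (fderiv ℝ (liftFun φ) (t, y, v)) (t, y + 0, v) := by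
    rw [add_zero]; exact hφ.hasFDerivAt
  have h3 := (hF'.comp (0 : Vel d) hc).fderiv
  have h4 : (fun y' : Vel d => φ t (proj y + proj y') v)
      = liftFun φ ∘ fun y' : Vel d => (t, y + y', v) := by
    funext y'; simp [liftFun, proj_add]
  rw [h4, h3]
  simp

theorem inner_gradient_proj_eq {φ : ℝ → Torus d → Vel d → ℝ} {t : ℝ} {y v : Vel d}
    (hφ : DifferentiableAt ℝ (liftFun φ) (t, y, v)) (a : Vel d) :
    inner ℝ a (gradient (fun w => φ t (proj y) w) v)
      = fderiv ℝ (liftFun φ) (t, y, v) (0, 0, a) := by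
  rw [inner_gradient_right]
  have hc : HasFDerivAt (fun w : Vel d => (t, y, w))
      ((0 : Vel d →L[ℝ] ℝ).prod ((0 : Vel d →L[ℝ] Vel d).prod (ContinuousLinearMap.id ℝ (Vel d))))
      v :=
    (hasFDerivAt_const t _).prodMk ((hasFDerivAt_const y _).prodMk (hasFDerivAt_id v))
  have h4 := (hφ.hasFDerivAt.comp v hc).fderiv
  have h5 : (fun w : Vel d => φ t (proj y) w) = liftFun φ ∘ fun w : Vel d => (t, y, w) := rfl
  rw [h5, h4]
  simp

/-- On the universal cover the transport operator is one directional derivative, along the generator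
of `spaceTimeFlow`; it can thus be estimated by difference quotients along that flow. -/
theorem transportOp_proj {φ : ℝ → Torus d → Vel d → ℝ} {t : ℝ} {y v : Vel d}
    (hφ : DifferentiableAt ℝ (liftFun φ) (t, y, v)) :
    transportOp W φ t (proj y) v = fderiv ℝ (liftFun φ) (t, y, v) (1, liftField W (y, v)) := by
  have h6 : liftField W (y, v) = (v, -torusGrad W (proj y)) := rfl
  rw [transportOp, deriv_proj_eq hφ, inner_torusGrad_proj_eq hφ, inner_gradient_proj_eq hφ, h6,
    ← map_add, ← map_sub]
  simp

/-- The flow of the transport operator on the universal cover of time and phase space. -/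
noncomputable def spaceTimeFlow (hW : TorusC2 W) (h : ℝ) (e : ℝ × Vel d × Vel d) :
    ℝ × Vel d × Vel d :=
  (e.1 + h, liftFlow hW h e.2)

theorem hasDerivAt_spaceTimeFlow (hW : TorusC2 W) (e : ℝ × Vel d × Vel d) :
    HasDerivAt (fun h => spaceTimeFlow hW h e) (1, liftField W e.2) 0 := by
  have h1 : HasDerivAt (fun h => liftFlow hW h e.2) (liftField W e.2) 0 := by
    simpa using hasDerivAt_liftFlow hW e.2 0
  exact ((hasDerivAt_id (0 : ℝ)).const_add e.1).prodMk h1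

@[simp]
theorem spaceTimeFlow_zero (hW : TorusC2 W) (e : ℝ × Vel d × Vel d) :
    spaceTimeFlow hW 0 e = e := by
  simp [spaceTimeFlow]

/-- The pull-back at time `s` of a function `ψ` prescribed at time `t`, on the universal cover. -/
noncomputable def pullback (hW : TorusC2 W) (ψ : Torus d × Vel d → ℝ) (t : ℝ)
    (e : ℝ × Vel d × Vel d) : ℝ :=
  ψ (projPhase (liftFlow hW (t - e.1) e.2))

/-- The backward transport equation in integrated form, which is meaningful although the pull-back
need not be differentiable. -/
theorem pullback_spaceTimeFlow (hW : TorusC2 W) (ψ : Torus d × Vel d → ℝ) (t h : ℝ)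
    (e : ℝ × Vel d × Vel d) : pullback hW ψ t (spaceTimeFlow hW h e) = pullback hW ψ t e := by
  simp only [pullback, spaceTimeFlow, ← liftFlow_add]
  congr 3; ring

theorem continuous_pullback (hW : TorusC2 W) {ψ : Torus d × Vel d → ℝ} (hψ : Continuous ψ)
    (t : ℝ) : Continuous (pullback hW ψ t) := by
  have h1 : Continuous fun e : ℝ × Vel d × Vel d => ((t - e.1, e.2) : ℝ × Vel d × Vel d) := by
    fun_prop
  exact hψ.comp (isOpenQuotientMap_projPhase.continuous.comp ((continuous_liftFlow hW).comp h1))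

/-- A Lipschitz function, compactly supported in velocity, varies slowly along the flow. -/
theorem exists_abs_comp_liftFlow_sub_le (hW : TorusC2 W) {ψ : Torus d × Vel d → ℝ} {L : NNReal}
    (hψ : LipschitzWith L ψ) {A : ℝ} (hA : ∀ z : Torus d × Vel d, A ≤ ‖z.2‖ → ψ z = 0) (H : ℝ) :
    ∃ C, 0 ≤ C ∧ ∀ h, |h| ≤ H → ∀ z,
      |ψ (projPhase (liftFlow hW h z)) - ψ (projPhase z)| ≤ C * |h| := by
  obtain ⟨D, hD0, hD⟩ := exists_norm_torusGrad_le hW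
  refine ⟨L * (|A| + 2 * (D * |H|) + D), by positivity, fun h hh z => ?_⟩
  have hH : |h| ≤ |H| := hh.trans (le_abs_self H)
  have hv := norm_liftFlow_snd_sub_le hW hD h z
  have hvH : ‖(liftFlow hW h z).2 - z.2‖ ≤ D * |H| := hv.trans (by gcongr)
  -- At large velocity `ψ` vanishes at both ends, since the velocity changes by at most `D * |H|`;
  -- at bounded velocity the displacement is of order `|h|`.
  by_cases hz : |A| + D * |H| ≤ ‖z.2‖
  · have h1 : ψ (projPhase z) = 0 := hA _ ((le_abs_self A).trans
      ((le_add_of_nonneg_right (by positivity)).trans hz))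
    have h2 : ψ (projPhase (liftFlow hW h z)) = 0 := by
      refine hA _ ((le_abs_self A).trans ?_)
      have h3 : ‖z.2‖ ≤ ‖(liftFlow hW h z).2‖ + ‖(liftFlow hW h z).2 - z.2‖ := by
        have := norm_sub_le (liftFlow hW h z).2 ((liftFlow hW h z).2 - z.2)
        simpa using this
      change |A| ≤ ‖(liftFlow hW h z).2‖
      linarith
    rw [h1, h2]; simp; positivity
  · push Not at hz
    have h1 := hψ.dist_le_mul (projPhase (liftFlow hW h z)) (projPhase z)
    rw [Real.dist_eq] at h1
    refine h1.trans ?_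
    rw [mul_assoc]
    refine mul_le_mul_of_nonneg_left ((dist_projPhase_le _ _).trans ?_) L.2
    refine max_le ?_ ?_
    · rw [dist_eq_norm]
      have h2 := norm_liftFlow_fst_sub_le hW hD h z
      have h3 : ‖(liftFlow hW h z).1 - z.1‖ ≤ D * |h| * |h| + |h| * ‖z.2‖ := by
        have h4 := norm_add_le ((liftFlow hW h z).1 - z.1 - h • z.2) (h • z.2)
        rw [sub_add_cancel, norm_smul, Real.norm_eq_abs] at h4
        linarith
      have h5 : D * |h| * |h| ≤ D * |H| * |h| := by gcongr
      have h6 : |h| * ‖z.2‖ ≤ |h| * (|A| + D * |H|) := by gcongr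
      nlinarith [abs_nonneg h]
    · rw [dist_eq_norm]
      refine hv.trans ?_
      gcongr
      have : 0 ≤ |A| + 2 * (D * |H|) := by positivity
      linarith

theorem pullback_eq_zero (hW : TorusC2 W) {ψ : Torus d × Vel d → ℝ} {A D : ℝ}
    (hA : ∀ z : Torus d × Vel d, A ≤ ‖z.2‖ → ψ z = 0) (hD : ∀ x, ‖torusGrad W x‖ ≤ D) {t : ℝ}
    {e : ℝ × Vel d × Vel d} (he : A + D * |t - e.1| ≤ ‖e.2.2‖) : pullback hW ψ t e = 0 := by
  have hv := norm_liftFlow_snd_sub_le hW hD (t - e.1) e.2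
  refine hA _ ?_
  have h3 : ‖e.2.2‖ ≤ ‖(liftFlow hW (t - e.1) e.2).2‖ + ‖(liftFlow hW (t - e.1) e.2).2 - e.2.2‖ := by
    have := norm_sub_le (liftFlow hW (t - e.1) e.2).2 ((liftFlow hW (t - e.1) e.2).2 - e.2.2)
    simpa using this
  change A ≤ ‖(liftFlow hW (t - e.1) e.2).2‖
  linarith

theorem abs_pullback_sub_le_of_fst_eq (hW : TorusC2 W) {K : NNReal}
    (hK : LipschitzWith K (liftField W)) {ψ : Torus d × Vel d → ℝ} {L : NNReal}
    (hψ : LipschitzWith L ψ) {t S s : ℝ} (hs : |t - s| ≤ S) (z z' : Vel d × Vel d) :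
    |pullback hW ψ t (s, z) - pullback hW ψ t (s, z')| ≤ L * Real.exp (K * S) * ‖z - z'‖ := by
  have h1 := hψ.dist_le_mul (projPhase (liftFlow hW (t - s) z)) (projPhase (liftFlow hW (t - s) z'))
  rw [Real.dist_eq] at h1
  refine h1.trans ?_
  rw [mul_assoc]
  refine mul_le_mul_of_nonneg_left ((dist_projPhase_le _ _).trans ?_) L.2
  refine (dist_liftFlow_le hW hK _ _ _).trans ?_
  rw [dist_eq_norm]
  gcongr

theorem exists_abs_pullback_sub_le (hW : TorusC2 W) {ψ : Torus d × Vel d → ℝ} {L : NNReal}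
    (hψ : LipschitzWith L ψ) {A : ℝ} (hA : ∀ z : Torus d × Vel d, A ≤ ‖z.2‖ → ψ z = 0) (t S : ℝ) :
    ∃ C, 0 ≤ C ∧ ∀ e e' : ℝ × Vel d × Vel d, |t - e.1| ≤ S → |t - e'.1| ≤ S →
      |pullback hW ψ t e - pullback hW ψ t e'| ≤ C * ‖e - e'‖ := by
  obtain ⟨K, hK⟩ := exists_lipschitzWith_liftField hW
  obtain ⟨C, hC0, hC⟩ := exists_abs_comp_liftFlow_sub_le hW hψ hA (2 * S)
  refine ⟨C + L * Real.exp (K * S), by positivity, fun e e' he he' => ?_⟩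
  obtain ⟨s, z⟩ := e
  obtain ⟨s', z'⟩ := e'
  have h1 := abs_pullback_sub_le_of_fst_eq hW hK hψ he' z z'
  have h2 : |pullback hW ψ t (s, z) - pullback hW ψ t (s', z)| ≤ C * |s' - s| := by
    have := hC (s' - s) (by
      simp only at he he'
      rw [abs_le] at *
      constructor <;> linarith) (liftFlow hW (t - s') z)
    rw [← liftFlow_add] at this
    simpa [pullback] using this
  have h3 : ‖((s, z) : ℝ × Vel d × Vel d) - (s', z')‖ = max |s' - s| ‖z - z'‖ := by
    rw [Prod.mk_sub_mk, Prod.norm_mk, Real.norm_eq_abs, abs_sub_comm]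
  rw [h3]
  calc |pullback hW ψ t (s, z) - pullback hW ψ t (s', z')|
      ≤ |pullback hW ψ t (s, z) - pullback hW ψ t (s', z)|
        + |pullback hW ψ t (s', z) - pullback hW ψ t (s', z')| := abs_sub_le _ _ _
    _ ≤ C * |s' - s| + L * Real.exp (K * S) * ‖z - z'‖ := add_le_add h2 h1
    _ ≤ C * max |s' - s| ‖z - z'‖ + L * Real.exp (K * S) * max |s' - s| ‖z - z'‖ := by
        gcongr
        · exact le_max_left _ _
        · exact le_max_right _ _
    _ = _ := by ring

/-! ### Mollification of functions pulled back by the flow. -/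

/-- Smooth mollifiers at scale `ε`. -/
structure IsMollifier {E : Type*} [NormedAddCommGroup E] [NormedSpace ℝ E] [MeasurableSpace E]
    (μ : Measure E) (ε : ℝ) (ρ : E → ℝ) : Prop where
  contDiff : ContDiff ℝ 1 ρ
  compact : HasCompactSupport ρ
  nonneg : ∀ y, 0 ≤ ρ y
  integral : ∫ y, ρ y ∂μ = 1
  eq_zero : ∀ y, ε ≤ ‖y‖ → ρ y = 0

theorem exists_isMollifier {E : Type*} [NormedAddCommGroup E] [NormedSpace ℝ E]
    [FiniteDimensional ℝ E] [MeasurableSpace E] [BorelSpace E] (μ : Measure E)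
    [IsLocallyFiniteMeasure μ] [μ.IsOpenPosMeasure] {ε : ℝ} (hε : 0 < ε) :
    ∃ ρ, IsMollifier μ ε ρ := by
  let b : ContDiffBump (0 : E) := ⟨ε / 2, ε, by positivity, by linarith⟩
  refine ⟨b.normed μ, b.contDiff_normed, b.hasCompactSupport_normed, b.nonneg_normed,
    b.integral_normed, fun y hy => ?_⟩
  have : y ∉ Function.support (b.normed μ) := by
    rw [b.support_normed_eq]
    simpa [b] using hy
  simpa using this

namespace IsMollifier

variable {E : Type*} [NormedAddCommGroup E] [NormedSpace ℝ E] [MeasurableSpace E] [BorelSpace E]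
  {μ : Measure E} {ε : ℝ} {ρ : E → ℝ}

theorem integrable_mul [IsFiniteMeasureOnCompacts μ] (h : IsMollifier μ ε ρ) {g : E → ℝ}
    (hg : Continuous g) : Integrable (fun y => ρ y * g y) μ :=
  (h.contDiff.continuous.mul hg).integrable_of_hasCompactSupport h.compact.mul_right

theorem abs_integral_mul_le [IsFiniteMeasureOnCompacts μ] (h : IsMollifier μ ε ρ) {g : E → ℝ}
    {C : ℝ} (hg : ∀ y, ‖y‖ < ε → |g y| ≤ C) : |∫ y, ρ y * g y ∂μ| ≤ C := by
  have h1 : ∀ y, ‖ρ y * g y‖ ≤ ρ y * C := fun y => by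
    rw [norm_mul, Real.norm_of_nonneg (h.nonneg y), Real.norm_eq_abs]
    rcases lt_or_ge ‖y‖ ε with hy | hy
    · exact mul_le_mul_of_nonneg_left (hg y hy) (h.nonneg y)
    · rw [h.eq_zero y hy]; simp
  have h2 := norm_integral_le_of_norm_le
    ((h.contDiff.continuous.integrable_of_hasCompactSupport (μ := μ) h.compact).mul_const C)
    (Filter.Eventually.of_forall h1)
  rwa [integral_mul_const, h.integral, one_mul] at h2

theorem abs_integral_sub_le [IsFiniteMeasureOnCompacts μ] (h : IsMollifier μ ε ρ) {g g' : E → ℝ}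
    (hg : Continuous g) (hg' : Continuous g') {C : ℝ} (hgg' : ∀ y, ‖y‖ < ε → |g y - g' y| ≤ C) :
    |∫ y, ρ y * g y ∂μ - ∫ y, ρ y * g' y ∂μ| ≤ C := by
  rw [← integral_sub (h.integrable_mul hg) (h.integrable_mul hg')]
  simp only [← mul_sub]
  exact h.abs_integral_mul_le hgg'

theorem contDiff_convolution [FiniteDimensional ℝ E] [μ.IsAddHaarMeasure]
    (h : IsMollifier μ ε ρ) {g : E → ℝ} (hg : Continuous g) :
    ContDiff ℝ 1 fun e => ∫ y, ρ y * g (e - y) ∂μ := by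
  have := h.compact.contDiff_convolution_left (ContinuousLinearMap.mul ℝ ℝ) (n := 1)
    h.contDiff (hg.locallyIntegrable (μ := μ))
  exact this

end IsMollifier

/-- Test functions approximating `θ(s) ψ(Φ_{t-s}(x, v))`, together with their transport
derivative. -/
theorem exists_isTestFunction_approx (hW : TorusC2 W) {ψ : Torus d × Vel d → ℝ} {L : NNReal}
    (hψ : LipschitzWith L ψ) {A : ℝ} (hA : ∀ z : Torus d × Vel d, A ≤ ‖z.2‖ → ψ z = 0) (t : ℝ)
    {θ : ℝ → ℝ} (hθ : ContDiff ℝ 1 θ) (hθc : HasCompactSupport θ) {τ : ℝ}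
    (hτ : ∀ s ∈ tsupport θ, s < τ) :
    ∃ C, 0 ≤ C ∧ ∀ ε, 0 < ε → ε ≤ 1 → ∃ φ, IsTestFunction τ φ ∧ ∀ s x v,
      |φ s x v - θ s * ψ (flow hW (t - s) (x, v))| ≤ C * ε ∧
      |transportOp W φ s x v - deriv θ s * ψ (flow hW (t - s) (x, v))| ≤ C * ε := by
  obtain ⟨K, hK⟩ := exists_lipschitzWith_liftField hW
  obtain ⟨D, hD0, hD⟩ := exists_norm_torusGrad_le hW
  obtain ⟨S₀, hS₀⟩ := hθc.isCompact.isBounded.exists_norm_le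
  -- The margin of `2` leaves room for a time shift of at most `1` by the mollifier and another of
  -- at most `1` along the flow.
  set S : ℝ := |t| + |S₀| + 2 with hS
  have hS0 : 0 ≤ S := by positivity
  have hwin : ∀ s ∈ tsupport θ, ∀ r : ℝ, |r| ≤ 2 → |t - (s + r)| ≤ S := fun s hs r hr => by
    have h1 : |s| ≤ |S₀| := (hS₀ s hs).trans (le_abs_self _)
    calc |t - (s + r)| ≤ |t| + |s + r| := abs_sub _ _
      _ ≤ |t| + (|s| + |r|) := by gcongr; exact abs_add_le _ _
      _ ≤ S := by linarith
  obtain ⟨C₁, hC₁0, hC₁⟩ := exists_abs_pullback_sub_le hW hψ hA t S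
  obtain ⟨B₀, hB₀⟩ := hθc.exists_bound_of_continuous hθ.continuous
  have hθ' : Continuous (deriv θ) := hθ.continuous_deriv le_rfl
  obtain ⟨B₁, hB₁⟩ := hθc.deriv.exists_bound_of_continuous hθ'
  have hB₀0 : 0 ≤ B₀ := (norm_nonneg _).trans (hB₀ 0)
  have hB₁0 : 0 ≤ B₁ := (norm_nonneg _).trans (hB₁ 0)
  set C₂ : ℝ := L * Real.exp (K * S) * (K * Real.exp K) with hC₂
  have hC₂0 : 0 ≤ C₂ := by have := K.2; positivity
  refine ⟨B₀ * C₁ + (B₁ * C₁ + B₀ * C₂), by positivity, fun ε hε hε1 => ?_⟩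
  let μ : Measure (ℝ × Vel d × Vel d) := Measure.addHaar
  obtain ⟨ρ, hρ⟩ := exists_isMollifier μ hε
  set g := pullback hW ψ t with hg
  have hgc : Continuous g := continuous_pullback hW hψ.continuous t
  have hgs : ∀ e, Continuous fun y => g (e - y) := fun e =>
    hgc.comp (continuous_const.sub continuous_id)
  set m : ℝ × Vel d × Vel d → ℝ := fun e => ∫ y, ρ y * g (e - y) ∂μ with hm
  have hm1 : ContDiff ℝ 1 m := hρ.contDiff_convolution hgc
  -- The same convolution written on the torus: a test function has to be defined there, and `m` is
  -- its lift.
  let m' : ℝ → Torus d → Vel d → ℝ := fun s x v =>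
    ∫ y, ρ y * ψ (flow hW (t - (s - y.1)) (x - proj y.2.1, v - y.2.2)) ∂μ
  have hmm' : ∀ s y v, m' s (proj y) v = m (s, y, v) := by
    intro s y v
    simp only [m', hm, hg, pullback]
    refine integral_congr_ae (Filter.Eventually.of_forall fun e => ?_)
    have h1 : proj y - proj e.2.1 = proj (y - e.2.1) := by
      rw [sub_eq_iff_eq_add, ← proj_add, sub_add_cancel]
    have h2 := flow_projPhase hW (t - (s - e.1)) (y - e.2.1, v - e.2.2)
    simp only [projPhase] at h2
    simp only [h1, h2, projPhase, Prod.fst_sub, Prod.snd_sub]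
    rfl
  let φ : ℝ → Torus d → Vel d → ℝ := fun s x v => θ s * m' s x v
  have hlift : liftFun φ = fun e => θ e.1 * m e := by
    funext e; simp only [liftFun, φ, hmm']
  have hφ1 : ContDiff ℝ 1 (liftFun φ) := by
    rw [hlift]; exact (hθ.comp contDiff_fst).mul hm1
  have happrox : ∀ s ∈ tsupport θ, ∀ z, |m (s, z) - g (s, z)| ≤ C₁ * ε := by
    intro s hs z
    have h1 : g (s, z) = ∫ y, ρ y * g (s, z) ∂μ := by
      rw [integral_mul_const, hρ.integral, one_mul]
    rw [h1]
    refine hρ.abs_integral_sub_le (hgs _)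
      continuous_const fun y hy => ?_
    refine (hC₁ _ _ ?_ ?_).trans ?_
    · have := hwin s hs (-y.1) (by
        rw [abs_neg, ← Real.norm_eq_abs]
        exact (norm_fst_le y).trans (by linarith))
      simpa [sub_eq_add_neg] using this
    · simpa using hwin s hs 0 (by simp)
    · have : ((s, z) : ℝ × Vel d × Vel d) - y - (s, z) = -y := by abel
      rw [this, norm_neg]
      gcongr
  -- The unmollified `g` is constant along the flow, so the increment of `m` is an average of `g` at
  -- the shift of the flowed point minus `g` at the flow of the shifted point. These points differ
  -- by at most a constant times `‖y‖ |h|`, and `‖y‖ ≤ ε` on the support of the mollifier.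
  have hcomm : ∀ s ∈ tsupport θ, ∀ z,
      |fderiv ℝ m (s, z) (1, liftField W z)| ≤ C₂ * ε := by
    intro s hs z
    have h1 : HasDerivAt (fun h => m (spaceTimeFlow hW h (s, z)))
        (fderiv ℝ m (s, z) (1, liftField W z)) 0 := by
      have h2 : HasFDerivAt m (fderiv ℝ m (s, z)) (spaceTimeFlow hW 0 (s, z)) := by
        rw [spaceTimeFlow_zero]
        exact (hm1.differentiable one_ne_zero _).hasFDerivAt
      exact h2.comp_hasDerivAt 0 (hasDerivAt_spaceTimeFlow hW (s, z))
    rw [← Real.norm_eq_abs]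
    refine h1.le_of_lip' (by positivity) ?_
    filter_upwards [Metric.ball_mem_nhds (0 : ℝ) one_pos] with h hh
    have hh1 : |h| ≤ 1 := by
      have : |h| < 1 := by simpa using hh
      exact this.le
    simp only [spaceTimeFlow_zero, sub_zero, Real.norm_eq_abs, hm]
    have h3 : (fun y => ρ y * g ((s, z) - y))
        = fun y => ρ y * g (spaceTimeFlow hW h ((s, z) - y)) := by
      funext y; rw [hg, pullback_spaceTimeFlow]
    rw [h3]
    have hcont : Continuous fun y => g (spaceTimeFlow hW h ((s, z) - y)) := by
      have : (fun y => g (spaceTimeFlow hW h ((s, z) - y))) = fun y => g ((s, z) - y) := by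
        funext y; rw [hg, pullback_spaceTimeFlow]
      rw [this]
      exact hgs _
    refine hρ.abs_integral_sub_le (hgs _)
      hcont fun y hy => ?_
    have hy1 : |y.1| ≤ 1 := by
      rw [← Real.norm_eq_abs]; exact (norm_fst_le y).trans (by linarith)
    have h4 : spaceTimeFlow hW h (s, z) - y = (s + (h - y.1), liftFlow hW h z - y.2) := by
      ext <;> simp [spaceTimeFlow] <;> ring
    have h5 : spaceTimeFlow hW h ((s, z) - y) = (s + (h - y.1), liftFlow hW h (z - y.2)) := by
      simp only [spaceTimeFlow, Prod.fst_sub, Prod.snd_sub]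
      congr 1; ring
    rw [h4, h5]
    refine (abs_pullback_sub_le_of_fst_eq hW hK hψ (hwin s hs _ ?_) _ _).trans ?_
    · exact (abs_sub _ _).trans (by linarith)
    · have h6 := norm_liftFlow_sub_sub_le hW hK hh1 z (z - y.2)
      have h7 : liftFlow hW h z - liftFlow hW h (z - y.2) - (z - (z - y.2))
          = liftFlow hW h z - y.2 - liftFlow hW h (z - y.2) := by abel
      rw [h7, sub_sub_cancel] at h6
      have h8 : ‖y.2‖ ≤ ε := (norm_snd_le y).trans hy.le
      calc _ ≤ L * Real.exp (K * S) * (K * Real.exp K * ‖y.2‖ * |h|) := by gcongr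
        _ ≤ L * Real.exp (K * S) * (K * Real.exp K * ε * |h|) := by
          have := K.2
          gcongr
        _ = _ := by rw [hC₂]; ring
  refine ⟨φ, ⟨hφ1, ?_, ?_⟩, fun s x v => ?_⟩
  · refine HasCompactSupport.intro (K := tsupport θ ×ˢ (Set.univ ×ˢ Metric.closedBall 0
      (A + D * S + 1))) (hθc.isCompact.prod (isCompact_univ.prod (isCompact_closedBall _ _)))
      fun q hq => ?_
    obtain ⟨s, x, v⟩ := q
    by_cases hs : s ∈ tsupport θ
    · have hv : A + D * S + 1 < ‖v‖ := by
        by_contra hcon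
        exact hq ⟨hs, trivial, by simpa using hcon⟩
      obtain ⟨y, rfl⟩ := proj_surjective x
      have : m (s, y, v) = 0 := by
        refine integral_eq_zero_of_ae (Filter.Eventually.of_forall fun e => ?_)
        simp only [Pi.zero_apply, mul_eq_zero]
        by_cases he : ε ≤ ‖e‖
        · exact Or.inl (hρ.eq_zero e he)
        · right
          push Not at he
          refine pullback_eq_zero hW hA hD ?_
          have h1 : |t - (s - e.1)| ≤ S := by
            have := hwin s hs (-e.1) (by
              rw [abs_neg, ← Real.norm_eq_abs]
              exact (norm_fst_le e).trans (by linarith))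
            simpa [sub_eq_add_neg] using this
          have h2 : ‖e.2.2‖ ≤ 1 := (norm_snd_le e.2).trans ((norm_snd_le e).trans (by linarith))
          have h3 : ‖v‖ ≤ ‖v - e.2.2‖ + ‖e.2.2‖ := by
            have := norm_add_le (v - e.2.2) e.2.2
            simpa using this
          have h4 : D * |t - (s - e.1)| ≤ D * S := by gcongr
          simp only [Prod.fst_sub, Prod.snd_sub]
          linarith
      simp only [φ, hmm', this, mul_zero]
    · simp only [φ, image_eq_zero_of_notMem_tsupport hs, zero_mul]
  · intro z hz
    refine hτ z.1 ?_
    have hcl : IsClosed {z : ℝ × Torus d × Vel d | z.1 ∈ tsupport θ} :=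
      (isClosed_tsupport θ).preimage continuous_fst
    refine closure_minimal (fun q hq => ?_) hcl hz
    by_contra hcon
    exact hq (by simp only [φ, image_eq_zero_of_notMem_tsupport hcon, zero_mul])
  · obtain ⟨y, rfl⟩ := proj_surjective x
    have h1 : ψ (flow hW (t - s) (proj y, v)) = g (s, y, v) := by
      have := flow_projPhase hW (t - s) (y, v)
      simp only [projPhase] at this
      rw [this]; rfl
    have h2 : transportOp W φ s (proj y) v
        = deriv θ s * m (s, y, v) + θ s * fderiv ℝ m (s, y, v) (1, liftField W (y, v)) := by
      rw [transportOp_proj (hφ1.differentiable one_ne_zero _), hlift]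
      have h3 : HasFDerivAt (fun e : ℝ × Vel d × Vel d => θ e.1)
          ((ContinuousLinearMap.toSpanSingleton ℝ (deriv θ s)).comp
            (ContinuousLinearMap.fst ℝ ℝ (Vel d × Vel d))) (s, y, v) :=
        HasFDerivAt.comp (s, y, v)
          (hθ.differentiable one_ne_zero s).hasDerivAt.hasFDerivAt hasFDerivAt_fst
      have h4 := (h3.mul (hm1.differentiable one_ne_zero (s, y, v)).hasFDerivAt).fderiv
      have h5 : (fun e : ℝ × Vel d × Vel d => θ e.1 * m e)
          = (fun e : ℝ × Vel d × Vel d => θ e.1) * m := rfl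
      rw [h5, h4]
      simp
      ring
    have h3 : φ s (proj y) v = θ s * m (s, y, v) := by simp only [φ, hmm']
    rw [h1, h2, h3]
    by_cases hs : s ∈ tsupport θ
    · have h4 := happrox s hs (y, v)
      have h5 := hcomm s hs (y, v)
      have hb0 : |θ s| ≤ B₀ := hB₀ s
      have hb1 : |deriv θ s| ≤ B₁ := hB₁ s
      have h6 : |θ s| * |m (s, y, v) - g (s, y, v)| ≤ B₀ * (C₁ * ε) := by gcongr
      have h7 : |deriv θ s| * |m (s, y, v) - g (s, y, v)| ≤ B₁ * (C₁ * ε) := by gcongr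
      have h8 : |θ s| * |fderiv ℝ m (s, y, v) (1, liftField W (y, v))| ≤ B₀ * (C₂ * ε) := by
        gcongr
      constructor
      · rw [← mul_sub, abs_mul]
        have : 0 ≤ (B₁ * C₁ + B₀ * C₂) * ε := by positivity
        linarith
      · have h9 : deriv θ s * m (s, y, v) + θ s * fderiv ℝ m (s, y, v) (1, liftField W (y, v))
            - deriv θ s * g (s, y, v) = deriv θ s * (m (s, y, v) - g (s, y, v))
            + θ s * fderiv ℝ m (s, y, v) (1, liftField W (y, v)) := by ring
        rw [h9]
        refine (abs_add_le _ _).trans ?_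
        rw [abs_mul, abs_mul]
        have : 0 ≤ B₀ * C₁ * ε := by positivity
        linarith
    · have h4 : deriv θ s = 0 :=
        image_eq_zero_of_notMem_tsupport fun h => hs (tsupport_deriv_subset h)
      rw [image_eq_zero_of_notMem_tsupport hs, h4]
      simp only [zero_mul, sub_zero, add_zero, abs_zero]
      constructor <;> positivity

end TestFunctions

end LinearBoltzmann

namespace LinearBoltzmann

/-! ### A linear differential equation in the weak sense -/

/-- The mild form of a scalar differential equation `a' = k`, `a 0 = m₀` given in weak form, with
an integrating factor. -/
theorem eq_of_weak_ode {τ c m₀ : ℝ} {a k : ℝ → ℝ} (hτ : 0 < τ)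
    (ha : ContinuousOn a (Set.Icc 0 τ)) (hk : IntervalIntegrable k volume 0 τ)
    (H : ∀ θ : ℝ → ℝ, ContDiff ℝ 1 θ → HasCompactSupport θ → (∀ s ∈ tsupport θ, s < τ) →
      ∫ s in (0 : ℝ)..τ, (deriv θ s * a s + θ s * k s) = -(θ 0 * m₀))
    {t : ℝ} (ht : t ∈ Set.Icc 0 τ) :
    Real.exp (c * t) * a t = m₀ + ∫ s in (0 : ℝ)..t, Real.exp (c * s) * (c * a s + k s) := by
  have hexp : Continuous fun s : ℝ => Real.exp (c * s) := by fun_prop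
  set q : ℝ → ℝ := fun s => Real.exp (c * s) * (c * a s + k s) with hq
  set Q : ℝ → ℝ := fun r => ∫ s in (0 : ℝ)..r, q s with hQ
  have ha' : ContinuousOn a (Set.uIcc 0 τ) := by rwa [Set.uIcc_of_le hτ.le]
  have hqi : IntervalIntegrable q volume 0 τ :=
    (((ha'.intervalIntegrable).const_mul c).add hk).continuousOn_mul hexp.continuousOn
  have hQc : ContinuousOn Q (Set.Icc 0 τ) := by
    have := intervalIntegral.continuousOn_primitive_interval' hqi Set.left_mem_uIcc
    rwa [Set.uIcc_of_le hτ.le] at this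
  set b : ℝ → ℝ := fun s => Real.exp (c * s) * a s - m₀ - Q s with hb
  have hbc : ContinuousOn b (Set.Icc 0 τ) :=
    ((hexp.continuousOn.mul ha).sub continuousOn_const).sub hQc
  -- It suffices that `b`, the defect in the claimed identity, integrates to zero against every
  -- smooth `η` supported in the open interval.
  have hkey : ∀ᵐ s, s ∈ Set.Ioo 0 τ → b s = 0 := by
    refine isOpen_Ioo.ae_eq_zero_of_integral_contDiff_smul_eq_zero
      ((hbc.mono Set.Ioo_subset_Icc_self).locallyIntegrableOn measurableSet_Ioo)
      fun η hη hηc hηs => ?_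
    have hηz : ∀ s, s ∉ Set.Ioo 0 τ → η s = 0 := fun s hs =>
      image_eq_zero_of_notMem_tsupport fun h => hs (hηs h)
    obtain ⟨τ', hτ'τ, hτ'⟩ : ∃ τ' < τ, ∀ s ∈ tsupport η, s ≤ τ' := by
      rcases (tsupport η).eq_empty_or_nonempty with h | h
      · exact ⟨τ - 1, by linarith, by simp [h]⟩
      · obtain ⟨x, hx, hmax⟩ := hηc.isCompact.exists_isMaxOn h continuousOn_id
        exact ⟨x, (hηs hx).2, fun s hs => hmax hs⟩
    set P : ℝ → ℝ := fun s => ∫ r in (0 : ℝ)..s, η r with hP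
    have hPd : ∀ s, HasDerivAt P (η s) s := fun s =>
      intervalIntegral.integral_hasDerivAt_right (hη.continuous.intervalIntegrable _ _)
        (hη.continuous.stronglyMeasurableAtFilter _ _) hη.continuous.continuousAt
    -- On `[0, τ]` this is the integral of `η` from `s` to `τ`, a primitive of `-η`. Subtracting a
    -- translate makes it compactly supported on the whole line, so that `exp (c s) * N s` is an
    -- admissible `θ`.
    set N : ℝ → ℝ := fun s => P (s + τ) - P s with hN
    have hNd : ∀ s, HasDerivAt N (η (s + τ) - η s) s := fun s =>
      ((hPd (s + τ)).comp_add_const s τ).sub (hPd s)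
    have hN1 : ContDiff ℝ 1 N := by
      rw [contDiff_one_iff_deriv]
      refine ⟨fun s => (hNd s).differentiableAt, ?_⟩
      have : deriv N = fun s => η (s + τ) - η s := funext fun s => (hNd s).deriv
      rw [this]
      exact (hη.continuous.comp (continuous_id.add continuous_const)).sub hη.continuous
    have hNeq : ∀ s, N s = ∫ r in s..(s + τ), η r := fun s => by
      simp only [hN, hP]
      exact intervalIntegral.integral_interval_sub_left (hη.continuous.intervalIntegrable _ _)
        (hη.continuous.intervalIntegrable _ _)
    have hNzero : ∀ s, s ∉ Set.Icc (-τ) τ' → N s = 0 := by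
      intro s hs
      rw [hNeq]
      refine intervalIntegral.integral_zero_ae (Filter.Eventually.of_forall fun r hr => ?_)
      rw [Set.uIoc_of_le (by linarith)] at hr
      by_cases h1 : s < -τ
      · exact hηz r fun h => by have := h.1; linarith [hr.2]
      · have h2 : τ' < s := by
          by_contra hcon
          exact hs ⟨not_lt.1 h1, not_lt.1 hcon⟩
        exact image_eq_zero_of_notMem_tsupport fun h => by linarith [hτ' r h, hr.1]
    set θ : ℝ → ℝ := fun s => Real.exp (c * s) * N s with hθ
    have hθ1 : ContDiff ℝ 1 θ := (Real.contDiff_exp.comp (contDiff_const.mul contDiff_id)).mul hN1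
    have hθc : HasCompactSupport θ := HasCompactSupport.intro (isCompact_Icc (a := -τ) (b := τ'))
      fun s hs => by simp only [hθ, hNzero s hs, mul_zero]
    have hθs : ∀ s ∈ tsupport θ, s < τ := by
      intro s hs
      have h1 : tsupport θ ⊆ Set.Icc (-τ) τ' := closure_minimal (fun r hr => by
        by_contra hcon
        exact hr (by simp only [hθ, hNzero r hcon, mul_zero])) isClosed_Icc
      exact (h1 hs).2.trans_lt hτ'τ
    have hH := H θ hθ1 hθc hθs
    have hθd : ∀ s, deriv θ s = c * θ s + Real.exp (c * s) * (η (s + τ) - η s) := fun s => by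
      have h1 : HasDerivAt (fun s : ℝ => Real.exp (c * s)) (Real.exp (c * s) * (c * 1)) s :=
        ((hasDerivAt_id s).const_mul c).exp
      refine (h1.mul (hNd s)).deriv.trans ?_
      simp only [hθ]; ring
    have hN0 : N 0 = ∫ r in (0 : ℝ)..τ, η r := by rw [hNeq, zero_add]
    have hi1 : IntervalIntegrable (fun s => N s * q s) volume 0 τ :=
      hqi.continuousOn_mul hN1.continuous.continuousOn
    have hi2 : IntervalIntegrable (fun s => η s * (Real.exp (c * s) * a s)) volume 0 τ :=
      ((hexp.continuousOn.mul ha').intervalIntegrable).continuousOn_mul hη.continuous.continuousOn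
    have hi3 : IntervalIntegrable (fun s => η s * Q s) volume 0 τ := by
      refine (ContinuousOn.mul hη.continuous.continuousOn ?_).intervalIntegrable
      rwa [Set.uIcc_of_le hτ.le]
    have h1 : ∫ s in (0 : ℝ)..τ, (deriv θ s * a s + θ s * k s)
        = (∫ s in (0 : ℝ)..τ, N s * q s) - ∫ s in (0 : ℝ)..τ, η s * (Real.exp (c * s) * a s) := by
      rw [← intervalIntegral.integral_sub hi1 hi2]
      refine intervalIntegral.integral_congr_ae (Filter.Eventually.of_forall fun s hs => ?_)
      rw [Set.uIoc_of_le hτ.le] at hs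
      have : η (s + τ) = 0 := hηz _ fun h => by linarith [h.2, hs.1]
      rw [hθd, this]
      simp only [hθ, hq]; ring
    -- Integration by parts, with `Q` only absolutely continuous; the boundary terms vanish because
    -- `N τ = 0` and `Q 0 = 0`.
    have h2 : ∫ s in (0 : ℝ)..τ, N s * q s = ∫ s in (0 : ℝ)..τ, η s * Q s := by
      have hNac : AbsolutelyContinuousOnInterval N 0 τ := by
        obtain ⟨C, hC⟩ := hηc.exists_bound_of_continuous hη.continuous
        have : LipschitzWith (2 * C).toNNReal N :=
          lipschitzWith_of_nnnorm_deriv_le (fun s => (hNd s).differentiableAt) fun s => by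
            rw [(hNd s).deriv, ← NNReal.coe_le_coe, coe_nnnorm]
            refine (norm_sub_le _ _).trans ?_
            refine le_trans ?_ (Real.le_coe_toNNReal _)
            linarith [hC s, hC (s + τ)]
        exact (this.lipschitzOnWith).absolutelyContinuousOnInterval
      have hQac : AbsolutelyContinuousOnInterval Q 0 τ :=
        hqi.absolutelyContinuousOnInterval_intervalIntegral Set.left_mem_uIcc
      have h3 := hNac.integral_mul_deriv_eq_deriv_mul hQac
      have hNτ : N τ = 0 := hNzero τ fun h => by linarith [h.2]
      have hQ0 : Q 0 = 0 := by simp [hQ]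
      rw [hNτ, hQ0] at h3
      have h4 : ∫ s in (0 : ℝ)..τ, N s * deriv Q s = ∫ s in (0 : ℝ)..τ, N s * q s := by
        refine intervalIntegral.integral_congr_ae ?_
        filter_upwards [hqi.ae_hasDerivAt_integral] with s hs hs'
        rw [(hs (Set.uIoc_subset_uIcc hs') 0 Set.left_mem_uIcc).deriv]
      have h5 : ∫ s in (0 : ℝ)..τ, deriv N s * Q s = -∫ s in (0 : ℝ)..τ, η s * Q s := by
        rw [← intervalIntegral.integral_neg]
        refine intervalIntegral.integral_congr_ae (Filter.Eventually.of_forall fun s hs => ?_)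
        rw [Set.uIoc_of_le hτ.le] at hs
        have : η (s + τ) = 0 := hηz _ fun h => by linarith [h.2, hs.1]
        rw [(hNd s).deriv, this]; ring
      rw [h4, h5] at h3
      linarith
    have h6 : ∫ s, η s • b s = ∫ s in (0 : ℝ)..τ, η s * b s := by
      rw [intervalIntegral.integral_of_le hτ.le, ← setIntegral_eq_integral_of_forall_compl_eq_zero
        (s := Set.Ioc 0 τ)]
      · simp only [smul_eq_mul]
      · intro s hs
        rw [hηz s fun h => hs ⟨h.1, h.2.le⟩, zero_smul]
    have h7 : ∫ s in (0 : ℝ)..τ, η s * b s = (∫ s in (0 : ℝ)..τ, η s * (Real.exp (c * s) * a s))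
        - (∫ s in (0 : ℝ)..τ, η s) * m₀ - ∫ s in (0 : ℝ)..τ, η s * Q s := by
      have hi4 : IntervalIntegrable (fun s => η s * m₀) volume 0 τ :=
        (hη.continuous.mul continuous_const).intervalIntegrable _ _
      rw [← intervalIntegral.integral_mul_const, ← intervalIntegral.integral_sub hi2 hi4,
        ← intervalIntegral.integral_sub (hi2.sub hi4) hi3]
      refine intervalIntegral.integral_congr fun s _ => ?_
      simp only [hb]; ring
    have h8 : θ 0 = ∫ r in (0 : ℝ)..τ, η r := by simp only [hθ, mul_zero, Real.exp_zero, one_mul, hN0]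
    rw [h6, h7, ← h2]
    rw [h1, h8] at hH
    linarith
  have hae : b =ᵐ[volume.restrict (Set.Ioo 0 τ)] fun _ => (0 : ℝ) :=
    (ae_restrict_iff' measurableSet_Ioo).2 hkey
  have hopen := Measure.eqOn_open_of_ae_eq hae isOpen_Ioo (hbc.mono Set.Ioo_subset_Icc_self)
    continuousOn_const
  have := hopen.of_subset_closure hbc continuousOn_const Set.Ioo_subset_Icc_self
    (closure_Ioo hτ.ne).ge ht
  simp only [hb] at this
  linarith

end LinearBoltzmann

namespace LinearBoltzmann

open ProbabilityTheory

/-! ### Weakly continuous curves of probability measures as kernels -/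

/-- Closed sets form a generating π-system, and the mass of a closed set is the limit of integrals
of thickened indicators, each of which is continuous in `s`. -/
theorem measurable_of_continuous_probabilityMeasure {X : Type*} [PseudoEMetricSpace X]
    [MeasurableSpace X] [BorelSpace X] {m : ℝ → ProbabilityMeasure X} (hm : Continuous m) :
    Measurable fun s => (m s : Measure X) := by
  refine Measurable.measure_of_isPiSystem_of_isProbabilityMeasure
    (BorelSpace.measurable_eq.trans borel_eq_generateFrom_isClosed) isPiSystem_isClosed
    fun F hF => ?_
  have hδ : ∀ n : ℕ, (0 : ℝ) < 1 / ((n : ℝ) + 1) := fun n => by positivity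
  refine measurable_of_tendsto_metrizable (fun n => ?_) (tendsto_pi_nhds.2 fun s =>
    tendsto_lintegral_thickenedIndicator_of_isClosed (m s : Measure X) hF hδ
      tendsto_one_div_add_atTop_nhds_zero_nat)
  refine Continuous.measurable (continuous_iff_continuousAt.2 fun s => ?_)
  exact (ProbabilityMeasure.tendsto_iff_forall_lintegral_tendsto.1 (hm.tendsto s)) _

/-- The kernel given by a weakly continuous curve of probability measures. -/
noncomputable def curveKernel {X : Type*} [PseudoEMetricSpace X]
    [MeasurableSpace X] [BorelSpace X] {m : ℝ → ProbabilityMeasure X} (hm : Continuous m) :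
    Kernel ℝ X :=
  ⟨fun s => (m s : Measure X), measurable_of_continuous_probabilityMeasure hm⟩

@[simp]
theorem curveKernel_apply {X : Type*} [PseudoEMetricSpace X]
    [MeasurableSpace X] [BorelSpace X] {m : ℝ → ProbabilityMeasure X} (hm : Continuous m) (s : ℝ) :
    curveKernel hm s = (m s : Measure X) := rfl

instance {X : Type*} [PseudoEMetricSpace X] [MeasurableSpace X] [BorelSpace X]
    {m : ℝ → ProbabilityMeasure X} (hm : Continuous m) : IsMarkovKernel (curveKernel hm) :=
  ⟨fun s => by rw [curveKernel_apply]; infer_instance⟩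

theorem abs_integral_le_of_abs_le {X : Type*} [MeasurableSpace X] {μ : Measure X}
    [IsProbabilityMeasure μ] {f : X → ℝ} {C : ℝ} (hf : ∀ x, |f x| ≤ C) : |∫ x, f x ∂μ| ≤ C := by
  have := norm_integral_le_of_norm_le_const (μ := μ) (f := f) (C := C)
    (Filter.Eventually.of_forall fun x => by rw [Real.norm_eq_abs]; exact hf x)
  simpa using this

theorem intervalIntegrable_integral_kernel {X : Type*} [MeasurableSpace X] {κ : Kernel ℝ X}
    [IsMarkovKernel κ] {f : ℝ × X → ℝ} (hf : Measurable f) {C τ : ℝ} (hτ : 0 ≤ τ)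
    (hC : ∀ s ∈ Set.Icc 0 τ, ∀ x, |f (s, x)| ≤ C) :
    IntervalIntegrable (fun s => ∫ x, f (s, x) ∂κ s) volume 0 τ := by
  rw [intervalIntegrable_iff_integrableOn_Icc_of_le hτ]
  refine Measure.integrableOn_of_bounded (M := C) (by simp)
    (hf.stronglyMeasurable.integral_kernel_prod_right').aestronglyMeasurable ?_
  filter_upwards [ae_restrict_mem measurableSet_Icc] with s hs
  exact abs_integral_le_of_abs_le (hC s hs)

theorem integrable_of_abs_le {X : Type*} [MeasurableSpace X] {μ : Measure X}
    [IsFiniteMeasure μ] {f : X → ℝ} (hf : Measurable f) {C : ℝ} (hC : ∀ x, |f x| ≤ C) :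
    Integrable f μ :=
  Integrable.of_bound hf.aestronglyMeasurable C (Filter.Eventually.of_forall hC)

theorem abs_integral_sub_integral_le {X : Type*} [MeasurableSpace X] {μ : Measure X}
    [IsProbabilityMeasure μ] {f g : X → ℝ} (hf : Measurable f) (hg : Measurable g) {B B' C : ℝ}
    (hB : ∀ x, |f x| ≤ B) (hB' : ∀ x, |g x| ≤ B') (hC : ∀ x, |f x - g x| ≤ C) :
    |(∫ x, f x ∂μ) - ∫ x, g x ∂μ| ≤ C := by
  rw [← integral_sub (integrable_of_abs_le hf hB) (integrable_of_abs_le hg hB')]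
  exact abs_integral_le_of_abs_le hC

/-! ### The scattering operator on bounded functions -/

section Scattering

variable {d : ℕ} {p : Vel d → Vel d → ℝ}

/-- The average of `f (x, ·)` against the scattering density `p (·, v)`. -/
noncomputable def scatterAvg (p : Vel d → Vel d → ℝ) (f : Torus d × Vel d → ℝ)
    (z : Torus d × Vel d) : ℝ :=
  ∫ w, p w z.2 * f (z.1, w)

theorem IsScatteringKernel.integrable (hp : IsScatteringKernel p) (v : Vel d) :
    Integrable fun w => p w v :=
  not_imp_comm.1 integral_undef (by rw [hp.mass]; norm_num)

theorem IsScatteringKernel.integrable_mul (hp : IsScatteringKernel p) (v : Vel d) {f : Vel d → ℝ}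
    (hf : Measurable f) {C : ℝ} (hC : ∀ w, |f w| ≤ C) : Integrable fun w => p w v * f w :=
  (hp.integrable v).mul_bdd (c := C) hf.aestronglyMeasurable (Filter.Eventually.of_forall hC)

theorem IsScatteringKernel.abs_integral_mul_le (hp : IsScatteringKernel p) (v : Vel d)
    {f : Vel d → ℝ} {C : ℝ} (hC : ∀ w, |f w| ≤ C) : |∫ w, p w v * f w| ≤ C := by
  have h1 := norm_integral_le_of_norm_le ((hp.integrable v).mul_const C)
    (f := fun w => p w v * f w) (Filter.Eventually.of_forall fun w => by
      rw [norm_mul, Real.norm_of_nonneg (hp.nonneg _ _)]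
      exact mul_le_mul_of_nonneg_left (hC w) (hp.nonneg _ _))
  rwa [integral_mul_const, hp.mass, one_mul] at h1

theorem IsScatteringKernel.abs_scatterAvg_le (hp : IsScatteringKernel p)
    {f : Torus d × Vel d → ℝ} {C : ℝ} (hC : ∀ z, |f z| ≤ C) (z) : |scatterAvg p f z| ≤ C :=
  hp.abs_integral_mul_le _ fun _ => hC _

theorem IsScatteringKernel.abs_scatterAvg_sub_le (hp : IsScatteringKernel p)
    {f g : Torus d × Vel d → ℝ} (hf : Measurable f) (hg : Measurable g) {B B' C : ℝ}
    (hB : ∀ z, |f z| ≤ B) (hB' : ∀ z, |g z| ≤ B') (hC : ∀ z, |f z - g z| ≤ C) (z) :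
    |scatterAvg p f z - scatterAvg p g z| ≤ C := by
  unfold scatterAvg
  have h1 : Integrable fun w => p w z.2 * f (z.1, w) :=
    hp.integrable_mul _ (hf.comp measurable_prodMk_left) fun w => hB _
  have h2 : Integrable fun w => p w z.2 * g (z.1, w) :=
    hp.integrable_mul _ (hg.comp measurable_prodMk_left) fun w => hB' _
  rw [← integral_sub h1 h2]
  simp only [← mul_sub]
  exact hp.abs_integral_mul_le _ fun _ => hC _

theorem IsScatteringKernel.measurable_scatterAvg (hp : IsScatteringKernel p)
    {f : ℝ × Torus d × Vel d → ℝ} (hf : Measurable f) :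
    Measurable fun q : ℝ × Torus d × Vel d => scatterAvg p (fun z => f (q.1, z)) q.2 := by
  have h : Measurable fun r : (ℝ × Torus d × Vel d) × Vel d =>
      p r.2 r.1.2.2 * f (r.1.1, (r.1.2.1, r.2)) := by
    have h1 : Measurable fun r : (ℝ × Torus d × Vel d) × Vel d => p r.2 r.1.2.2 :=
      hp.measurable.comp (measurable_snd.prodMk measurable_fst.snd.snd)
    exact h1.mul (hf.comp (by fun_prop))
  exact (h.stronglyMeasurable.integral_prod_right (ν := volume)
    (f := fun (q : ℝ × Torus d × Vel d) (w : Vel d) => p w q.2.2 * f (q.1, (q.2.1, w)))).measurable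

end Scattering

/-! ### Continuity of test functions and of their transport derivatives -/

section TestFunctions

variable {d : ℕ} {W : Torus d → ℝ}

theorem isOpenQuotientMap_id_projPhase :
    IsOpenQuotientMap (Prod.map id (projPhase (d := d)) : ℝ × Vel d × Vel d → _) :=
  IsOpenQuotientMap.id.prodMap isOpenQuotientMap_projPhase

theorem IsTestFunction.continuous {τ : ℝ} {φ : ℝ → Torus d → Vel d → ℝ}
    (hφ : IsTestFunction τ φ) :
    Continuous fun q : ℝ × Torus d × Vel d => φ q.1 q.2.1 q.2.2 := by
  rw [isOpenQuotientMap_id_projPhase.isQuotientMap.continuous_iff]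
  exact hφ.contDiff.continuous

theorem continuous_liftField (hW : TorusC2 W) : Continuous (liftField W) := by
  obtain ⟨K, hK⟩ := exists_lipschitzWith_liftField hW
  exact hK.continuous

theorem IsTestFunction.continuous_transportOp (hW : TorusC2 W) {τ : ℝ}
    {φ : ℝ → Torus d → Vel d → ℝ} (hφ : IsTestFunction τ φ) :
    Continuous fun q : ℝ × Torus d × Vel d => transportOp W φ q.1 q.2.1 q.2.2 := by
  have hφ1 : ContDiff ℝ 1 (liftFun φ) := hφ.contDiff
  rw [isOpenQuotientMap_id_projPhase.isQuotientMap.continuous_iff]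
  have h : (fun q : ℝ × Torus d × Vel d => transportOp W φ q.1 q.2.1 q.2.2) ∘ Prod.map id projPhase
      = fun e : ℝ × Vel d × Vel d => fderiv ℝ (liftFun φ) e (1, liftField W e.2) := by
    funext e
    exact transportOp_proj (hφ1.differentiable one_ne_zero _)
  rw [h]
  exact (hφ1.continuous_fderiv one_ne_zero).clm_apply
    (continuous_const.prodMk ((continuous_liftField hW).comp continuous_snd))

end TestFunctions

/-! ### Measure solutions tested against functions pulled back by the flow -/

section Solutions

variable {d : ℕ} {W : Torus d → ℝ} {σ : C(Torus d, ℝ)} {p : Vel d → Vel d → ℝ}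
  {μ₀ : ProbabilityMeasure (Torus d × Vel d)} {μ : ℝ → ProbabilityMeasure (Torus d × Vel d)}

/-- Freezing the curve at negative times makes it continuous on the whole line, so that it defines a
kernel. -/
theorem IsMeasureSolution.continuous (hμ : IsMeasureSolution W σ p μ₀ μ) :
    Continuous fun s => μ (max s 0) := by
  rw [continuous_iff_continuousAt]
  intro s
  have h1 : ContinuousOn (fun s => μ (max s 0)) (Set.Iic (max s 0 + 1)) := by
    refine (hμ (max s 0 + 1) (by positivity)).1.comp (by fun_prop) fun r hr => ?_
    exact ⟨le_max_right _ _, max_le hr (by positivity)⟩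
  exact h1.continuousAt (Iic_mem_nhds (by linarith [le_max_left s 0]))

theorem abs_sigma_le (σ : C(Torus d, ℝ)) (x : Torus d) : |σ x| ≤ ‖σ‖ := σ.norm_coe_le_norm x

/-- The equation tested against `θ(s) ψ(Φ_{t-s})`: transport annihilates the second factor, so that
only `θ'` and the collision term remain. The function is not an admissible test function, and the
identity is the limit of those for its approximations. -/
theorem IsMeasureSolution.integral_pullback (hW : TorusC2 W) (hp : IsScatteringKernel p)
    (hμ : IsMeasureSolution W σ p μ₀ μ) {ψ : Torus d × Vel d → ℝ} {L : NNReal}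
    (hψ : LipschitzWith L ψ) {A : ℝ} (hA : ∀ z : Torus d × Vel d, A ≤ ‖z.2‖ → ψ z = 0) {B : ℝ}
    (hB : ∀ z, |ψ z| ≤ B) (t : ℝ)
    {θ : ℝ → ℝ} (hθ : ContDiff ℝ 1 θ) (hθc : HasCompactSupport θ) {τ : ℝ} (hτ0 : 0 < τ)
    (hτ : ∀ s ∈ tsupport θ, s < τ) :
    ∫ s in (0 : ℝ)..τ, (deriv θ s * ∫ z, ψ (flow hW (t - s) z) ∂(μ (max s 0) : Measure _)
      + θ s * ∫ z, σ z.1 * (scatterAvg p (fun z => ψ (flow hW (t - s) z)) z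
        - ψ (flow hW (t - s) z)) ∂(μ (max s 0) : Measure _))
      = -(θ 0 * ∫ z, ψ (flow hW t z) ∂(μ₀ : Measure (Torus d × Vel d))) := by
  obtain ⟨C, hC0, hC⟩ := exists_isTestFunction_approx hW hψ hA t hθ hθc hτ
  have hB0 : 0 ≤ B := (abs_nonneg _).trans (hB (0, 0))
  obtain ⟨B₀, hB₀⟩ := hθc.exists_bound_of_continuous hθ.continuous
  have hθ' : Continuous (deriv θ) := hθ.continuous_deriv le_rfl
  obtain ⟨B₁, hB₁⟩ := hθc.deriv.exists_bound_of_continuous hθ'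
  have hB₀0 : 0 ≤ B₀ := (norm_nonneg _).trans (hB₀ 0)
  have hB₁0 : 0 ≤ B₁ := (norm_nonneg _).trans (hB₁ 0)
  set κ : Kernel ℝ (Torus d × Vel d) := curveKernel hμ.continuous with hκ
  have hσ0 : 0 ≤ ‖σ‖ := norm_nonneg σ
  -- the pulled back function
  set G : ℝ × Torus d × Vel d → ℝ := fun q => ψ (flow hW (t - q.1) q.2) with hG
  have hGc : Continuous G := by
    have h1 : Continuous fun q : ℝ × Torus d × Vel d => ((t - q.1, q.2) : ℝ × Torus d × Vel d) := by
      fun_prop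
    exact hψ.continuous.comp ((continuous_flow hW).comp h1)
  have hGm : ∀ s, Measurable fun z => G (s, z) := fun s => hGc.measurable.comp measurable_prodMk_left
  have hGB : ∀ q, |G q| ≤ B := fun q => hB _
  have hσm : Measurable fun q : ℝ × Torus d × Vel d => σ q.2.1 :=
    (σ.continuous.comp (by fun_prop)).measurable
  set S : ℝ × Torus d × Vel d → ℝ := fun q =>
    σ q.2.1 * (scatterAvg p (fun z => G (q.1, z)) q.2 - G q) with hS
  have hSm : Measurable S := hσm.mul ((hp.measurable_scatterAvg hGc.measurable).sub hGc.measurable)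
  have hSB : ∀ q, |S q| ≤ ‖σ‖ * (2 * B) := fun q => by
    simp only [hS, abs_mul]
    refine mul_le_mul (abs_sigma_le σ _) ?_ (abs_nonneg _) hσ0
    refine (abs_sub _ _).trans ?_
    linarith [hp.abs_scatterAvg_le (f := fun z => G (q.1, z)) (fun z => hGB (q.1, z)) q.2, hGB q]
  set F : ℝ × Torus d × Vel d → ℝ := fun q => deriv θ q.1 * G q + θ q.1 * S q with hF
  have hFm : Measurable F :=
    ((hθ'.measurable.comp measurable_fst).mul hGc.measurable).add
      ((hθ.continuous.measurable.comp measurable_fst).mul hSm)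
  have hFB : ∀ q, |F q| ≤ B₁ * B + B₀ * (‖σ‖ * (2 * B)) := fun q => by
    refine (abs_add_le _ _).trans ?_
    rw [abs_mul, abs_mul]
    have := hB₁ q.1; have := hB₀ q.1
    rw [Real.norm_eq_abs] at *
    gcongr
    · exact hGB q
    · exact hSB q
  have hFint : ∀ s, ∫ z, F (s, z) ∂κ s
      = deriv θ s * ∫ z, G (s, z) ∂κ s + θ s * ∫ z, S (s, z) ∂κ s := fun s => by
    have h1 : Integrable (fun z => G (s, z)) (κ s) := integrable_of_abs_le (hGm s) fun z => hGB _
    have h2 : Integrable (fun z => S (s, z)) (κ s) :=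
      integrable_of_abs_le (hSm.comp measurable_prodMk_left) fun z => hSB _
    rw [← integral_const_mul, ← integral_const_mul, ← integral_add (h1.const_mul _) (h2.const_mul _)]
  have hgoal : ∫ s in (0 : ℝ)..τ, ∫ z, F (s, z) ∂κ s
      = -(θ 0 * ∫ z, G (0, z) ∂(μ₀ : Measure (Torus d × Vel d))) := by
    -- The error of the backward operator accumulated over `[0, τ]`, plus the error in the initial
    -- term.
    set D : ℝ := (C + ‖σ‖ * (2 * C)) * τ + C with hD
    have hest : ∀ ε, 0 < ε → ε ≤ 1 → |(∫ s in (0 : ℝ)..τ, ∫ z, F (s, z) ∂κ s)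
        - -(θ 0 * ∫ z, G (0, z) ∂(μ₀ : Measure (Torus d × Vel d)))| ≤ D * ε := by
      intro ε hε hε1
      obtain ⟨φ, hφ, hφe⟩ := hC ε hε hε1
      have hsol := (hμ τ hτ0).2 φ hφ
      set E : ℝ × Torus d × Vel d → ℝ := fun q => backwardOp W σ p φ q.1 q.2.1 q.2.2 with hE
      have hφc := hφ.continuous
      set f : ℝ × Torus d × Vel d → ℝ := fun q => φ q.1 q.2.1 q.2.2 with hf
      have hEeq : ∀ q, E q = transportOp W φ q.1 q.2.1 q.2.2
          + σ q.2.1 * (scatterAvg p (fun z => f (q.1, z)) q.2 - f q) := fun q => rfl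
      have hEm : Measurable E :=
        (hφ.continuous_transportOp hW).measurable.add
          (hσm.mul ((hp.measurable_scatterAvg hφc.measurable).sub hφc.measurable))
      have hfG : ∀ q, |f q - θ q.1 * G q| ≤ C * ε := fun q => (hφe q.1 q.2.1 q.2.2).1
      have hCε : 0 ≤ C * ε := by positivity
      have hθG : ∀ q, |θ q.1 * G q| ≤ B₀ * B := fun q => by
        rw [abs_mul]
        exact mul_le_mul (hB₀ _) (hGB q) (abs_nonneg _) hB₀0
      have hfB : ∀ q, |f q| ≤ C * ε + B₀ * B := fun q => by
        have h1 := abs_add_le (f q - θ q.1 * G q) (θ q.1 * G q)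
        rw [sub_add_cancel] at h1
        linarith [hfG q, hθG q]
      have hsc : ∀ q : ℝ × Torus d × Vel d,
          scatterAvg p (fun z => θ q.1 * G (q.1, z)) q.2
            = θ q.1 * scatterAvg p (fun z => G (q.1, z)) q.2 := fun q => by
        unfold scatterAvg
        rw [← integral_const_mul]
        exact integral_congr_ae (Filter.Eventually.of_forall fun w => by simp only; ring)
      have hEF : ∀ q, |E q - F q| ≤ (C + ‖σ‖ * (2 * C)) * ε := fun q => by
        have h1 := (hφe q.1 q.2.1 q.2.2).2
        have h2 := hp.abs_scatterAvg_sub_le (f := fun z => f (q.1, z))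
          (g := fun z => θ q.1 * G (q.1, z)) (hφc.measurable.comp measurable_prodMk_left)
          ((hGm q.1).const_mul _) (fun z => hfB (q.1, z)) (fun z => hθG (q.1, z))
          (fun z => hfG (q.1, z)) q.2
        rw [hsc] at h2
        have h3 : E q - F q = (transportOp W φ q.1 q.2.1 q.2.2 - deriv θ q.1 * G q)
            + σ q.2.1 * ((scatterAvg p (fun z => f (q.1, z)) q.2
              - θ q.1 * scatterAvg p (fun z => G (q.1, z)) q.2) - (f q - θ q.1 * G q)) := by
          rw [hEeq]; simp only [hF, hS]; ring
        rw [h3]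
        refine (abs_add_le _ _).trans ?_
        rw [abs_mul]
        have h4 : |σ q.2.1| * |(scatterAvg p (fun z => f (q.1, z)) q.2
            - θ q.1 * scatterAvg p (fun z => G (q.1, z)) q.2) - (f q - θ q.1 * G q)|
            ≤ ‖σ‖ * (C * ε + C * ε) := by
          refine mul_le_mul (abs_sigma_le σ _) ?_ (abs_nonneg _) hσ0
          exact (abs_sub _ _).trans (add_le_add h2 (hfG q))
        have h5 : |transportOp W φ q.1 q.2.1 q.2.2 - deriv θ q.1 * G q| ≤ C * ε := h1
        calc _ ≤ C * ε + ‖σ‖ * (C * ε + C * ε) := add_le_add h5 h4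
          _ = _ := by ring
      have hEB : ∀ q, |E q| ≤ (C + ‖σ‖ * (2 * C)) * ε + (B₁ * B + B₀ * (‖σ‖ * (2 * B))) :=
        fun q => by
          have h1 := abs_add_le (E q - F q) (F q)
          rw [sub_add_cancel] at h1
          linarith [hEF q, hFB q]
      have hi1 := intervalIntegrable_integral_kernel (κ := κ) hEm hτ0.le fun s _ z => hEB (s, z)
      have hi2 := intervalIntegrable_integral_kernel (κ := κ) hFm hτ0.le fun s _ z => hFB (s, z)
      have hsol' : ∫ s in (0 : ℝ)..τ, ∫ z, E (s, z) ∂κ s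
          = -∫ z, f (0, z) ∂(μ₀ : Measure (Torus d × Vel d)) := by
        rw [← hsol]
        refine intervalIntegral.integral_congr fun s hs => ?_
        rw [Set.uIcc_of_le hτ0.le] at hs
        simp only [hκ, curveKernel_apply, max_eq_left hs.1, hE]
      have h1 : |(∫ s in (0 : ℝ)..τ, ∫ z, E (s, z) ∂κ s) - ∫ s in (0 : ℝ)..τ, ∫ z, F (s, z) ∂κ s|
          ≤ (C + ‖σ‖ * (2 * C)) * ε * τ := by
        rw [← intervalIntegral.integral_sub hi1 hi2]
        have := intervalIntegral.norm_integral_le_of_norm_le_const (a := (0 : ℝ)) (b := τ)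
          (C := (C + ‖σ‖ * (2 * C)) * ε)
          (f := fun s => (∫ z, E (s, z) ∂κ s) - ∫ z, F (s, z) ∂κ s) fun s _ => by
            exact abs_integral_sub_integral_le (hEm.comp measurable_prodMk_left)
              (hFm.comp measurable_prodMk_left) (fun z => hEB (s, z)) (fun z => hFB (s, z))
              fun z => hEF (s, z)
        rwa [sub_zero, abs_of_pos hτ0] at this
      have h2 : |(∫ z, f (0, z) ∂(μ₀ : Measure (Torus d × Vel d)))
          - θ 0 * ∫ z, G (0, z) ∂(μ₀ : Measure (Torus d × Vel d))| ≤ C * ε := by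
        rw [← integral_const_mul]
        exact abs_integral_sub_integral_le (hφc.measurable.comp measurable_prodMk_left)
          ((hGm 0).const_mul _) (fun z => hfB (0, z)) (fun z => hθG (0, z)) fun z => hfG (0, z)
      rw [hsol'] at h1
      rw [abs_le] at h1 h2 ⊢
      rw [hD]
      constructor <;> nlinarith [h1.1, h1.2, h2.1, h2.2]
    have hD0 : 0 ≤ D := by positivity
    have : |(∫ s in (0 : ℝ)..τ, ∫ z, F (s, z) ∂κ s)
        - -(θ 0 * ∫ z, G (0, z) ∂(μ₀ : Measure (Torus d × Vel d)))| ≤ 0 := by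
      refine le_of_forall_pos_le_add fun δ hδ => ?_
      refine (hest (min 1 (δ / (D + 1))) (by positivity) (min_le_left _ _)).trans ?_
      calc D * min 1 (δ / (D + 1)) ≤ D * (δ / (D + 1)) := by gcongr; exact min_le_right _ _
        _ ≤ (D + 1) * (δ / (D + 1)) := by gcongr; linarith
        _ = 0 + δ := by field_simp; ring
    exact sub_eq_zero.1 (abs_nonpos_iff.1 this)
  simp only [hFint] at hgoal
  simpa only [hG, hS, hκ, curveKernel_apply, sub_zero] using hgoal

end Solutions

end LinearBoltzmann

namespace LinearBoltzmann

open ProbabilityTheory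
open scoped ENNReal

/-! ### The jump kernel -/

section JumpKernel

variable {d : ℕ} {σ : C(Torus d, ℝ)} {p : Vel d → Vel d → ℝ}

/-- The scattering kernel: the position is kept, the velocity is redrawn with density
`p (·, v)`. -/
noncomputable def scatterKernel (p : Vel d → Vel d → ℝ) : Kernel (Torus d × Vel d) (Torus d × Vel d) :=
  (Kernel.deterministic Prod.fst measurable_fst) ×ₖ
    ((Kernel.const (Torus d × Vel d) (volume : Measure (Vel d))).withDensity
      fun z w => ((p w z.2).toNNReal : ℝ≥0∞))

instance : IsSFiniteKernel (scatterKernel p) := by unfold scatterKernel; infer_instance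

theorem IsScatteringKernel.measurable_density (hp : IsScatteringKernel p) :
    Measurable fun q : (Torus d × Vel d) × Vel d => ((p q.2 q.1.2).toNNReal : ℝ≥0∞) :=
  ((hp.measurable.comp (measurable_snd.prodMk measurable_fst.snd)).real_toNNReal).coe_nnreal_ennreal

theorem IsScatteringKernel.lintegral_scatterKernel (hp : IsScatteringKernel p)
    (z : Torus d × Vel d) {g : Torus d × Vel d → ℝ≥0∞} (hg : Measurable g) :
    ∫⁻ z', g z' ∂scatterKernel p z = ∫⁻ w, ENNReal.ofReal (p w z.2) * g (z.1, w) := by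
  unfold scatterKernel
  rw [Kernel.lintegral_prod _ _ _ hg, Kernel.lintegral_deterministic' measurable_fst,
    Kernel.lintegral_withDensity (g := fun w => g (z.1, w)) _ hp.measurable_density _
      (hg.comp measurable_prodMk_left)]
  · rfl
  · exact hg.lintegral_prod_right'

/-- The kernel of jumps at total rate `c`: scattering at rate `σ x`, and a fictitious jump, which
leaves the state unchanged, at rate `c - σ x`. -/
noncomputable def jumpKernel (σ : C(Torus d, ℝ)) (p : Vel d → Vel d → ℝ) (c : ℝ) :
    Kernel (Torus d × Vel d) (Torus d × Vel d) :=
  (scatterKernel p).withDensity (fun z _ => ((σ z.1).toNNReal : ℝ≥0∞))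
    + Kernel.id.withDensity (fun z _ => ((c - σ z.1).toNNReal : ℝ≥0∞))

instance (c : ℝ) : IsSFiniteKernel (jumpKernel σ p c) := by unfold jumpKernel; infer_instance

theorem measurable_sigma_fst (σ : C(Torus d, ℝ)) : Measurable fun z : Torus d × Vel d => σ z.1 :=
  (σ.continuous.comp continuous_fst).measurable

theorem IsScatteringKernel.lintegral_jumpKernel (hp : IsScatteringKernel p) (c : ℝ)
    (z : Torus d × Vel d) {g : Torus d × Vel d → ℝ≥0∞} (hg : Measurable g) :
    ∫⁻ z', g z' ∂jumpKernel σ p c z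
      = ENNReal.ofReal (σ z.1) * (∫⁻ w, ENNReal.ofReal (p w z.2) * g (z.1, w))
        + ENNReal.ofReal (c - σ z.1) * g z := by
  have h1 : Measurable fun q : (Torus d × Vel d) × Torus d × Vel d =>
      ((σ q.1.1).toNNReal : ℝ≥0∞) :=
    (((measurable_sigma_fst σ).comp measurable_fst).real_toNNReal).coe_nnreal_ennreal
  have h2 : Measurable fun q : (Torus d × Vel d) × Torus d × Vel d =>
      ((c - σ q.1.1).toNNReal : ℝ≥0∞) :=
    ((((measurable_sigma_fst σ).const_sub c).comp measurable_fst).real_toNNReal).coe_nnreal_ennreal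
  unfold jumpKernel
  rw [FunLike.coe_add, Pi.add_apply, lintegral_add_measure, Kernel.lintegral_withDensity _ h1 _ hg,
    Kernel.lintegral_withDensity _ h2 _ hg, lintegral_const_mul _ hg, lintegral_const_mul _ hg,
    Kernel.lintegral_id' hg, hp.lintegral_scatterKernel z hg]
  rfl

theorem IsScatteringKernel.lintegral_density (hp : IsScatteringKernel p) (v : Vel d) :
    ∫⁻ w, ENNReal.ofReal (p w v) = 1 := by
  rw [← ofReal_integral_eq_lintegral_ofReal (hp.integrable v)
    (Filter.Eventually.of_forall fun w => hp.nonneg w v), hp.mass, ENNReal.ofReal_one]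

/-- The fictitious jumps are there for this: the total rate no longer depends on the state, so the
backward evolution of the constant `1` is explicit. -/
theorem IsScatteringKernel.jumpKernel_univ (hp : IsScatteringKernel p) (hσ : ∀ x, 0 ≤ σ x) {c : ℝ}
    (hc : ∀ x, σ x ≤ c) (z : Torus d × Vel d) :
    jumpKernel σ p c z Set.univ = ENNReal.ofReal c := by
  rw [← lintegral_one, hp.lintegral_jumpKernel c z measurable_const]
  simp only [mul_one]
  rw [hp.lintegral_density, mul_one, ← ENNReal.ofReal_add (hσ _) (sub_nonneg.2 (hc _)),
    add_sub_cancel]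

theorem IsScatteringKernel.lintegral_jumpKernel_ofReal (hp : IsScatteringKernel p)
    (hσ : ∀ x, 0 ≤ σ x) {c : ℝ} (hc : ∀ x, σ x ≤ c) (z : Torus d × Vel d)
    {f : Torus d × Vel d → ℝ} (hf : Measurable f) (hf0 : ∀ z, 0 ≤ f z) {B : ℝ}
    (hB : ∀ z, f z ≤ B) :
    ∫⁻ z', ENNReal.ofReal (f z') ∂jumpKernel σ p c z
      = ENNReal.ofReal (σ z.1 * scatterAvg p f z + (c - σ z.1) * f z) := by
  have hi : Integrable fun w => p w z.2 * f (z.1, w) :=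
    hp.integrable_mul _ (hf.comp measurable_prodMk_left) fun w => (abs_of_nonneg (hf0 _)).trans_le (hB _)
  have h0 : ∀ w, 0 ≤ p w z.2 * f (z.1, w) := fun w => mul_nonneg (hp.nonneg _ _) (hf0 _)
  have h0' : 0 ≤ scatterAvg p f z := integral_nonneg h0
  rw [hp.lintegral_jumpKernel c z hf.ennreal_ofReal, ENNReal.ofReal_add
    (mul_nonneg (hσ _) h0') (mul_nonneg (sub_nonneg.2 (hc _)) (hf0 _)), ENNReal.ofReal_mul (hσ _),
    ENNReal.ofReal_mul (sub_nonneg.2 (hc _)), scatterAvg,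
    ofReal_integral_eq_lintegral_ofReal hi (Filter.Eventually.of_forall h0)]
  simp only [ENNReal.ofReal_mul (hp.nonneg _ _)]

end JumpKernel

/-! ### Lipschitz approximation of open sets -/

/-- A multiple of the distance to the complement, truncated at `1` and at `n - ‖v‖`: the slope and
the velocity cutoff are relaxed together, so that the sequence increases. -/
theorem exists_lipschitz_tendsto_indicator {X E : Type*} [PseudoMetricSpace X]
    [SeminormedAddCommGroup E] {U : Set (X × E)} (hU : IsOpen U) :
    ∃ ψ : ℕ → X × E → ℝ, (∀ n, ∃ L, LipschitzWith L (ψ n)) ∧ (∀ n z, 0 ≤ ψ n z) ∧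
      (∀ n z, ψ n z ≤ 1) ∧ (∀ (n : ℕ) (z : X × E), (n : ℝ) ≤ ‖z.2‖ → ψ n z = 0) ∧
      (∀ z, Monotone fun n => ψ n z) ∧
      ∀ z, Filter.Tendsto (fun n => ψ n z) Filter.atTop (nhds (U.indicator 1 z)) := by
  obtain ⟨u, hu, hu0, huU, huU'⟩ : ∃ u : X × E → ℝ, LipschitzWith 1 u ∧ (∀ z, 0 ≤ u z) ∧
      (∀ z ∈ U, 0 < u z) ∧ ∀ z ∉ U, u z = 0 := by
    -- The distance to the empty set is `0` by convention, so the full space needs the constant `1`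
    -- instead.
    rcases Set.eq_empty_or_nonempty Uᶜ with h | h
    · refine ⟨fun _ => 1, (LipschitzWith.const 1).weaken zero_le_one, fun _ => zero_le_one,
        fun _ _ => zero_lt_one, fun z hz => ?_⟩
      exact absurd (show z ∈ Uᶜ from hz) (by simp [h])
    · refine ⟨fun z => Metric.infDist z Uᶜ, Metric.lipschitz_infDist_pt _,
        fun z => Metric.infDist_nonneg, fun z hz => ?_, fun z hz => ?_⟩
      · exact (hU.isClosed_compl.notMem_iff_infDist_pos h).1 (by simpa using hz)
      · exact Metric.infDist_zero_of_mem hz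
  have hnorm : LipschitzWith 1 fun z : X × E => ‖z.2‖ := by
    have := lipschitzWith_one_norm.comp (LipschitzWith.prod_snd (α := X) (β := E))
    rwa [one_mul] at this
  refine ⟨fun n z => max (min (min (n * u z) 1) (n - ‖z.2‖)) 0, fun n => ?_, fun n z => ?_,
    fun n z => ?_, fun n z hz => ?_, fun z m n hmn => ?_, fun z => ?_⟩
  · have h1 : LipschitzWith (n : NNReal) fun z => (n : ℝ) * u z := by
      refine LipschitzWith.of_dist_le_mul fun z z' => ?_
      rw [Real.dist_eq, ← mul_sub, abs_mul, Nat.abs_cast, ← Real.dist_eq]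
      have := hu.dist_le_mul z z'
      rw [NNReal.coe_one, one_mul] at this
      exact mul_le_mul_of_nonneg_left this (Nat.cast_nonneg n)
    have h2 : LipschitzWith 1 fun z : X × E => (n : ℝ) - ‖z.2‖ := by
      refine LipschitzWith.of_dist_le_mul fun z z' => ?_
      have := hnorm.dist_le_mul z z'
      rwa [dist_sub_left]
    exact ⟨_, ((h1.min_const 1).min h2).max_const 0⟩
  · exact le_max_right _ _
  · exact max_le ((min_le_left _ _).trans (min_le_right _ _)) zero_le_one
  · exact max_eq_right ((min_le_right _ _).trans (sub_nonpos.2 hz))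
  · have : (m : ℝ) ≤ n := by exact_mod_cast hmn
    have := hu0 z
    simp only
    gcongr
  · by_cases hz : z ∈ U
    · rw [Set.indicator_of_mem hz, Pi.one_apply]
      refine tendsto_const_nhds.congr' ?_
      obtain ⟨N, hN⟩ := exists_nat_ge (max (1 / u z) (‖z.2‖ + 1))
      filter_upwards [Filter.eventually_ge_atTop N] with n hn
      have hn' : (N : ℝ) ≤ n := by exact_mod_cast hn
      have h1 : 1 ≤ n * u z := by
        have := (le_max_left _ _).trans (hN.trans hn')
        rwa [div_le_iff₀ (huU z hz)] at this
      have h2 : 1 ≤ (n : ℝ) - ‖z.2‖ := by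
        have := (le_max_right _ _).trans (hN.trans hn'); linarith
      rw [min_eq_right h1, min_eq_left h2, max_eq_left zero_le_one]
    · rw [Set.indicator_of_notMem hz]
      refine tendsto_const_nhds.congr fun n => ?_
      simp only [huU' z hz, mul_zero, min_eq_left zero_le_one]
      exact (max_eq_right (min_le_left _ _)).symm

/-- Monotone convergence identifies the masses of open sets, which form a generating π-system. It
reduces equality of measures to the functions for which the weak equation can be used. -/
theorem measure_eq_of_lintegral_lipschitz {X E : Type*} [PseudoMetricSpace X]
    [SeminormedAddCommGroup E] [MeasurableSpace X] [MeasurableSpace E] [BorelSpace (X × E)]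
    {m m' : Measure (X × E)} [IsFiniteMeasure m]
    (h : ∀ (ψ : X × E → ℝ) (L : NNReal) (A : ℝ), LipschitzWith L ψ → (∀ z, 0 ≤ ψ z) →
      (∀ z, ψ z ≤ 1) → (∀ z, A ≤ ‖z.2‖ → ψ z = 0) →
      ∫⁻ z, ENNReal.ofReal (ψ z) ∂m = ∫⁻ z, ENNReal.ofReal (ψ z) ∂m') : m = m' := by
  have key : ∀ U : Set (X × E), IsOpen U → m U = m' U := by
    intro U hU
    obtain ⟨ψ, hL, h0, h1, hA, hmono, hlim⟩ := exists_lipschitz_tendsto_indicator hU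
    have hm : ∀ n, Measurable fun z => ENNReal.ofReal (ψ n z) := fun n => by
      obtain ⟨L, hL⟩ := hL n
      exact hL.continuous.measurable.ennreal_ofReal
    have hlim' : ∀ z, Filter.Tendsto (fun n => ENNReal.ofReal (ψ n z)) Filter.atTop
        (nhds (U.indicator 1 z)) := fun z => by
      convert ENNReal.tendsto_ofReal (hlim z) using 2
      by_cases hz : z ∈ U <;> simp [hz]
    have hgen : ∀ μ : Measure (X × E), Filter.Tendsto
        (fun n => ∫⁻ z, ENNReal.ofReal (ψ n z) ∂μ) Filter.atTop (nhds (μ U)) := fun μ => by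
      rw [← lintegral_indicator_one hU.measurableSet]
      exact lintegral_tendsto_of_tendsto_of_monotone (fun n => (hm n).aemeasurable)
        (Filter.Eventually.of_forall fun z a b hab => ENNReal.ofReal_le_ofReal (hmono z hab))
        (Filter.Eventually.of_forall hlim')
    refine tendsto_nhds_unique (hgen m) ((hgen m').congr fun n => ?_)
    obtain ⟨L, hL⟩ := hL n
    exact (h (ψ n) L n hL (h0 n) (h1 n) (hA n)).symm
  exact ext_of_generate_finite {s | IsOpen s} BorelSpace.measurable_eq isPiSystem_isOpen
    (fun U hU => key U hU) (key _ isOpen_univ)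

end LinearBoltzmann

namespace LinearBoltzmann

open ProbabilityTheory
open scoped ENNReal

/-! ### Duhamel's formula for measure solutions. -/

section MildSolutions

variable {d : ℕ} {W : Torus d → ℝ} {σ : C(Torus d, ℝ)} {p : Vel d → Vel d → ℝ}
  {μ₀ : ProbabilityMeasure (Torus d × Vel d)} {μ : ℝ → ProbabilityMeasure (Torus d × Vel d)}

theorem exists_abs_comp_flow_sub_le (hW : TorusC2 W) {ψ : Torus d × Vel d → ℝ} {L : NNReal}
    (hψ : LipschitzWith L ψ) {A : ℝ} (hA : ∀ z : Torus d × Vel d, A ≤ ‖z.2‖ → ψ z = 0) :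
    ∃ C, 0 ≤ C ∧ ∀ r s, |r - s| ≤ 1 → ∀ z,
      |ψ (flow hW r z) - ψ (flow hW s z)| ≤ C * |r - s| := by
  obtain ⟨C, hC0, hC⟩ := exists_abs_comp_liftFlow_sub_le hW hψ hA 1
  refine ⟨C, hC0, fun r s hrs z => ?_⟩
  obtain ⟨y, hy⟩ := projPhase_surjective (flow hW s z)
  have := hC (r - s) hrs y
  rwa [← flow_projPhase hW, hy, ← flow_add, sub_add_cancel] at this

/-- Both the integrand and the measure move with `s`: the integrand converges uniformly, and weak
continuity handles the fixed limit integrand. -/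
theorem IsMeasureSolution.continuous_integral_pullback (hW : TorusC2 W)
    (hμ : IsMeasureSolution W σ p μ₀ μ) {ψ : Torus d × Vel d → ℝ} {L : NNReal}
    (hψ : LipschitzWith L ψ) {A : ℝ} (hA : ∀ z : Torus d × Vel d, A ≤ ‖z.2‖ → ψ z = 0) {B : ℝ}
    (hB : ∀ z, |ψ z| ≤ B) (t : ℝ) :
    Continuous fun s => ∫ z, ψ (flow hW (t - s) z) ∂(μ (max s 0) : Measure _) := by
  obtain ⟨C, hC0, hC⟩ := exists_abs_comp_flow_sub_le hW hψ hA
  have hflow : ∀ s, Continuous fun z => ψ (flow hW (t - s) z) := fun s =>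
    hψ.continuous.comp ((continuous_flow hW).comp (continuous_const.prodMk continuous_id))
  rw [continuous_iff_continuousAt]
  intro s₀
  let f : BoundedContinuousFunction (Torus d × Vel d) ℝ :=
    BoundedContinuousFunction.ofNormedAddCommGroup _ (hflow s₀) B fun z => hB _
  have h1 : Filter.Tendsto (fun s => ∫ z, ψ (flow hW (t - s₀) z) ∂(μ (max s 0) : Measure _))
      (nhds s₀) (nhds (∫ z, ψ (flow hW (t - s₀) z) ∂(μ (max s₀ 0) : Measure _))) :=
    (ProbabilityMeasure.tendsto_iff_forall_integral_tendsto.1 (hμ.continuous.tendsto s₀)) f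
  have h2 : Filter.Tendsto (fun s => (∫ z, ψ (flow hW (t - s) z) ∂(μ (max s 0) : Measure _))
      - ∫ z, ψ (flow hW (t - s₀) z) ∂(μ (max s 0) : Measure _)) (nhds s₀) (nhds 0) := by
    have h3 : Filter.Tendsto (fun s => C * |s₀ - s|) (nhds s₀) (nhds 0) := by
      have : Continuous fun s => C * |s₀ - s| := by fun_prop
      simpa using this.tendsto s₀
    refine squeeze_zero_norm' ?_ h3
    filter_upwards [Metric.closedBall_mem_nhds s₀ one_pos] with s hs
    rw [Metric.mem_closedBall, dist_comm, Real.dist_eq] at hs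
    refine abs_integral_sub_integral_le (hflow s).measurable (hflow s₀).measurable
      (fun z => hB _) (fun z => hB _) fun z => ?_
    have h4 : t - s - (t - s₀) = s₀ - s := by ring
    have := hC (t - s) (t - s₀) (by rwa [h4]) z
    rwa [h4] at this
  have := h2.add h1
  simp only [sub_add_cancel, zero_add] at this
  exact this

/-- The tested equation is a scalar weak differential equation in `s`. The integrating factor turns
the loss `-σ ψ` into `(c - σ) ψ`, which for `c ≥ σ` and `ψ ≥ 0` is a gain. -/
theorem IsMeasureSolution.exp_mul_integral_eq (hW : TorusC2 W) (hp : IsScatteringKernel p)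
    (hμ : IsMeasureSolution W σ p μ₀ μ) {ψ : Torus d × Vel d → ℝ} {L : NNReal}
    (hψ : LipschitzWith L ψ) {A : ℝ} (hA : ∀ z : Torus d × Vel d, A ≤ ‖z.2‖ → ψ z = 0) {B : ℝ}
    (hB : ∀ z, |ψ z| ≤ B) (c : ℝ) {t : ℝ} (ht : 0 ≤ t) :
    Real.exp (c * t) * ∫ z, ψ z ∂(μ t : Measure _)
      = (∫ z, ψ (flow hW t z) ∂(μ₀ : Measure _))
        + ∫ s in (0 : ℝ)..t, Real.exp (c * s) *
          ∫ z, (σ z.1 * scatterAvg p (fun z => ψ (flow hW (t - s) z)) z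
            + (c - σ z.1) * ψ (flow hW (t - s) z)) ∂(μ (max s 0) : Measure _) := by
  set κ : Kernel ℝ (Torus d × Vel d) := curveKernel hμ.continuous with hκ
  set G : ℝ × Torus d × Vel d → ℝ := fun q => ψ (flow hW (t - q.1) q.2) with hG
  have hGc : Continuous G := by
    have h1 : Continuous fun q : ℝ × Torus d × Vel d => ((t - q.1, q.2) : ℝ × Torus d × Vel d) := by
      fun_prop
    exact hψ.continuous.comp ((continuous_flow hW).comp h1)
  have hGB : ∀ q, |G q| ≤ B := fun q => hB _
  have hσm : Measurable fun q : ℝ × Torus d × Vel d => σ q.2.1 :=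
    (σ.continuous.comp (by fun_prop)).measurable
  set S : ℝ × Torus d × Vel d → ℝ := fun q =>
    σ q.2.1 * (scatterAvg p (fun z => G (q.1, z)) q.2 - G q) with hS
  have hSm : Measurable S := hσm.mul ((hp.measurable_scatterAvg hGc.measurable).sub hGc.measurable)
  have hSB : ∀ q, |S q| ≤ ‖σ‖ * (2 * B) := fun q => by
    simp only [hS, abs_mul]
    refine mul_le_mul (abs_sigma_le σ _) ?_ (abs_nonneg _) (norm_nonneg σ)
    refine (abs_sub _ _).trans ?_
    linarith [hp.abs_scatterAvg_le (f := fun z => G (q.1, z)) (fun z => hGB (q.1, z)) q.2, hGB q]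
  -- The longer interval has positive length even when `t = 0`.
  have hode := eq_of_weak_ode (τ := t + 1) (c := c) (t := t)
    (m₀ := ∫ z, ψ (flow hW t z) ∂(μ₀ : Measure _))
    (a := fun s => ∫ z, G (s, z) ∂κ s) (k := fun s => ∫ z, S (s, z) ∂κ s) (by linarith)
    (hμ.continuous_integral_pullback hW hψ hA hB t).continuousOn
    (intervalIntegrable_integral_kernel hSm (by linarith) fun s _ z => hSB (s, z))
    (fun θ hθ hθc hτ => hμ.integral_pullback hW hp hψ hA hB t hθ hθc (by linarith) hτ)
    ⟨ht, by linarith⟩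
  simp only [hG, hκ, curveKernel_apply, max_eq_left ht, sub_self, flow_zero] at hode
  rw [hode]
  congr 1
  refine intervalIntegral.integral_congr fun s _ => ?_
  congr 1
  have h1 : Integrable (fun z => G (s, z)) (μ (max s 0) : Measure _) :=
    integrable_of_abs_le (hGc.measurable.comp measurable_prodMk_left) fun z => hGB _
  have h2 : Integrable (fun z => S (s, z)) (μ (max s 0) : Measure _) :=
    integrable_of_abs_le (hSm.comp measurable_prodMk_left) fun z => hSB _
  rw [← integral_const_mul, ← integral_add (h1.const_mul c) h2]
  refine integral_congr_ae (Filter.Eventually.of_forall fun z => ?_)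
  simp only [hG, hS]
  ring

/-- A family of measures that satisfies Duhamel's formula for the flow `Φ` and the jump
kernel `Q`. -/
def IsMild {Z : Type*} [MeasurableSpace Z] (Φ : ℝ → Z → Z) (Q : Kernel Z Z) (ρ : Kernel ℝ Z) :
    Prop :=
  ∀ t, 0 ≤ t → ∀ g : Z → ℝ≥0∞, Measurable g →
    ∫⁻ z, g z ∂ρ t = (∫⁻ z, g (Φ t z) ∂ρ 0)
      + ∫⁻ s in Set.Ioo 0 t, ∫⁻ z, ∫⁻ z', g (Φ (t - s) z') ∂Q z ∂ρ s

/-- The measures `e^{ct} κ t`. -/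
noncomputable def expKernel {Z : Type*} [MeasurableSpace Z] (c : ℝ) (κ : Kernel ℝ Z)
    [IsSFiniteKernel κ] : Kernel ℝ Z :=
  κ.withDensity fun s _ => ((Real.exp (c * s)).toNNReal : ℝ≥0∞)

instance {Z : Type*} [MeasurableSpace Z] (c : ℝ) (κ : Kernel ℝ Z) [IsSFiniteKernel κ] :
    IsSFiniteKernel (expKernel c κ) := by unfold expKernel; infer_instance

theorem lintegral_expKernel {Z : Type*} [MeasurableSpace Z] (c : ℝ) (κ : Kernel ℝ Z)
    [IsSFiniteKernel κ] (s : ℝ) {g : Z → ℝ≥0∞} (hg : Measurable g) :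
    ∫⁻ z, g z ∂expKernel c κ s = ENNReal.ofReal (Real.exp (c * s)) * ∫⁻ z, g z ∂κ s := by
  have h : Measurable fun q : ℝ × Z => ((Real.exp (c * q.1)).toNNReal : ℝ≥0∞) := by fun_prop
  rw [expKernel, Kernel.lintegral_withDensity _ h _ hg, lintegral_const_mul _ hg]
  rfl

theorem expKernel_apply {Z : Type*} [MeasurableSpace Z] (c : ℝ) (κ : Kernel ℝ Z)
    [IsSFiniteKernel κ] (s : ℝ) : expKernel c κ s = ENNReal.ofReal (Real.exp (c * s)) • κ s := by
  refine Measure.ext_of_lintegral _ fun g hg => ?_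
  rw [lintegral_expKernel c κ s hg, lintegral_smul_measure, smul_eq_mul]

/-- The measure on the right of Duhamel's formula. -/
noncomputable def duhamelMeasure {Z : Type*} [MeasurableSpace Z] (Φ : ℝ → Z → Z) (Q : Kernel Z Z)
    (ρ : Kernel ℝ Z) (m₀ : Measure Z) (t : ℝ) : Measure Z :=
  m₀.map (Φ t)
    + ((volume.restrict (Set.Ioo 0 t)) ⊗ₘ (Q ∘ₖ ρ)).map fun q => Φ (t - q.1) q.2

theorem lintegral_duhamelMeasure {Z : Type*} [MeasurableSpace Z] {Φ : ℝ → Z → Z}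
    (hΦ : Measurable fun q : ℝ × Z => Φ q.1 q.2) (Q : Kernel Z Z) [IsSFiniteKernel Q]
    (ρ : Kernel ℝ Z) [IsSFiniteKernel ρ] (m₀ : Measure Z) (t : ℝ) {g : Z → ℝ≥0∞}
    (hg : Measurable g) :
    ∫⁻ z, g z ∂duhamelMeasure Φ Q ρ m₀ t = (∫⁻ z, g (Φ t z) ∂m₀)
      + ∫⁻ s in Set.Ioo 0 t, ∫⁻ z, ∫⁻ z', g (Φ (t - s) z') ∂Q z ∂ρ s := by
  have h1 : Measurable fun q : ℝ × Z => Φ (t - q.1) q.2 :=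
    hΦ.comp ((measurable_fst.const_sub t).prodMk measurable_snd)
  have h2 : Measurable fun q : ℝ × Z => g (Φ (t - q.1) q.2) := hg.comp h1
  have h3 : Measurable (Φ t) := hΦ.comp measurable_prodMk_left
  rw [duhamelMeasure, lintegral_add_measure, lintegral_map hg h3,
    lintegral_map hg h1, Measure.lintegral_compProd h2]
  congr 1
  refine lintegral_congr fun s => ?_
  exact Kernel.lintegral_comp _ _ _ (h2.comp measurable_prodMk_left)

/-- Both sides agree on nonnegative Lipschitz functions of bounded velocity support, and these
determine a finite measure. Positivity of each term lets the real identity pass to Lebesgue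
integrals. -/
theorem IsMeasureSolution.exp_smul_eq_duhamelMeasure (hW : TorusC2 W) (hp : IsScatteringKernel p)
    (hσ : ∀ x, 0 ≤ σ x) (hμ : IsMeasureSolution W σ p μ₀ μ) {c : ℝ} (hc : ∀ x, σ x ≤ c) {t : ℝ}
    (ht : 0 ≤ t) :
    ENNReal.ofReal (Real.exp (c * t)) • (μ t : Measure _)
      = duhamelMeasure (flow hW) (jumpKernel σ p c) (expKernel c (curveKernel hμ.continuous))
        (μ₀ : Measure _) t := by
  have hΦ := (continuous_flow hW).measurable
  have : IsFiniteMeasure (ENNReal.ofReal (Real.exp (c * t)) • (μ t : Measure (Torus d × Vel d))) :=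
    ⟨by simp⟩
  refine measure_eq_of_lintegral_lipschitz fun ψ L A hψ h0 h1 hA => ?_
  have hB : ∀ z, |ψ z| ≤ 1 := fun z => (abs_of_nonneg (h0 z)).trans_le (h1 z)
  have hψm : Measurable ψ := hψ.continuous.measurable
  have hψi : ∀ m : ProbabilityMeasure (Torus d × Vel d), Integrable ψ (m : Measure _) :=
    fun m => integrable_of_abs_le hψm hB
  have hfm : ∀ s, Measurable fun z => ψ (flow hW s z) := fun s => hψm.comp (measurable_flow hW s)
  rw [lintegral_duhamelMeasure hΦ _ _ _ _ hψm.ennreal_ofReal, lintegral_smul_measure, smul_eq_mul]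
  set K : ℝ × Torus d × Vel d → ℝ := fun q =>
    σ q.2.1 * scatterAvg p (fun z => ψ (flow hW (t - q.1) z)) q.2
      + (c - σ q.2.1) * ψ (flow hW (t - q.1) q.2) with hK
  have hGm : Measurable fun q : ℝ × Torus d × Vel d => ψ (flow hW (t - q.1) q.2) :=
    hψm.comp (hΦ.comp ((measurable_fst.const_sub t).prodMk measurable_snd))
  have hσm : Measurable fun q : ℝ × Torus d × Vel d => σ q.2.1 :=
    (σ.continuous.comp (by fun_prop)).measurable
  have hKm : Measurable K :=
    (hσm.mul (hp.measurable_scatterAvg hGm)).add ((hσm.const_sub c).mul hGm)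
  have hA0 : ∀ s z, 0 ≤ scatterAvg p (fun z => ψ (flow hW (t - s) z)) z := fun s z =>
    integral_nonneg fun w => mul_nonneg (hp.nonneg _ _) (h0 _)
  have hK0 : ∀ q, 0 ≤ K q := fun q =>
    add_nonneg (mul_nonneg (hσ _) (hA0 _ _)) (mul_nonneg (sub_nonneg.2 (hc _)) (h0 _))
  have hKc : ∀ q, |K q| ≤ c := fun q => by
    rw [abs_of_nonneg (hK0 q)]
    have h2 := le_of_abs_le (hp.abs_scatterAvg_le (f := fun z => ψ (flow hW (t - q.1) z))
      (fun z => hB _) q.2)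
    calc K q ≤ σ q.2.1 * 1 + (c - σ q.2.1) * 1 :=
        add_le_add (mul_le_mul_of_nonneg_left h2 (hσ _))
          (mul_le_mul_of_nonneg_left (h1 _) (sub_nonneg.2 (hc _)))
      _ = c := by ring
  have hmain : Real.exp (c * t) * ∫ z, ψ z ∂(μ t : Measure _)
      = (∫ z, ψ (flow hW t z) ∂(μ₀ : Measure _)) + ∫ s in (0 : ℝ)..t, Real.exp (c * s) *
        ∫ z, K (s, z) ∂(curveKernel hμ.continuous s) :=
    hμ.exp_mul_integral_eq hW hp hψ hA hB c ht
  have hint : IntervalIntegrable (fun s => Real.exp (c * s) *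
      ∫ z, K (s, z) ∂(curveKernel hμ.continuous s)) volume 0 t :=
    (intervalIntegrable_integral_kernel hKm ht fun s _ z => hKc (s, z)).continuousOn_mul
      (by fun_prop)
  have hpos : ∀ s, 0 ≤ Real.exp (c * s) * ∫ z, K (s, z) ∂(curveKernel hμ.continuous s) :=
    fun s => mul_nonneg (Real.exp_pos _).le (integral_nonneg fun z => hK0 _)
  have hI : ENNReal.ofReal (∫ s in (0 : ℝ)..t, Real.exp (c * s) *
      ∫ z, K (s, z) ∂(curveKernel hμ.continuous s))
      = ∫⁻ s in Set.Ioo 0 t, ∫⁻ z, ∫⁻ z', ENNReal.ofReal (ψ (flow hW (t - s) z'))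
        ∂jumpKernel σ p c z ∂expKernel c (curveKernel hμ.continuous) s := by
    rw [intervalIntegral.integral_of_le ht, integral_Ioc_eq_integral_Ioo]
    rw [intervalIntegrable_iff_integrableOn_Ioo_of_le ht] at hint
    rw [ofReal_integral_eq_lintegral_ofReal hint (Filter.Eventually.of_forall hpos)]
    refine lintegral_congr fun s => ?_
    simp only [hp.lintegral_jumpKernel_ofReal hσ hc _ (hfm (t - s)) (fun z => h0 _) (fun z => h1 _)]
    have hKs : Measurable fun z => K (s, z) := hKm.comp measurable_prodMk_left
    rw [lintegral_expKernel _ _ _ hKs.ennreal_ofReal, ENNReal.ofReal_mul (Real.exp_pos _).le,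
      ofReal_integral_eq_lintegral_ofReal (integrable_of_abs_le hKs fun z => hKc _)
        (Filter.Eventually.of_forall fun z => hK0 _)]
  rw [← hI, ← ofReal_integral_eq_lintegral_ofReal (hψi _) (Filter.Eventually.of_forall h0),
    ← ENNReal.ofReal_mul (Real.exp_pos _).le, hmain,
    ← ofReal_integral_eq_lintegral_ofReal (integrable_of_abs_le (hfm t) fun z => hB _)
      (Filter.Eventually.of_forall fun z => h0 _), ENNReal.ofReal_add
      (integral_nonneg fun z => h0 _) (intervalIntegral.integral_nonneg ht fun s _ => hpos s)]

/-- The initial datum enters the weak formulation only through a boundary term; Duhamel's formula at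
time `0`, where the jump integral is empty, recovers it. -/
theorem IsMeasureSolution.initial_eq (hW : TorusC2 W) (hp : IsScatteringKernel p)
    (hσ : ∀ x, 0 ≤ σ x) (hμ : IsMeasureSolution W σ p μ₀ μ) :
    (μ 0 : Measure (Torus d × Vel d)) = μ₀ := by
  refine Measure.ext_of_lintegral _ fun g hg => ?_
  have h := hμ.exp_smul_eq_duhamelMeasure hW hp hσ
    (c := ‖σ‖) (fun x => le_of_abs_le (abs_sigma_le σ x)) le_rfl
  rw [mul_zero, Real.exp_zero, ENNReal.ofReal_one, one_smul] at h
  rw [h, lintegral_duhamelMeasure (continuous_flow hW).measurable _ _ _ _ hg]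
  simp

theorem IsMeasureSolution.isMild (hW : TorusC2 W) (hp : IsScatteringKernel p)
    (hσ : ∀ x, 0 ≤ σ x) (hμ : IsMeasureSolution W σ p μ₀ μ) {c : ℝ} (hc : ∀ x, σ x ≤ c) :
    IsMild (flow hW) (jumpKernel σ p c) (expKernel c (curveKernel hμ.continuous)) := by
  intro t ht g hg
  have h0 : expKernel c (curveKernel hμ.continuous) 0 = (μ₀ : Measure _) := by
    rw [expKernel_apply, mul_zero, Real.exp_zero, ENNReal.ofReal_one, one_smul, curveKernel_apply,
      max_self, hμ.initial_eq hW hp hσ]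
  rw [h0, ← lintegral_duhamelMeasure (continuous_flow hW).measurable _ _ _ _ hg,
    ← hμ.exp_smul_eq_duhamelMeasure hW hp hσ hc ht, expKernel_apply, curveKernel_apply,
    max_eq_left ht]

end MildSolutions

end LinearBoltzmann

namespace LinearBoltzmann

open ProbabilityTheory
open scoped ENNReal

/-! ### Integration by parts in position and in velocity -/

section IntegrationByParts

variable {d : ℕ} {W : Torus d → ℝ}

theorem contDiff_add_proj {u : Torus d → ℝ} (hu : ContDiff ℝ 1 fun y : Vel d => u (proj y))
    (x : Torus d) : ContDiff ℝ 1 fun y : Vel d => u (x + proj y) := by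
  obtain ⟨z, rfl⟩ := proj_surjective x
  simp only [← proj_add]
  exact ContDiff.comp (g := fun y : Vel d => u (proj y)) hu (contDiff_const.add contDiff_id)

theorem inner_torusGrad (u : Torus d → ℝ) (x : Torus d) (a : Vel d) :
    inner ℝ a (torusGrad u x) = fderiv ℝ (fun y : Vel d => u (x + proj y)) 0 a := by
  rw [torusGrad, inner_gradient_right]

theorem inner_torusGrad_add_proj (u : Torus d → ℝ) (x : Torus d) (y a : Vel d) :
    inner ℝ a (torusGrad u (x + proj y)) = fderiv ℝ (fun y : Vel d => u (x + proj y)) y a := by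
  rw [torusGrad_shift, inner_gradient_right]

theorem continuous_inner_torusGrad {u : Torus d → ℝ}
    (hu : ContDiff ℝ 1 fun y : Vel d => u (proj y)) (a : Vel d) :
    Continuous fun x => inner ℝ a (torusGrad u x) := by
  rw [isOpenQuotientMap_proj.isQuotientMap.continuous_iff]
  have h : (fun x => inner ℝ a (torusGrad u x)) ∘ proj
      = fun y : Vel d => fderiv ℝ (fun y : Vel d => u (0 + proj y)) y a := by
    funext y
    rw [← inner_torusGrad_add_proj, zero_add, Function.comp_apply]
  rw [h]
  exact ((contDiff_add_proj hu 0).continuous_fderiv one_ne_zero).clm_apply continuous_const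

theorem continuous_of_contDiff_proj {u : Torus d → ℝ}
    (hu : ContDiff ℝ 1 fun y : Vel d => u (proj y)) : Continuous u := by
  rw [isOpenQuotientMap_proj.isQuotientMap.continuous_iff]
  exact hu.continuous

/-- The integral over the torus of a directional derivative vanishes. -/
theorem integral_inner_torusGrad {u : Torus d → ℝ}
    (hu : ContDiff ℝ 1 fun y : Vel d => u (proj y)) (a : Vel d) :
    ∫ x : Torus d, inner ℝ a (torusGrad u x) = 0 := by
  have hc := continuous_inner_torusGrad hu a
  have huc := continuous_of_contDiff_proj hu
  obtain ⟨C, hC⟩ := isCompact_univ.exists_bound_of_continuousOn hc.continuousOn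
  have hderiv : ∀ (x : Torus d) (s : ℝ), HasDerivAt (fun s : ℝ => u (x + proj (s • a)))
      (inner ℝ a (torusGrad u (x + proj (s • a)))) s := by
    intro x s
    rw [inner_torusGrad_add_proj]
    have h1 := (((contDiff_add_proj hu x).differentiable one_ne_zero) (s • a)).hasFDerivAt
    have h2 : HasDerivAt (fun s : ℝ => s • a) a s := by
      simpa using (hasDerivAt_id s).smul_const a
    exact h1.comp_hasDerivAt s h2
  -- The integral of `u` translated by `s • a` does not depend on `s`; differentiating it at `s = 0`
  -- under the integral gives the claim.
  have h := (hasDerivAt_integral_of_dominated_loc_of_deriv_le (μ := (volume : Measure (Torus d)))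
    (F := fun (s : ℝ) x => u (x + proj (s • a))) (x₀ := 0) (s := Set.univ) (bound := fun _ => C)
    (F' := fun (s : ℝ) x => inner ℝ a (torusGrad u (x + proj (s • a)))) Filter.univ_mem
    (Filter.Eventually.of_forall fun s =>
      (huc.comp (continuous_add_const _)).measurable.aestronglyMeasurable)
    (integrable_of_continuous_torus (huc.comp (continuous_add_const _)))
    (hc.comp (continuous_add_const _)).measurable.aestronglyMeasurable
    (Filter.Eventually.of_forall fun x s _ => hC _ (Set.mem_univ _)) (integrable_const C)
    (Filter.Eventually.of_forall fun x s _ => hderiv x s)).2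
  have h0 : (fun s : ℝ => ∫ x : Torus d, u (x + proj (s • a))) = fun _ => ∫ x : Torus d, u x :=
    funext fun s => integral_add_right_eq_self _ _
  rw [h0] at h
  simpa [proj_zero] using h.unique (hasDerivAt_const _ _)

theorem integral_nuX (hW : TorusC2 W) (f : Torus d → ℝ) :
    ∫ x, f x ∂nuX W = ∫ x, Real.exp (-W x) / (∫ y : Torus d, Real.exp (-W y)) * f x := by
  have hWm : Measurable W := (continuous_of_torusC2 hW).measurable
  rw [nuX, integral_withDensity_eq_integral_toReal_smul (by fun_prop) (by simp)]
  refine integral_congr_ae (Filter.Eventually.of_forall fun x => ?_)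
  simp only [smul_eq_mul]
  rw [ENNReal.toReal_ofReal (div_nonneg (Real.exp_pos _).le (partition_pos hW).le)]

theorem integral_nuV (f : Vel d → ℝ) : ∫ v, f v ∂nuV d = ∫ v, maxwellian v * f v := by
  rw [nuV, integral_withDensity_eq_integral_toReal_smul
    (continuous_maxwellian.measurable.ennreal_ofReal) (by simp)]
  refine integral_congr_ae (Filter.Eventually.of_forall fun v => ?_)
  simp only [smul_eq_mul]
  rw [ENNReal.toReal_ofReal (maxwellian_pos v).le]

/-- The vanishing of the integral of a derivative, applied to `e^{-W} u`. -/
theorem integral_nuX_inner_torusGrad (hW : TorusC2 W) {u : Torus d → ℝ}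
    (hu : ContDiff ℝ 1 fun y : Vel d => u (proj y)) (a : Vel d) :
    ∫ x, inner ℝ a (torusGrad u x) ∂nuX W
      = ∫ x, inner ℝ a (torusGrad W x) * u x ∂nuX W := by
  have hW1 : ContDiff ℝ 1 fun y : Vel d => W (proj y) := ContDiff.of_le hW one_le_two
  have hE : ContDiff ℝ 1 fun y : Vel d => Real.exp (-W (proj y)) * u (proj y) :=
    hW1.neg.exp.mul hu
  have h0 := integral_inner_torusGrad (u := fun x => Real.exp (-W x) * u x) hE a
  have hprod : ∀ x, inner ℝ a (torusGrad (fun x => Real.exp (-W x) * u x) x)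
      = Real.exp (-W x) * inner ℝ a (torusGrad u x)
        - Real.exp (-W x) * (inner ℝ a (torusGrad W x) * u x) := by
    intro x
    have hu' := ((contDiff_add_proj hu x).differentiable one_ne_zero 0).hasFDerivAt
    have hW' := ((contDiff_add_proj hW1 x).differentiable one_ne_zero 0).hasFDerivAt
    have h := (hW'.neg.exp.mul hu').fderiv
    rw [inner_torusGrad, inner_torusGrad, inner_torusGrad]
    have h2 : (fun y : Vel d => Real.exp (-W (x + proj y)) * u (x + proj y))
      = (fun y : Vel d => Real.exp ((-fun y : Vel d => W (x + proj y)) y)) *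
        fun y : Vel d => u (x + proj y) := rfl
    rw [h2, h]
    simp [proj_zero]
    ring
  have hc1 : Continuous fun x => Real.exp (-W x) * inner ℝ a (torusGrad u x) :=
    (continuous_of_torusC2 hW).neg.rexp.mul (continuous_inner_torusGrad hu a)
  have hc2 : Continuous fun x => Real.exp (-W x) * (inner ℝ a (torusGrad W x) * u x) :=
    (continuous_of_torusC2 hW).neg.rexp.mul
      ((continuous_inner_torusGrad hW1 a).mul (continuous_of_contDiff_proj hu))
  simp only [hprod] at h0
  rw [integral_sub (integrable_of_continuous_torus hc1) (integrable_of_continuous_torus hc2),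
    sub_eq_zero] at h0
  rw [integral_nuX hW, integral_nuX hW]
  simp only [div_eq_inv_mul, mul_assoc]
  rw [integral_const_mul, integral_const_mul, h0]

theorem hasFDerivAt_maxwellian (v : Vel d) :
    HasFDerivAt (maxwellian (d := d)) (-(maxwellian v) • innerSL ℝ v) v := by
  have h1 : HasFDerivAt (fun v : Vel d => ‖v‖ ^ 2) (2 • innerSL ℝ v) v :=
    (hasStrictFDerivAt_norm_sq v).hasFDerivAt
  have h2 := ((h1.const_mul (-(1 / 2) : ℝ)).exp).const_mul ((2 * Real.pi) ^ (-(d : ℝ) / 2))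
  have h3 : (fun v : Vel d => (2 * Real.pi) ^ (-(d : ℝ) / 2) * Real.exp (-(1 / 2) * ‖v‖ ^ 2))
      = maxwellian := by
    funext v; rw [maxwellian]; congr 2; ring
  rw [h3] at h2
  refine h2.congr_fderiv (ContinuousLinearMap.ext fun a => ?_)
  rw [← h3]
  simp
  ring

/-- Integration by parts, with `-v` the logarithmic gradient of the Maxwellian. -/
theorem integral_nuV_inner_gradient {f : Vel d → ℝ} (hf : ContDiff ℝ 1 f)
    (hfc : HasCompactSupport f) (a : Vel d) :
    ∫ v, inner ℝ a (gradient f v) ∂nuV d = ∫ v, inner ℝ v a * f v ∂nuV d := by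
  rw [integral_nuV, integral_nuV]
  simp only [inner_gradient_right]
  have hM := continuous_maxwellian (d := d)
  have hfd : ∀ v, fderiv ℝ (maxwellian (d := d)) v a = -(maxwellian v * inner ℝ v a) := fun v => by
    rw [(hasFDerivAt_maxwellian v).fderiv]; simp
  have hf' : Continuous fun v => fderiv ℝ f v a :=
    (hf.continuous_fderiv one_ne_zero).clm_apply continuous_const
  have hf'c : HasCompactSupport fun v => fderiv ℝ f v a :=
    (hfc.fderiv (𝕜 := ℝ)).comp_left (g := fun L : Vel d →L[ℝ] ℝ => L a) rfl
  have hin : Continuous fun v : Vel d => inner ℝ v a := by fun_prop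
  rw [integral_mul_fderiv_eq_neg_fderiv_mul_of_integrable (f := maxwellian) (g := f)]
  · rw [← integral_neg]
    refine integral_congr_ae (Filter.Eventually.of_forall fun v => ?_)
    simp only [hfd]; ring
  · simp only [hfd]
    exact ((hM.mul hin).neg.mul hf.continuous).integrable_of_hasCompactSupport hfc.mul_left
  · exact (hM.mul hf').integrable_of_hasCompactSupport hf'c.mul_left
  · exact (hM.mul hf.continuous).integrable_of_hasCompactSupport hfc.mul_left
  · exact fun v _ => (hasFDerivAt_maxwellian v).differentiableAt
  · exact fun v _ => hf.differentiable one_ne_zero v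

end IntegrationByParts

/-! ### The transport operator integrates to zero against the equilibrium -/

section Equilibrium

variable {d : ℕ} {W : Torus d → ℝ} {τ : ℝ} {φ : ℝ → Torus d → Vel d → ℝ}

theorem exists_bound_of_tsupport {X : Type*} [TopologicalSpace X] [R1Space X] {f D : X → ℝ}
    (hf : HasCompactSupport f) (hD : Continuous D) (h : ∀ q ∉ tsupport f, D q = 0) :
    ∃ C, ∀ q, |D q| ≤ C :=
  (HasCompactSupport.intro hf h).exists_bound_of_continuous hD

theorem eventually_eq_zero_of_notMem_tsupport {q : ℝ × Torus d × Vel d}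
    (hq : q ∉ tsupport fun z : ℝ × Torus d × Vel d => φ z.1 z.2.1 z.2.2) {X : Type*}
    [TopologicalSpace X] {c : X → ℝ × Torus d × Vel d} {x : X} (hc : ContinuousAt c x)
    (hx : c x = q) :
    (fun y => φ (c y).1 (c y).2.1 (c y).2.2) =ᶠ[nhds x] fun _ => 0 := by
  rw [notMem_tsupport_iff_eventuallyEq] at hq
  rw [← hx] at hq
  exact hc.eventually hq

theorem IsTestFunction.continuous_deriv (hφ : IsTestFunction τ φ) :
    Continuous fun q : ℝ × Torus d × Vel d => deriv (fun s => φ s q.2.1 q.2.2) q.1 := by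
  have hφ1 : ContDiff ℝ 1 (liftFun φ) := hφ.contDiff
  rw [isOpenQuotientMap_id_projPhase.isQuotientMap.continuous_iff]
  have h : (fun q : ℝ × Torus d × Vel d => deriv (fun s => φ s q.2.1 q.2.2) q.1)
      ∘ Prod.map id projPhase = fun e => fderiv ℝ (liftFun φ) e (1, 0, 0) := by
    funext e
    exact deriv_proj_eq (hφ1.differentiable one_ne_zero _)
  rw [h]
  exact (hφ1.continuous_fderiv one_ne_zero).clm_apply continuous_const

theorem IsTestFunction.continuous_inner_torusGrad (hφ : IsTestFunction τ φ) :
    Continuous fun q : ℝ × Torus d × Vel d =>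
      (inner ℝ q.2.2 (torusGrad (fun y => φ q.1 y q.2.2) q.2.1) : ℝ) := by
  have hφ1 : ContDiff ℝ 1 (liftFun φ) := hφ.contDiff
  rw [isOpenQuotientMap_id_projPhase.isQuotientMap.continuous_iff]
  have h : (fun q : ℝ × Torus d × Vel d =>
      (inner ℝ q.2.2 (torusGrad (fun y => φ q.1 y q.2.2) q.2.1) : ℝ))
      ∘ Prod.map id projPhase = fun e => fderiv ℝ (liftFun φ) e (0, e.2.2, 0) := by
    funext e
    exact inner_torusGrad_proj_eq (hφ1.differentiable one_ne_zero _) _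
  rw [h]
  exact (hφ1.continuous_fderiv one_ne_zero).clm_apply (by fun_prop)

theorem IsTestFunction.continuous_inner_gradient (hW : TorusC2 W) (hφ : IsTestFunction τ φ) :
    Continuous fun q : ℝ × Torus d × Vel d =>
      (inner ℝ (torusGrad W q.2.1) (gradient (fun w => φ q.1 q.2.1 w) q.2.2) : ℝ) := by
  have hφ1 : ContDiff ℝ 1 (liftFun φ) := hφ.contDiff
  rw [isOpenQuotientMap_id_projPhase.isQuotientMap.continuous_iff]
  have h : (fun q : ℝ × Torus d × Vel d =>
      (inner ℝ (torusGrad W q.2.1) (gradient (fun w => φ q.1 q.2.1 w) q.2.2) : ℝ))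
      ∘ Prod.map id projPhase
      = fun e => fderiv ℝ (liftFun φ) e (0, 0, torusGrad W (proj e.2.1)) := by
    funext e
    exact inner_gradient_proj_eq (hφ1.differentiable one_ne_zero _) _
  rw [h]
  exact (hφ1.continuous_fderiv one_ne_zero).clm_apply (continuous_const.prodMk
    (continuous_const.prodMk ((continuous_torusGrad hW).comp
      (continuous_proj.comp continuous_snd.fst))))

theorem IsTestFunction.exists_bound_deriv (hφ : IsTestFunction τ φ) :
    ∃ C, ∀ q : ℝ × Torus d × Vel d, |deriv (fun s => φ s q.2.1 q.2.2) q.1| ≤ C := by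
  refine exists_bound_of_tsupport hφ.compact hφ.continuous_deriv fun q hq => ?_
  have h := eventually_eq_zero_of_notMem_tsupport hq (c := fun s : ℝ => (s, q.2.1, q.2.2)) (x := q.1)
    (by fun_prop) rfl
  rw [Filter.EventuallyEq.deriv_eq h, deriv_const]

theorem IsTestFunction.exists_bound_inner_torusGrad (hφ : IsTestFunction τ φ) :
    ∃ C, ∀ q : ℝ × Torus d × Vel d,
      |inner ℝ q.2.2 (torusGrad (fun y => φ q.1 y q.2.2) q.2.1)| ≤ C := by
  refine exists_bound_of_tsupport hφ.compact hφ.continuous_inner_torusGrad fun q hq => ?_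
  have h := eventually_eq_zero_of_notMem_tsupport hq (c := fun y : Vel d => (q.1, q.2.1 + proj y, q.2.2)) (x := 0)
    (continuous_const.prodMk ((continuous_const.add continuous_proj).prodMk
      continuous_const)).continuousAt (by simp [proj_zero])
  rw [inner_torusGrad, Filter.EventuallyEq.fderiv_eq h]
  simp

theorem IsTestFunction.exists_bound_inner_gradient (hW : TorusC2 W) (hφ : IsTestFunction τ φ) :
    ∃ C, ∀ q : ℝ × Torus d × Vel d,
      |inner ℝ (torusGrad W q.2.1) (gradient (fun w => φ q.1 q.2.1 w) q.2.2)| ≤ C := by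
  refine exists_bound_of_tsupport hφ.compact (hφ.continuous_inner_gradient hW) fun q hq => ?_
  have h := eventually_eq_zero_of_notMem_tsupport hq (c := fun w : Vel d => (q.1, q.2.1, w)) (x := q.2.2)
    (by fun_prop) rfl
  rw [inner_gradient_right, Filter.EventuallyEq.fderiv_eq h]
  simp

theorem IsTestFunction.contDiff_position (hφ : IsTestFunction τ φ) (t : ℝ) (v : Vel d) :
    ContDiff ℝ 1 fun y : Vel d => φ t (proj y) v :=
  hφ.contDiff.comp (contDiff_const.prodMk (contDiff_id.prodMk contDiff_const))

theorem IsTestFunction.contDiff_velocity (hφ : IsTestFunction τ φ) (t : ℝ) (x : Torus d) :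
    ContDiff ℝ 1 fun v : Vel d => φ t x v := by
  obtain ⟨y, rfl⟩ := proj_surjective x
  exact hφ.contDiff.comp (contDiff_const.prodMk (contDiff_const.prodMk contDiff_id))

theorem IsTestFunction.contDiff_time (hφ : IsTestFunction τ φ) (z : Torus d × Vel d) :
    ContDiff ℝ 1 fun s : ℝ => φ s z.1 z.2 := by
  obtain ⟨y, hy⟩ := proj_surjective z.1
  rw [← hy]
  exact hφ.contDiff.comp (contDiff_id.prodMk (contDiff_const (c := (y, z.2))))

theorem IsTestFunction.hasCompactSupport_velocity (hφ : IsTestFunction τ φ) (t : ℝ)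
    (x : Torus d) : HasCompactSupport fun v : Vel d => φ t x v :=
  HasCompactSupport.intro (hφ.compact.image continuous_snd.snd) fun v hv => by
    by_contra h
    exact hv ⟨(t, x, v), subset_tsupport _ h, rfl⟩

/-- Both sides equal the integral of `(v · ∇W) φ`: one by parts in position, the other by parts in
velocity. -/
theorem IsTestFunction.integral_nu_transport (hW : TorusC2 W) (hφ : IsTestFunction τ φ) (t : ℝ) :
    ∫ z, (inner ℝ z.2 (torusGrad (fun y => φ t y z.2) z.1) : ℝ) ∂nu W
      = ∫ z, (inner ℝ (torusGrad W z.1) (gradient (fun w => φ t z.1 w) z.2) : ℝ) ∂nu W := by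
  have := isProbabilityMeasure_nuX hW
  obtain ⟨C₁, hC₁⟩ := hφ.exists_bound_inner_torusGrad
  obtain ⟨C₂, hC₂⟩ := hφ.exists_bound_inner_gradient hW
  have hslice : Continuous fun z : Torus d × Vel d => ((t, z) : ℝ × Torus d × Vel d) := by fun_prop
  have hc1 := hφ.continuous_inner_torusGrad.comp hslice
  have hc2 := (hφ.continuous_inner_gradient hW).comp hslice
  have hφs : Continuous fun z : Torus d × Vel d => φ t z.1 z.2 := hφ.continuous.comp hslice
  have hc3 : Continuous fun z : Torus d × Vel d =>
      (inner ℝ z.2 (torusGrad W z.1) : ℝ) * φ t z.1 z.2 :=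
    (continuous_snd.inner ((continuous_torusGrad hW).comp continuous_fst)).mul hφs
  obtain ⟨C₃, hC₃⟩ : ∃ C, ∀ z : Torus d × Vel d,
      |(inner ℝ z.2 (torusGrad W z.1) : ℝ) * φ t z.1 z.2| ≤ C := by
    have hcs : HasCompactSupport fun z : Torus d × Vel d => φ t z.1 z.2 :=
      HasCompactSupport.intro (hφ.compact.image continuous_snd) fun z hz => by
        by_contra h
        exact hz ⟨(t, z), subset_tsupport _ h, rfl⟩
    exact (hcs.mul_left).exists_bound_of_continuous hc3
  have hi1 : Integrable (fun z : Torus d × Vel d =>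
      (inner ℝ z.2 (torusGrad (fun y => φ t y z.2) z.1) : ℝ)) ((nuX W).prod (nuV d)) :=
    integrable_of_abs_le hc1.measurable fun z => hC₁ (t, z)
  have hi2 : Integrable (fun z : Torus d × Vel d =>
      (inner ℝ (torusGrad W z.1) (gradient (fun w => φ t z.1 w) z.2) : ℝ))
      ((nuX W).prod (nuV d)) :=
    integrable_of_abs_le hc2.measurable fun z => hC₂ (t, z)
  have hi3 : Integrable (fun z : Torus d × Vel d =>
      (inner ℝ z.2 (torusGrad W z.1) : ℝ) * φ t z.1 z.2) ((nuX W).prod (nuV d)) :=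
    integrable_of_abs_le hc3.measurable hC₃
  have hx : ∀ v, ∫ x, (inner ℝ v (torusGrad (fun y => φ t y v) x) : ℝ) ∂nuX W
      = ∫ x, (inner ℝ v (torusGrad W x) : ℝ) * φ t x v ∂nuX W := fun v =>
    integral_nuX_inner_torusGrad hW (u := fun x => φ t x v) (hφ.contDiff_position t v) v
  have hv : ∀ x, ∫ v, (inner ℝ (torusGrad W x) (gradient (fun w => φ t x w) v) : ℝ) ∂nuV d
      = ∫ v, (inner ℝ v (torusGrad W x) : ℝ) * φ t x v ∂nuV d := fun x =>
    integral_nuV_inner_gradient (f := fun w => φ t x w) (hφ.contDiff_velocity t x)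
      (hφ.hasCompactSupport_velocity t x) (torusGrad W x)
  rw [nu, integral_prod_symm _ hi1, integral_prod _ hi2]
  simp only [hx, hv]
  exact (integral_prod_symm _ hi3).symm.trans (integral_prod _ hi3)

/-- The equilibrium, as a probability measure. -/
noncomputable def equilibrium (hW : TorusC2 W) : ProbabilityMeasure (Torus d × Vel d) :=
  ⟨nu W, isProbabilityMeasure_nu hW⟩

/-- Without collisions the two spatial terms cancel and the time derivative integrates to the
boundary term. This serves to deduce invariance under the flow. -/
theorem isMeasureSolution_equilibrium (hW : TorusC2 W) (p : Vel d → Vel d → ℝ) :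
    IsMeasureSolution W 0 p (equilibrium hW) fun _ => equilibrium hW := by
  have := isProbabilityMeasure_nu hW
  refine fun τ hτ => ⟨continuousOn_const, fun φ hφ => ?_⟩
  change ∫ t in (0 : ℝ)..τ, ∫ z, backwardOp W 0 p φ t z.1 z.2 ∂nu W = -∫ z, φ 0 z.1 z.2 ∂nu W
  obtain ⟨C₀, hC₀⟩ := hφ.exists_bound_deriv
  obtain ⟨C₁, hC₁⟩ := hφ.exists_bound_inner_torusGrad
  obtain ⟨C₂, hC₂⟩ := hφ.exists_bound_inner_gradient hW
  have hs : ∀ t : ℝ, Continuous fun z : Torus d × Vel d => ((t, z) : ℝ × Torus d × Vel d) :=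
    fun t => by fun_prop
  have h1 : ∀ t, ∫ z, backwardOp W 0 p φ t z.1 z.2 ∂nu W
      = ∫ z, deriv (fun s => φ s z.1 z.2) t ∂nu W := by
    intro t
    have hi0 : Integrable (fun z : Torus d × Vel d => deriv (fun s => φ s z.1 z.2) t) (nu W) :=
      integrable_of_abs_le (hφ.continuous_deriv.comp (hs t)).measurable fun z => hC₀ (t, z)
    have hi1 : Integrable (fun z : Torus d × Vel d =>
        (inner ℝ z.2 (torusGrad (fun y => φ t y z.2) z.1) : ℝ)) (nu W) :=
      integrable_of_abs_le (hφ.continuous_inner_torusGrad.comp (hs t)).measurable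
        fun z => hC₁ (t, z)
    have hi2 : Integrable (fun z : Torus d × Vel d =>
        (inner ℝ (torusGrad W z.1) (gradient (fun w => φ t z.1 w) z.2) : ℝ)) (nu W) :=
      integrable_of_abs_le ((hφ.continuous_inner_gradient hW).comp (hs t)).measurable
        fun z => hC₂ (t, z)
    simp only [backwardOp, ContinuousMap.zero_apply, zero_mul, add_zero]
    have hi01 : Integrable (fun z : Torus d × Vel d => deriv (fun s => φ s z.1 z.2) t
        + (inner ℝ z.2 (torusGrad (fun y => φ t y z.2) z.1) : ℝ)) (nu W) := hi0.add hi1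
    rw [integral_sub hi01 hi2, integral_add hi0 hi1, hφ.integral_nu_transport hW,
      add_sub_cancel_right]
  simp only [h1]
  rw [intervalIntegral.integral_of_le hτ.le, integral_integral_swap, ← integral_neg]
  · refine integral_congr_ae (Filter.Eventually.of_forall fun z => ?_)
    simp only
    rw [← intervalIntegral.integral_of_le hτ.le, intervalIntegral.integral_deriv_eq_sub
      (fun s _ => (hφ.contDiff_time z).differentiable one_ne_zero s)
      (((hφ.contDiff_time z).continuous_deriv le_rfl).intervalIntegrable _ _)]
    have : φ τ z.1 z.2 = 0 := by
      by_contra h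
      exact lt_irrefl τ (hφ.support (τ, z.1, z.2) (subset_tsupport _ h))
    rw [this, zero_sub]
  · exact integrable_of_abs_le hφ.continuous_deriv.measurable hC₀

theorem isScatteringKernel_maxwellian :
    IsScatteringKernel fun w (_ : Vel d) => maxwellian w where
  measurable := continuous_maxwellian.measurable.comp measurable_fst
  nonneg w _ := (maxwellian_pos w).le
  mass _ := integral_maxwellian

/-- The equilibrium is invariant under the flow. -/
theorem map_flow_nu (hW : TorusC2 W) {t : ℝ} (ht : 0 ≤ t) : (nu W).map (flow hW t) = nu W := by
  refine Measure.ext_of_lintegral _ fun g hg => ?_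
  -- With `σ = 0` and `c = 0` Duhamel's formula has no jump term and says that the constant solution
  -- is its own push-forward. No Jacobian of the flow is computed; the scattering kernel plays no
  -- role.
  have h := (isMeasureSolution_equilibrium hW _).exp_smul_eq_duhamelMeasure hW
    isScatteringKernel_maxwellian (fun _ => le_rfl) (c := 0) (fun _ => le_rfl) ht
  have h2 := congr_arg (fun m => ∫⁻ z, g z ∂m) h
  simp only [lintegral_duhamelMeasure (continuous_flow hW).measurable _ _ _ _ hg] at h2
  have h3 : ∀ (s : ℝ) (z : Torus d × Vel d), ∫⁻ z', g (flow hW (t - s) z')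
      ∂jumpKernel 0 (fun w (_ : Vel d) => maxwellian w) 0 z = 0 := fun s z => by
    rw [isScatteringKernel_maxwellian.lintegral_jumpKernel (g := fun z => g (flow hW (t - s) z)) 0 z
      (hg.comp (measurable_flow hW _))]
    simp
  simp only [h3, lintegral_zero, add_zero, zero_mul, Real.exp_zero, ENNReal.ofReal_one,
    one_smul] at h2
  rw [lintegral_map hg (measurable_flow hW t)]
  exact h2.symm

end Equilibrium

end LinearBoltzmann

namespace LinearBoltzmann

open ProbabilityTheory
open scoped ENNReal

/-! ### The Dyson series of Duhamel's formula -/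

section Dyson

variable {Z : Type*} [MeasurableSpace Z] {Φ : ℝ → Z → Z} {Q : Kernel Z Z} {ρ : Kernel ℝ Z}

/-- The contribution of `n` jumps to the backward evolution of `g` over a time `t`. -/
noncomputable def dysonTerm (Φ : ℝ → Z → Z) (Q : Kernel Z Z) (g : Z → ℝ≥0∞) :
    ℕ → ℝ → Z → ℝ≥0∞
  | 0, t, z => g (Φ t z)
  | n + 1, t, z => ∫⁻ s in Set.Ioo 0 t, ∫⁻ z', dysonTerm Φ Q g n (t - s) z' ∂Q (Φ s z)

/-- The backward evolution of `g` over a time `t`. -/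
noncomputable def dysonSeries (Φ : ℝ → Z → Z) (Q : Kernel Z Z) (g : Z → ℝ≥0∞) (t : ℝ) (z : Z) :
    ℝ≥0∞ :=
  ∑' n, dysonTerm Φ Q g n t z

theorem setLIntegral_Ioo_eq (f : ℝ → ℝ≥0∞) (a b : ℝ) :
    ∫⁻ s in Set.Ioo a b, f s = ∫⁻ s, (Set.Ioo a b).indicator f s :=
  (lintegral_indicator measurableSet_Ioo f).symm

/-- Joint measurability of an integral over a variable interval. -/
theorem measurable_setLIntegral_Ioo {X : Type*} [MeasurableSpace X] {f : X → ℝ → ℝ≥0∞}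
    {b : X → ℝ} (hf : Measurable fun q : X × ℝ => f q.1 q.2) (hb : Measurable b) :
    Measurable fun x => ∫⁻ s in Set.Ioo 0 (b x), f x s := by
  simp only [setLIntegral_Ioo_eq]
  have hs : MeasurableSet {q : X × ℝ | q.2 ∈ Set.Ioo 0 (b q.1)} :=
    (measurableSet_lt measurable_const measurable_snd).inter
      (measurableSet_lt measurable_snd (hb.comp measurable_fst))
  have h : Measurable fun q : X × ℝ => (Set.Ioo 0 (b q.1)).indicator (f q.1) q.2 :=
    hf.indicator hs
  exact h.lintegral_prod_right'

theorem measurable_dysonTerm [IsSFiniteKernel Q] (hΦ : Measurable fun q : ℝ × Z => Φ q.1 q.2)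
    {g : Z → ℝ≥0∞} (hg : Measurable g) (n : ℕ) :
    Measurable fun q : ℝ × Z => dysonTerm Φ Q g n q.1 q.2 := by
  induction n with
  | zero => exact hg.comp hΦ
  | succ n ih =>
    have h1 : Measurable fun r : (ℝ × ℝ × Z) × Z => dysonTerm Φ Q g n (r.1.2.1 - r.1.1) r.2 :=
      ih.comp ((measurable_fst.snd.fst.sub measurable_fst.fst).prodMk measurable_snd)
    let K : Kernel (ℝ × ℝ × Z) Z := Q.comap (fun r => Φ r.1 r.2.2)
      (hΦ.comp (measurable_fst.prodMk measurable_snd.snd))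
    have h2 : Measurable fun r : ℝ × ℝ × Z =>
        ∫⁻ z', dysonTerm Φ Q g n (r.2.1 - r.1) z' ∂Q (Φ r.1 r.2.2) :=
      h1.lintegral_kernel_prod_right' (κ := K)
    exact measurable_setLIntegral_Ioo (X := ℝ × Z)
      (f := fun q s => ∫⁻ z', dysonTerm Φ Q g n (q.1 - s) z' ∂Q (Φ s q.2))
      (h2.comp (measurable_snd.prodMk measurable_fst)) measurable_fst

theorem measurable_dysonSeries [IsSFiniteKernel Q] (hΦ : Measurable fun q : ℝ × Z => Φ q.1 q.2)
    {g : Z → ℝ≥0∞} (hg : Measurable g) (t : ℝ) : Measurable (dysonSeries Φ Q g t) :=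
  Measurable.tsum fun n => (measurable_dysonTerm hΦ hg n).comp measurable_prodMk_left

theorem measurable_lintegral_dysonTerm [IsSFiniteKernel Q]
    (hΦ : Measurable fun q : ℝ × Z => Φ q.1 q.2) {g : Z → ℝ≥0∞} (hg : Measurable g) (n : ℕ)
    (t : ℝ) :
    Measurable fun q : ℝ × Z => ∫⁻ z', dysonTerm Φ Q g n (t - q.1) z' ∂Q q.2 := by
  have h1 : Measurable fun r : (ℝ × Z) × Z => dysonTerm Φ Q g n (t - r.1.1) r.2 :=
    (measurable_dysonTerm hΦ hg n).comp ((measurable_fst.fst.const_sub t).prodMk measurable_snd)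
  exact h1.lintegral_kernel_prod_right' (κ := Q.comap Prod.snd measurable_snd)

theorem dysonTerm_add [IsSFiniteKernel Q] (hΦ : Measurable fun q : ℝ × Z => Φ q.1 q.2)
    {g h : Z → ℝ≥0∞} (hg : Measurable g) (n : ℕ) (t : ℝ) (z : Z) :
    dysonTerm Φ Q (fun z => g z + h z) n t z = dysonTerm Φ Q g n t z + dysonTerm Φ Q h n t z := by
  induction n generalizing t z with
  | zero => rfl
  | succ n ih =>
    simp only [dysonTerm, ih]
    have h1 : ∀ s, ∫⁻ z', (dysonTerm Φ Q g n (t - s) z' + dysonTerm Φ Q h n (t - s) z') ∂Q (Φ s z)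
        = (∫⁻ z', dysonTerm Φ Q g n (t - s) z' ∂Q (Φ s z))
          + ∫⁻ z', dysonTerm Φ Q h n (t - s) z' ∂Q (Φ s z) := fun s =>
      lintegral_add_left ((measurable_dysonTerm hΦ hg n).comp measurable_prodMk_left) _
    simp only [h1]
    refine lintegral_add_left ?_ _
    exact (measurable_lintegral_dysonTerm hΦ hg n t).comp
      (measurable_id.prodMk (hΦ.comp measurable_prodMk_right))

theorem dysonSeries_add [IsSFiniteKernel Q] (hΦ : Measurable fun q : ℝ × Z => Φ q.1 q.2)
    {g h : Z → ℝ≥0∞} (hg : Measurable g) (t : ℝ) (z : Z) :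
    dysonSeries Φ Q (fun z => g z + h z) t z = dysonSeries Φ Q g t z + dysonSeries Φ Q h t z := by
  simp only [dysonSeries, dysonTerm_add hΦ hg]
  exact ENNReal.tsum_add

theorem dysonTerm_mono {g h : Z → ℝ≥0∞} (hgh : ∀ z, g z ≤ h z) (n : ℕ) (t : ℝ) (z : Z) :
    dysonTerm Φ Q g n t z ≤ dysonTerm Φ Q h n t z := by
  induction n generalizing t z with
  | zero => exact hgh _
  | succ n ih => exact lintegral_mono fun s => lintegral_mono fun z' => ih _ _

theorem setLIntegral_pow {c t : ℝ} (hc : 0 ≤ c) (ht : 0 ≤ t) (n : ℕ) :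
    ∫⁻ s in Set.Ioo 0 t, ENNReal.ofReal (c * ((c * (t - s)) ^ n / n.factorial))
      = ENNReal.ofReal ((c * t) ^ (n + 1) / (n + 1).factorial) := by
  have hcont : Continuous fun s : ℝ => c * ((c * (t - s)) ^ n / n.factorial) := by fun_prop
  have hderiv : ∀ s : ℝ, HasDerivAt (fun s : ℝ => -((c * (t - s)) ^ (n + 1) / (n + 1).factorial))
      (c * ((c * (t - s)) ^ n / n.factorial)) s := by
    intro s
    have h1 : HasDerivAt (fun s : ℝ => c * (t - s)) (-c) s := by
      simpa using ((hasDerivAt_id s).const_sub t).const_mul c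
    have h2 := ((h1.pow (n + 1)).div_const ((n + 1).factorial : ℝ)).neg
    refine h2.congr_deriv ?_
    rw [Nat.factorial_succ]
    have : (n.factorial : ℝ) ≠ 0 := by positivity
    have : (n : ℝ) + 1 ≠ 0 := by positivity
    push_cast
    field_simp
  have hI : ∫ s in (0 : ℝ)..t, c * ((c * (t - s)) ^ n / n.factorial)
      = (c * t) ^ (n + 1) / (n + 1).factorial := by
    rw [intervalIntegral.integral_eq_sub_of_hasDerivAt (fun s _ => hderiv s)
      (hcont.intervalIntegrable _ _)]
    simp
  rw [← hI, intervalIntegral.integral_of_le ht, integral_Ioc_eq_integral_Ioo,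
    ofReal_integral_eq_lintegral_ofReal]
  · exact (intervalIntegrable_iff_integrableOn_Ioo_of_le ht).1 (hcont.intervalIntegrable _ _)
  · filter_upwards [ae_restrict_mem measurableSet_Ioo] with s hs
    have : 0 ≤ t - s := by linarith [hs.2]
    simp only [Pi.zero_apply]
    positivity

/-- At constant total rate the number of jumps is a Poisson variable; this is its weight without the
normalising exponential. -/
theorem dysonTerm_one {c : ℝ} (hc : 0 ≤ c) (hQ : ∀ z, Q z Set.univ = ENNReal.ofReal c) (n : ℕ)
    {t : ℝ} (ht : 0 ≤ t) (z : Z) :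
    dysonTerm Φ Q (fun _ => 1) n t z = ENNReal.ofReal ((c * t) ^ n / n.factorial) := by
  induction n generalizing t z with
  | zero => simp [dysonTerm]
  | succ n ih =>
    rw [dysonTerm, ← setLIntegral_pow hc ht]
    refine setLIntegral_congr_fun measurableSet_Ioo fun s hs => ?_
    simp only [ih (sub_nonneg.2 hs.2.le)]
    rw [lintegral_const, hQ, mul_comm, ENNReal.ofReal_mul hc]

theorem dysonSeries_one {c : ℝ} (hc : 0 ≤ c) (hQ : ∀ z, Q z Set.univ = ENNReal.ofReal c)
    {t : ℝ} (ht : 0 ≤ t) (z : Z) :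
    dysonSeries Φ Q (fun _ => 1) t z = ENNReal.ofReal (Real.exp (c * t)) := by
  have h := NormedSpace.expSeries_div_hasSum_exp (𝔸 := ℝ) (c * t)
  rw [← Real.exp_eq_exp_ℝ] at h
  rw [dysonSeries, ← h.tsum_eq, ENNReal.ofReal_tsum_of_nonneg (fun n => by positivity) h.summable]
  exact tsum_congr fun n => dysonTerm_one hc hQ n ht z

/-- Fubini's theorem on the triangle `0 < r < s < t`, with the change of variables
`s = r + u`. -/
theorem setLIntegral_triangle {f : ℝ → ℝ → ℝ≥0∞} (hf : Measurable fun q : ℝ × ℝ => f q.1 q.2)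
    (t : ℝ) :
    ∫⁻ s in Set.Ioo 0 t, ∫⁻ r in Set.Ioo 0 s, f r s
      = ∫⁻ r in Set.Ioo 0 t, ∫⁻ u in Set.Ioo 0 (t - r), f r (r + u) := by
  -- Both sides are supported on `0 < r`, `0 < u`, `r + u < t`.
  have h1 : ∀ r u : ℝ, (Set.Ioo 0 t).indicator
        (fun r => (Set.Ioo 0 (t - r)).indicator (fun u => f r (r + u)) u) r
      = (Set.Ioo 0 t).indicator (fun s => (Set.Ioo 0 s).indicator (fun r => f r s) r) (r + u) := by
    intro r u
    simp only [Set.indicator_apply, Set.mem_Ioo]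
    split_ifs <;> first | rfl | (exfalso; grind)
  have h2 : Measurable fun q : ℝ × ℝ => (Set.Ioo 0 t).indicator
      (fun s => (Set.Ioo 0 s).indicator (fun r => f r s) q.1) q.2 := by
    have hA : MeasurableSet {q : ℝ × ℝ | q.1 ∈ Set.Ioo 0 q.2} :=
      (measurableSet_lt measurable_const measurable_fst).inter
        (measurableSet_lt measurable_fst measurable_snd)
    have hB : MeasurableSet {q : ℝ × ℝ | q.2 ∈ Set.Ioo 0 t} := measurable_snd measurableSet_Ioo
    exact (hf.indicator hA).indicator hB
  calc ∫⁻ s in Set.Ioo 0 t, ∫⁻ r in Set.Ioo 0 s, f r s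
      = ∫⁻ s, ∫⁻ r, (Set.Ioo 0 t).indicator
          (fun s => (Set.Ioo 0 s).indicator (fun r => f r s) r) s := by
        rw [setLIntegral_Ioo_eq]
        refine lintegral_congr fun s => ?_
        by_cases hs : s ∈ Set.Ioo 0 t
        · simp only [Set.indicator_of_mem hs, setLIntegral_Ioo_eq]
        · simp only [Set.indicator_of_notMem hs, lintegral_zero]
    _ = ∫⁻ r, ∫⁻ s, (Set.Ioo 0 t).indicator
          (fun s => (Set.Ioo 0 s).indicator (fun r => f r s) r) s :=
        lintegral_lintegral_swap (h2.comp measurable_swap).aemeasurable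
    _ = ∫⁻ r, ∫⁻ u, (Set.Ioo 0 t).indicator
          (fun s => (Set.Ioo 0 s).indicator (fun r => f r s) r) (r + u) :=
        lintegral_congr fun r => (lintegral_add_left_eq_self _ r).symm
    _ = _ := by
        simp only [← h1]
        rw [setLIntegral_Ioo_eq]
        refine lintegral_congr fun r => ?_
        by_cases hr : r ∈ Set.Ioo 0 t
        · simp only [Set.indicator_of_mem hr, setLIntegral_Ioo_eq]
        · simp only [Set.indicator_of_notMem hr, lintegral_zero]

/-- What remains in Duhamel's formula after `n` iterations. -/
noncomputable def dysonRemainder (Φ : ℝ → Z → Z) (Q : Kernel Z Z) (ρ : Kernel ℝ Z)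
    (g : Z → ℝ≥0∞) (n : ℕ) (t : ℝ) : ℝ≥0∞ :=
  ∫⁻ s in Set.Ioo 0 t, ∫⁻ z, ∫⁻ z', dysonTerm Φ Q g n (t - s) z' ∂Q z ∂ρ s

/-- Duhamel's formula is inserted for the measure at time `s`. Its free part gives the next Dyson
term; its jump part inserts an earlier jump at `r < s`, and exchanging `r` and `s` gives the next
remainder. -/
theorem IsMild.dysonRemainder_eq [IsSFiniteKernel Q] [IsSFiniteKernel ρ] (hρ : IsMild Φ Q ρ)
    (hΦ : Measurable fun q : ℝ × Z => Φ q.1 q.2) {g : Z → ℝ≥0∞} (hg : Measurable g) (n : ℕ)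
    (t : ℝ) :
    dysonRemainder Φ Q ρ g n t
      = (∫⁻ z, dysonTerm Φ Q g (n + 1) t z ∂ρ 0) + dysonRemainder Φ Q ρ g (n + 1) t := by
  set h : ℝ → Z → ℝ≥0∞ := fun s z => ∫⁻ z', dysonTerm Φ Q g n (t - s) z' ∂Q z with hh
  have hm : Measurable fun q : ℝ × Z => h q.1 q.2 := measurable_lintegral_dysonTerm hΦ hg n t
  have hm1 : Measurable fun q : ℝ × Z => h q.1 (Φ q.1 q.2) := hm.comp (measurable_fst.prodMk hΦ)
  have hstep : dysonRemainder Φ Q ρ g n t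
      = ∫⁻ s in Set.Ioo 0 t, ((∫⁻ z, h s (Φ s z) ∂ρ 0)
        + ∫⁻ r in Set.Ioo 0 s, ∫⁻ z, ∫⁻ z', h s (Φ (s - r) z') ∂Q z ∂ρ r) :=
    setLIntegral_congr_fun measurableSet_Ioo fun s hs =>
      hρ s hs.1.le (h s) (hm.comp measurable_prodMk_left)
  have hJ : Measurable fun q : (ℝ × ℝ) × Z => ∫⁻ z', h q.1.2 (Φ (q.1.2 - q.1.1) z') ∂Q q.2 := by
    have h1 : Measurable fun r : ((ℝ × ℝ) × Z) × Z => h r.1.1.2 (Φ (r.1.1.2 - r.1.1.1) r.2) :=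
      hm.comp (measurable_fst.fst.snd.prodMk
        (hΦ.comp ((measurable_fst.fst.snd.sub measurable_fst.fst.fst).prodMk measurable_snd)))
    exact h1.lintegral_kernel_prod_right' (κ := Q.comap Prod.snd measurable_snd)
  have hJ2 : Measurable fun q : ℝ × ℝ => ∫⁻ z, ∫⁻ z', h q.2 (Φ (q.2 - q.1) z') ∂Q z ∂ρ q.1 :=
    hJ.lintegral_kernel_prod_right' (κ := ρ.comap Prod.fst measurable_fst)
  rw [hstep, lintegral_add_left hm1.lintegral_prod_right']
  congr 1
  · rw [lintegral_lintegral_swap hm1.aemeasurable]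
    rfl
  · rw [setLIntegral_triangle (f := fun r s => ∫⁻ z, ∫⁻ z', h s (Φ (s - r) z') ∂Q z ∂ρ r) hJ2 t]
    refine lintegral_congr fun r => ?_
    have hJ3 : Measurable fun q : ℝ × Z => ∫⁻ z', h (r + q.1) (Φ q.1 z') ∂Q q.2 := by
      have h1 : Measurable fun w : (ℝ × Z) × Z => h (r + w.1.1) (Φ w.1.1 w.2) :=
        hm.comp ((measurable_fst.fst.const_add r).prodMk
          (hΦ.comp (measurable_fst.fst.prodMk measurable_snd)))
      exact h1.lintegral_kernel_prod_right' (κ := Q.comap Prod.snd measurable_snd)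
    simp only [add_sub_cancel_left]
    rw [lintegral_lintegral_swap hJ3.aemeasurable]
    refine lintegral_congr fun z => ?_
    have hJ4 : Measurable fun q : ℝ × Z => h (r + q.1) (Φ q.1 q.2) :=
      hm.comp ((measurable_fst.const_add r).prodMk hΦ)
    rw [lintegral_lintegral_swap hJ4.aemeasurable]
    refine lintegral_congr fun z' => ?_
    simp only [dysonTerm, hh, sub_add_eq_sub_sub]

theorem IsMild.lintegral_eq_sum_add [IsSFiniteKernel Q] [IsSFiniteKernel ρ] (hρ : IsMild Φ Q ρ)
    (hΦ : Measurable fun q : ℝ × Z => Φ q.1 q.2) {g : Z → ℝ≥0∞} (hg : Measurable g) {t : ℝ}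
    (ht : 0 ≤ t) (n : ℕ) :
    ∫⁻ z, g z ∂ρ t = (∑ k ∈ Finset.range (n + 1), ∫⁻ z, dysonTerm Φ Q g k t z ∂ρ 0)
      + dysonRemainder Φ Q ρ g n t := by
  induction n with
  | zero => rw [zero_add, Finset.sum_range_one]; exact hρ t ht g hg
  | succ n ih => rw [ih, hρ.dysonRemainder_eq hΦ hg, Finset.sum_range_succ _ (n + 1), add_assoc]

/-- The remainder is at most a constant times `(c t)^n / n!`. The evolution is thus a function of
the initial measure alone, through one positive operator common to all mild solutions. -/
theorem IsMild.lintegral_eq_dysonSeries [IsSFiniteKernel Q] [IsSFiniteKernel ρ]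
    (hρ : IsMild Φ Q ρ) (hΦ : Measurable fun q : ℝ × Z => Φ q.1 q.2) {c : ℝ} (hc : 0 ≤ c)
    (hQ : ∀ z, Q z Set.univ = ENNReal.ofReal c) {B : ℝ} {t : ℝ} (ht : 0 ≤ t)
    (hB : ∀ s ∈ Set.Ioo 0 t, ρ s Set.univ ≤ ENNReal.ofReal B) {g : Z → ℝ≥0∞} (hg : Measurable g)
    (hg1 : ∀ z, g z ≤ 1) :
    ∫⁻ z, g z ∂ρ t = ∫⁻ z, dysonSeries Φ Q g t z ∂ρ 0 := by
  have hR : Filter.Tendsto (dysonRemainder Φ Q ρ g · t) Filter.atTop (nhds 0) := by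
    have hle : ∀ n, dysonRemainder Φ Q ρ g n t
        ≤ ENNReal.ofReal ((c * t) ^ n / n.factorial)
          * (ENNReal.ofReal c * ENNReal.ofReal B * ENNReal.ofReal t) := by
      intro n
      have h1 : ∀ s ∈ Set.Ioo 0 t, ∫⁻ z, ∫⁻ z', dysonTerm Φ Q g n (t - s) z' ∂Q z ∂ρ s
          ≤ ENNReal.ofReal ((c * t) ^ n / n.factorial) * (ENNReal.ofReal c * ENNReal.ofReal B) := by
        intro s hs
        have h2 : ∀ z', dysonTerm Φ Q g n (t - s) z'
            ≤ ENNReal.ofReal ((c * t) ^ n / n.factorial) := fun z' => by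
          refine (dysonTerm_mono hg1 n _ _).trans ?_
          rw [dysonTerm_one hc hQ n (sub_nonneg.2 hs.2.le)]
          refine ENNReal.ofReal_le_ofReal ?_
          have : 0 ≤ t - s := sub_nonneg.2 hs.2.le
          have : t - s ≤ t := by linarith [hs.1]
          gcongr
        calc _ ≤ ∫⁻ z, ∫⁻ z', ENNReal.ofReal ((c * t) ^ n / n.factorial) ∂Q z ∂ρ s :=
              lintegral_mono fun z => lintegral_mono fun z' => h2 z'
          _ = ENNReal.ofReal ((c * t) ^ n / n.factorial) * (ENNReal.ofReal c * ρ s Set.univ) := by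
              simp only [lintegral_const, hQ, mul_assoc]
          _ ≤ _ := by gcongr; exact hB s hs
      calc dysonRemainder Φ Q ρ g n t ≤ ∫⁻ _ in Set.Ioo 0 t,
            ENNReal.ofReal ((c * t) ^ n / n.factorial) * (ENNReal.ofReal c * ENNReal.ofReal B) :=
            setLIntegral_mono measurable_const h1
        _ = _ := by
            rw [setLIntegral_const, Real.volume_Ioo, sub_zero]
            ring
    have h0 : Filter.Tendsto (fun n : ℕ => ENNReal.ofReal ((c * t) ^ n / n.factorial)
        * (ENNReal.ofReal c * ENNReal.ofReal B * ENNReal.ofReal t)) Filter.atTop (nhds 0) := by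
      have h1 := ENNReal.tendsto_ofReal (FloorSemiring.tendsto_pow_div_factorial_atTop (c * t))
      rw [ENNReal.ofReal_zero] at h1
      have h2 := ENNReal.Tendsto.mul_const (b := ENNReal.ofReal c * ENNReal.ofReal B
        * ENNReal.ofReal t) h1 (Or.inr (by finiteness))
      rwa [zero_mul] at h2
    exact tendsto_of_tendsto_of_tendsto_of_le_of_le tendsto_const_nhds h0 (fun _ => bot_le) hle
  have hsum : ∫⁻ z, dysonSeries Φ Q g t z ∂ρ 0 = ∑' n, ∫⁻ z, dysonTerm Φ Q g n t z ∂ρ 0 :=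
    lintegral_tsum fun n =>
      ((measurable_dysonTerm hΦ hg n).comp measurable_prodMk_left).aemeasurable
  have hlim : Filter.Tendsto (fun n => (∑ k ∈ Finset.range (n + 1),
      ∫⁻ z, dysonTerm Φ Q g k t z ∂ρ 0) + dysonRemainder Φ Q ρ g n t) Filter.atTop
      (nhds ((∑' n, ∫⁻ z, dysonTerm Φ Q g n t z ∂ρ 0) + 0)) :=
    ((ENNReal.summable.hasSum.tendsto_sum_nat).comp (Filter.tendsto_add_atTop_nat 1)).add hR
  rw [add_zero, ← hsum] at hlim
  refine tendsto_nhds_unique (tendsto_const_nhds.congr fun n => ?_) hlim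
  exact hρ.lintegral_eq_sum_add hΦ hg ht n

/-- A mild solution restarted at a later time. -/
theorem IsMild.shift (hρ : IsMild Φ Q ρ) (hΦ : Measurable fun q : ℝ × Z => Φ q.1 q.2)
    (hadd : ∀ s t z, Φ (s + t) z = Φ s (Φ t z)) {t₀ : ℝ} (ht₀ : 0 ≤ t₀) :
    IsMild Φ Q (ρ.comap (fun s => t₀ + s) (measurable_const_add t₀)) := by
  intro t ht g hg
  have h1 := hρ (t₀ + t) (by linarith) g hg
  have h2 := hρ t₀ ht₀ (fun z => g (Φ t z)) (hg.comp (hΦ.comp measurable_prodMk_left))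
  simp only [Kernel.comap_apply, add_zero]
  rw [h1, h2, add_assoc]
  congr 1
  · exact lintegral_congr fun z => by rw [add_comm, hadd]
  · set J : ℝ → ℝ≥0∞ := fun s => ∫⁻ z, ∫⁻ z', g (Φ (t₀ + t - s) z') ∂Q z ∂ρ s with hJ
    have e1 : ∫⁻ s in Set.Ioo 0 t₀, ∫⁻ z, ∫⁻ z', g (Φ t (Φ (t₀ - s) z')) ∂Q z ∂ρ s
        = ∫⁻ s in Set.Ioo 0 t₀, J s := by
      refine lintegral_congr fun s => ?_
      simp only [hJ, ← hadd]
      rw [show t + (t₀ - s) = t₀ + t - s by ring]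
    have e2 : ∫⁻ s in Set.Ioo 0 t, ∫⁻ z, ∫⁻ z', g (Φ (t - s) z') ∂Q z ∂ρ (t₀ + s)
        = ∫⁻ s in Set.Ioo t₀ (t₀ + t), J s := by
      rw [setLIntegral_Ioo_eq, setLIntegral_Ioo_eq,
        ← lintegral_add_left_eq_self ((Set.Ioo t₀ (t₀ + t)).indicator J) t₀]
      refine lintegral_congr fun s => ?_
      have hiff : t₀ + s ∈ Set.Ioo t₀ (t₀ + t) ↔ s ∈ Set.Ioo 0 t := by
        simp only [Set.mem_Ioo]; constructor <;> intro h <;> constructor <;> linarith [h.1, h.2]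
      simp only [Set.indicator_apply, hiff, hJ, add_sub_add_left_eq_sub]
    rw [e1, e2, restrict_Ioo_eq_restrict_Ioc, restrict_Ioo_eq_restrict_Ioc,
      restrict_Ioo_eq_restrict_Ioc, ← lintegral_union measurableSet_Ioc
        (Set.Ioc_disjoint_Ioc_of_le le_rfl), Set.Ioc_union_Ioc_eq_Ioc ht₀ (by linarith)]

end Dyson

end LinearBoltzmann

namespace LinearBoltzmann

open ProbabilityTheory
open scoped ENNReal

/-! ### The equilibrium is a stationary mild solution -/

section Stationary

variable {d : ℕ} {W : Torus d → ℝ} {σ : C(Torus d, ℝ)} {p : Vel d → Vel d → ℝ}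

theorem lintegral_nuV {f : Vel d → ℝ≥0∞} (hf : Measurable f) :
    ∫⁻ v, f v ∂nuV d = ∫⁻ v, ENNReal.ofReal (maxwellian v) * f v := by
  rw [nuV, lintegral_withDensity_eq_lintegral_mul _ continuous_maxwellian.measurable.ennreal_ofReal
    hf]
  rfl

theorem lintegral_nu (hW : TorusC2 W) {f : Torus d × Vel d → ℝ≥0∞} (hf : Measurable f) :
    ∫⁻ z, f z ∂nu W = ∫⁻ x, ∫⁻ v, f (x, v) ∂nuV d ∂nuX W := by
  have := isProbabilityMeasure_nuX hW
  exact lintegral_prod _ hf.aemeasurable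

theorem PreservesMaxwellian.lintegral_density_mul (hp : IsScatteringKernel p)
    (hM : PreservesMaxwellian p) : ∀ᵐ w : Vel d,
      ∫⁻ v, ENNReal.ofReal (maxwellian v) * ENNReal.ofReal (p w v)
        = ENNReal.ofReal (maxwellian w) := by
  filter_upwards [hM] with w hw
  have hi : Integrable fun v => p w v * maxwellian v :=
    not_imp_comm.1 integral_undef (by rw [hw]; exact (maxwellian_pos w).ne')
  rw [← hw, ofReal_integral_eq_lintegral_ofReal hi
    (Filter.Eventually.of_forall fun v => mul_nonneg (hp.nonneg _ _) (maxwellian_pos v).le)]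
  refine lintegral_congr fun v => ?_
  rw [ENNReal.ofReal_mul (hp.nonneg _ _), mul_comm]

/-- After Tonelli the outer variable is integrated against Lebesgue measure, so the equilibrium
relation is only needed almost everywhere. -/
theorem lintegral_nuV_scatter (hp : IsScatteringKernel p) (hM : PreservesMaxwellian p)
    {f : Vel d → ℝ≥0∞} (hf : Measurable f) :
    ∫⁻ v, (∫⁻ w, ENNReal.ofReal (p w v) * f w) ∂nuV d = ∫⁻ w, f w ∂nuV d := by
  have hpm : Measurable fun q : Vel d × Vel d => ENNReal.ofReal (p q.2 q.1) :=
    (hp.measurable.comp measurable_swap).ennreal_ofReal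
  have hMm : Measurable fun v : Vel d => ENNReal.ofReal (maxwellian v) :=
    continuous_maxwellian.measurable.ennreal_ofReal
  have h1 : Measurable fun q : Vel d × Vel d => ENNReal.ofReal (p q.2 q.1) * f q.2 :=
    hpm.mul (hf.comp measurable_snd)
  have hF : Measurable fun v => ∫⁻ w, ENNReal.ofReal (p w v) * f w := h1.lintegral_prod_right'
  rw [lintegral_nuV hF, lintegral_nuV hf]
  have h2 : ∀ v, ENNReal.ofReal (maxwellian v) * ∫⁻ w, ENNReal.ofReal (p w v) * f w
      = ∫⁻ w, ENNReal.ofReal (maxwellian v) * ENNReal.ofReal (p w v) * f w := fun v => by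
    have h : Measurable fun w => ENNReal.ofReal (p w v) * f w := h1.comp measurable_prodMk_left
    rw [← lintegral_const_mul _ h]
    simp only [mul_assoc]
  simp only [h2]
  rw [lintegral_lintegral_swap
    (((hMm.comp measurable_fst).mul hpm).mul (hf.comp measurable_snd)).aemeasurable]
  refine lintegral_congr_ae ?_
  filter_upwards [hM.lintegral_density_mul hp] with w hw
  rw [← hw, ← lintegral_mul_const]
  exact hMm.mul (hpm.comp measurable_prodMk_right)

/-- At each position scattering preserves the Maxwellian and a fictitious jump changes nothing; the
rates `σ` and `c - σ` add up to `c`. -/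
theorem lintegral_nu_jumpKernel (hW : TorusC2 W) (hp : IsScatteringKernel p)
    (hM : PreservesMaxwellian p) (hσ : ∀ x, 0 ≤ σ x) {c : ℝ} (hc : ∀ x, σ x ≤ c)
    {g : Torus d × Vel d → ℝ≥0∞} (hg : Measurable g) :
    ∫⁻ z, ∫⁻ z', g z' ∂jumpKernel σ p c z ∂nu W = ENNReal.ofReal c * ∫⁻ z, g z ∂nu W := by
  rw [lintegral_nu hW hg.lintegral_kernel, lintegral_nu hW hg, ← lintegral_const_mul _
    hg.lintegral_prod_right']
  refine lintegral_congr fun x => ?_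
  have hgx : Measurable fun w => g (x, w) := hg.comp measurable_prodMk_left
  have h1 : Measurable fun v => ∫⁻ w, ENNReal.ofReal (p w v) * g (x, w) := by
    have : Measurable fun q : Vel d × Vel d => ENNReal.ofReal (p q.2 q.1) * g (x, q.2) :=
      (hp.measurable.comp measurable_swap).ennreal_ofReal.mul (hgx.comp measurable_snd)
    exact this.lintegral_prod_right'
  simp only [hp.lintegral_jumpKernel c _ hg]
  rw [lintegral_add_left (h1.const_mul _), lintegral_const_mul _ h1, lintegral_const_mul _ hgx,
    lintegral_nuV_scatter hp hM hgx, ← add_mul, ← ENNReal.ofReal_add (hσ x)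
    (sub_nonneg.2 (hc x)), add_sub_cancel]

theorem setLIntegral_mul_exp {c t : ℝ} (hc : 0 ≤ c) (ht : 0 ≤ t) :
    1 + ∫⁻ s in Set.Ioo 0 t, ENNReal.ofReal c * ENNReal.ofReal (Real.exp (c * s))
      = ENNReal.ofReal (Real.exp (c * t)) := by
  have hcont : Continuous fun s : ℝ => c * Real.exp (c * s) := by fun_prop
  have hI : ∫ s in (0 : ℝ)..t, c * Real.exp (c * s) = Real.exp (c * t) - 1 := by
    have hd : ∀ s : ℝ, HasDerivAt (fun s => Real.exp (c * s)) (c * Real.exp (c * s)) s := fun s => by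
      have := ((hasDerivAt_id s).const_mul c).exp
      simpa [mul_comm] using this
    rw [intervalIntegral.integral_eq_sub_of_hasDerivAt (fun s _ => hd s)
      (hcont.intervalIntegrable _ _)]
    simp
  have hL : ∫⁻ s in Set.Ioo 0 t, ENNReal.ofReal c * ENNReal.ofReal (Real.exp (c * s))
      = ENNReal.ofReal (Real.exp (c * t) - 1) := by
    rw [← hI, intervalIntegral.integral_of_le ht, integral_Ioc_eq_integral_Ioo,
      ofReal_integral_eq_lintegral_ofReal]
    · simp only [ENNReal.ofReal_mul hc]
    · exact (intervalIntegrable_iff_integrableOn_Ioo_of_le ht).1 (hcont.intervalIntegrable _ _)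
    · exact Filter.Eventually.of_forall fun s => by
        simp only [Pi.zero_apply]; positivity
  have : (1 : ℝ) ≤ Real.exp (c * t) := Real.one_le_exp (mul_nonneg hc ht)
  rw [hL, ← ENNReal.ofReal_one, ← ENNReal.ofReal_add zero_le_one (by linarith)]
  congr 1; ring

/-- By invariance under flow and jumps, every term of Duhamel's formula is a multiple of `ν`, and
the formula reduces to `1 + ∫ c e^{cs} ds = e^{ct}`. -/
theorem isMild_nu (hW : TorusC2 W) (hp : IsScatteringKernel p) (hM : PreservesMaxwellian p)
    (hσ : ∀ x, 0 ≤ σ x) {c : ℝ} (hc0 : 0 ≤ c) (hc : ∀ x, σ x ≤ c) [SFinite (nu W)] :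
    IsMild (flow hW) (jumpKernel σ p c) (expKernel c (Kernel.const ℝ (nu W))) := by
  intro t ht g hg
  have hgt : ∀ s, Measurable fun z => g (flow hW s z) := fun s => hg.comp (measurable_flow hW s)
  have hinv : ∀ s, 0 ≤ s → ∫⁻ z, g (flow hW s z) ∂nu W = ∫⁻ z, g z ∂nu W := fun s hs => by
    rw [← lintegral_map hg (measurable_flow hW s), map_flow_nu hW hs]
  have h1 : ∫⁻ s in Set.Ioo 0 t, ∫⁻ z, ∫⁻ z', g (flow hW (t - s) z') ∂jumpKernel σ p c z
        ∂expKernel c (Kernel.const ℝ (nu W)) s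
      = (∫⁻ s in Set.Ioo 0 t, ENNReal.ofReal c * ENNReal.ofReal (Real.exp (c * s)))
        * ∫⁻ z, g z ∂nu W := by
    rw [← lintegral_mul_const _ (by fun_prop)]
    refine setLIntegral_congr_fun measurableSet_Ioo fun s hs => ?_
    rw [lintegral_expKernel _ _ _ (hgt _).lintegral_kernel, Kernel.const_apply,
      lintegral_nu_jumpKernel hW hp hM hσ hc (hgt _), hinv _ (sub_nonneg.2 hs.2.le)]
    ring
  rw [lintegral_expKernel _ _ _ hg, lintegral_expKernel _ _ _ (hgt t), h1, Kernel.const_apply,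
    Kernel.const_apply, hinv t ht, ← setLIntegral_mul_exp hc0 ht]
  simp [add_mul]

end Stationary

/-! ### The lower bound given by two jumps -/

section Minorization

variable {d : ℕ} {W : Torus d → ℝ} {σ : C(Torus d, ℝ)} {p : Vel d → Vel d → ℝ}

theorem GeometricControl.ofReal_le_setLIntegral {hW : TorusC2 W} {T κ : ℝ} (hσ : ∀ x, 0 ≤ σ x)
    (hκ : GeometricControl hW σ T κ) (z : Torus d × Vel d) :
    ENNReal.ofReal κ ≤ ∫⁻ r in Set.Ioo 0 T, ENNReal.ofReal (σ (flow hW r z).1) := by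
  obtain ⟨hT, -, hκ'⟩ := hκ
  have hc : Continuous fun r => σ (flow hW r z).1 :=
    σ.continuous.comp (continuous_fst.comp
      ((continuous_flow hW).comp (continuous_id.prodMk continuous_const)))
  refine (ENNReal.ofReal_le_ofReal (hκ' z)).trans_eq ?_
  rw [intervalIntegral.integral_of_le hT.le, integral_Ioc_eq_integral_Ioo,
    ofReal_integral_eq_lintegral_ofReal]
  · exact (intervalIntegrable_iff_integrableOn_Ioo_of_le hT.le).1 (hc.intervalIntegrable _ _)
  · exact Filter.Eventually.of_forall fun r => hσ _

theorem le_lintegral_jumpKernel (hp : IsScatteringKernel p) {R m : ℝ}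
    (hR : ∀ w ∈ Metric.ball (0 : Vel d) R, ∀ v, m ≤ p w v) (c : ℝ) (z : Torus d × Vel d)
    {g : Torus d × Vel d → ℝ≥0∞} (hg : Measurable g) :
    ENNReal.ofReal (σ z.1) * (ENNReal.ofReal m * ∫⁻ w in Metric.ball 0 R, g (z.1, w))
      ≤ ∫⁻ z', g z' ∂jumpKernel σ p c z := by
  rw [hp.lintegral_jumpKernel c z hg]
  refine le_trans ?_ le_self_add
  gcongr
  have hgz : Measurable fun w => g (z.1, w) := hg.comp measurable_prodMk_left
  rw [← lintegral_const_mul _ hgz]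
  refine le_trans ?_ (setLIntegral_le_lintegral (Metric.ball 0 R) _)
  refine setLIntegral_mono' measurableSet_ball fun w hw => ?_
  gcongr
  exact hR w hw z.2

/-- The measure that bounds from below the state after two jumps, the second of which takes place
at a time `s ∈ (a, b)`. -/
noncomputable def minorant (hW : TorusC2 W) (σ : C(Torus d, ℝ)) (R a b : ℝ) :
    Measure (Torus d × Vel d) :=
  (((volume.restrict (Set.Ioo a b)).prod
    ((nuX W).withDensity fun x => ENNReal.ofReal (σ x))).prod
      (volume.restrict (Metric.ball (0 : Vel d) R))).map
    fun q : (ℝ × Torus d) × Vel d => flow hW (b - q.1.1) (q.1.2, q.2)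

theorem lintegral_prod_prod {X Y E : Type*} [MeasurableSpace X] [MeasurableSpace Y]
    [MeasurableSpace E] (m₁ : Measure X) (m₂ : Measure Y) (m₃ : Measure E) [SFinite m₂] [SFinite m₃]
    {F : (X × Y) × E → ℝ≥0∞} (hF : Measurable F) :
    ∫⁻ q, F q ∂(m₁.prod m₂).prod m₃ = ∫⁻ x, ∫⁻ y, ∫⁻ e, F ((x, y), e) ∂m₃ ∂m₂ ∂m₁ :=
  (lintegral_prod _ hF.aemeasurable).trans
    (lintegral_prod _ (Measurable.lintegral_prod_right' hF).aemeasurable)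

theorem lintegral_minorant (hW : TorusC2 W) (σ : C(Torus d, ℝ)) (R a b : ℝ)
    {g : Torus d × Vel d → ℝ≥0∞} (hg : Measurable g) :
    ∫⁻ z, g z ∂minorant hW σ R a b
      = ∫⁻ s in Set.Ioo a b, ∫⁻ x, ENNReal.ofReal (σ x) *
          (∫⁻ w in Metric.ball 0 R, g (flow hW (b - s) (x, w))) ∂nuX W := by
  have := isProbabilityMeasure_nuX hW
  have hσm : Measurable fun x => ENNReal.ofReal (σ x) := σ.continuous.measurable.ennreal_ofReal
  have h1 : Measurable fun q : (ℝ × Torus d) × Vel d => flow hW (b - q.1.1) (q.1.2, q.2) :=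
    (continuous_flow hW).measurable.comp
      ((measurable_fst.fst.const_sub b).prodMk (measurable_fst.snd.prodMk measurable_snd))
  have h2 : Measurable fun q : (ℝ × Torus d) × Vel d => g (flow hW (b - q.1.1) (q.1.2, q.2)) :=
    hg.comp h1
  have h4 : ∀ s : ℝ, Measurable fun x : Torus d =>
      ∫⁻ w in Metric.ball 0 R, g (flow hW (b - s) (x, w)) :=
    fun s => (hg.comp (measurable_flow hW (b - s))).lintegral_prod_right'
  rw [minorant, lintegral_map hg h1, lintegral_prod_prod _ _ _ h2]
  exact lintegral_congr fun s => lintegral_withDensity_eq_lintegral_mul _ hσm (h4 s)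

theorem ofReal_mul_minorant_le_dysonSeries (hW : TorusC2 W) (hp : IsScatteringKernel p)
    {R m T T₀ β κ c : ℝ} (hT₀ : 0 < T₀)
    (hR : ∀ w ∈ Metric.ball (0 : Vel d) R, ∀ v, m ≤ p w v)
    (hβ : ∀ t ∈ Set.Icc T₀ (2 * T + T₀), ∀ x₀, ENNReal.ofReal β • nuX W
      ≤ (volume.restrict (Metric.ball 0 R)).map fun w => (flow hW t (x₀, w)).1)
    (hσ : ∀ x, 0 ≤ σ x) (hκ : GeometricControl hW σ T κ)
    {g : Torus d × Vel d → ℝ≥0∞} (hg : Measurable g) (z : Torus d × Vel d) :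
    ENNReal.ofReal κ * (ENNReal.ofReal m * ENNReal.ofReal m * (ENNReal.ofReal β *
      ∫⁻ z, g z ∂minorant hW σ R (T + T₀) (2 * T + T₀)))
      ≤ dysonSeries (flow hW) (jumpKernel σ p c) g (2 * T + T₀) z := by
  have hT := hκ.1
  have := isProbabilityMeasure_nuX hW
  set b := 2 * T + T₀ with hb
  set Q := jumpKernel σ p c with hQ
  have hΦ := (continuous_flow hW).measurable
  have hσm : Measurable fun x => ENNReal.ofReal (σ x) := σ.continuous.measurable.ennreal_ofReal
  have hDm : ∀ n t, Measurable (dysonTerm (flow hW) Q g n t) := fun n t =>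
    (measurable_dysonTerm hΦ hg n).comp measurable_prodMk_left
  set K : ℝ → Torus d → ℝ≥0∞ := fun s x => ENNReal.ofReal (σ x) * (ENNReal.ofReal m *
    ∫⁻ w in Metric.ball 0 R, g (flow hW (b - s) (x, w))) with hK
  have h3 : Measurable fun q : ℝ × Torus d =>
      ∫⁻ w in Metric.ball 0 R, g (flow hW (b - q.1) (q.2, w)) := by
    have h1 : Measurable fun q : (ℝ × Torus d) × Vel d => g (flow hW (b - q.1.1) (q.1.2, q.2)) :=
      hg.comp (hΦ.comp
        ((measurable_fst.fst.const_sub b).prodMk (measurable_fst.snd.prodMk measurable_snd)))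
    exact h1.lintegral_prod_right'
  have hKm : Measurable fun q : ℝ × Torus d => K q.1 q.2 :=
    (hσm.comp measurable_snd).mul (h3.const_mul _)
  set η := ∫⁻ z, g z ∂minorant hW σ R (T + T₀) b with hη
  have hηK : ENNReal.ofReal m * η = ∫⁻ s in Set.Ioo (T + T₀) b, ∫⁻ x, K s x ∂nuX W := by
    have h4 : Measurable fun q : ℝ × Torus d => ENNReal.ofReal (σ q.2) *
        (∫⁻ w in Metric.ball 0 R, g (flow hW (b - q.1) (q.2, w))) :=
      (hσm.comp measurable_snd).mul h3
    rw [hη, lintegral_minorant hW σ R _ _ hg, ← lintegral_const_mul _ h4.lintegral_prod_right']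
    refine lintegral_congr fun s => ?_
    have h5 : Measurable fun x => ENNReal.ofReal (σ x) *
        (∫⁻ w in Metric.ball 0 R, g (flow hW (b - s) (x, w))) := h4.comp measurable_prodMk_left
    rw [← lintegral_const_mul _ h5]
    refine lintegral_congr fun x => ?_
    simp only [hK]; ring
  -- the second jump
  have hF1 : ∀ r ∈ Set.Ioo 0 T, ∀ y : Torus d × Vel d,
      ∫⁻ s in Set.Ioo (T + T₀) b, K s (flow hW (s - r) y).1
        ≤ dysonTerm (flow hW) Q g 1 (b - r) y := by
    intro r hr y
    -- Translation by `r` makes `s` the absolute time of the second jump, so that the bound can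
    -- refer to a window of times independent of `r`.
    have e : dysonTerm (flow hW) Q g 1 (b - r) y
        = ∫⁻ s in Set.Ioo r b, ∫⁻ z', g (flow hW (b - s) z') ∂Q (flow hW (s - r) y) := by
      simp only [dysonTerm]
      rw [setLIntegral_Ioo_eq, setLIntegral_Ioo_eq, ← lintegral_add_left_eq_self
        ((Set.Ioo r b).indicator fun s =>
          ∫⁻ z', g (flow hW (b - s) z') ∂Q (flow hW (s - r) y)) r]
      refine lintegral_congr fun s => ?_
      have hiff : r + s ∈ Set.Ioo r b ↔ s ∈ Set.Ioo 0 (b - r) := by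
        simp only [Set.mem_Ioo]; constructor <;> intro h <;> constructor <;> linarith [h.1, h.2]
      simp only [Set.indicator_apply, hiff, add_sub_cancel_left, sub_add_eq_sub_sub]
    rw [e]
    have hrT : r ≤ T + T₀ := by linarith [hr.2]
    refine le_trans (lintegral_mono fun s => ?_) (lintegral_mono_set (Set.Ioo_subset_Ioo_left hrT))
    exact le_lintegral_jumpKernel (g := fun z => g (flow hW (b - s) z)) hp hR c _
      (hg.comp (measurable_flow hW (b - s)))
  -- the velocity after the first jump spreads the position at the second jump
  have hspread : ∀ r ∈ Set.Ioo 0 T, ∀ x : Torus d, ENNReal.ofReal β * (ENNReal.ofReal m * η)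
      ≤ ∫⁻ w in Metric.ball 0 R, dysonTerm (flow hW) Q g 1 (b - r) (x, w) := by
    intro r hr x
    have hm1 : Measurable fun q : Vel d × ℝ => K q.2 (flow hW (q.2 - r) (x, q.1)).1 :=
      hKm.comp (measurable_snd.prodMk (hΦ.comp ((measurable_snd.sub_const r).prodMk
        (measurable_const.prodMk measurable_fst))).fst)
    calc ENNReal.ofReal β * (ENNReal.ofReal m * η)
        = ∫⁻ s in Set.Ioo (T + T₀) b, ENNReal.ofReal β * ∫⁻ x, K s x ∂nuX W := by
          rw [hηK, lintegral_const_mul _ hKm.lintegral_prod_right']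
      _ ≤ ∫⁻ s in Set.Ioo (T + T₀) b, ∫⁻ w in Metric.ball 0 R, K s (flow hW (s - r) (x, w)).1 := by
          refine setLIntegral_mono' measurableSet_Ioo fun s hs => ?_
          have hKs : Measurable (K s) := hKm.comp measurable_prodMk_left
          -- The second jump is restricted to `s > T + T₀` so that at least `T₀` elapses after the
          -- first one, whenever `r < T`.
          have hle := hβ (s - r) ⟨by linarith [hs.1, hr.2], by linarith [hs.2, hr.1]⟩ x
          have hf : Measurable fun w : Vel d => (flow hW (s - r) (x, w)).1 :=
            ((measurable_flow hW (s - r)).comp measurable_prodMk_left).fst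
          have := lintegral_mono' hle (le_refl (K s))
          rwa [lintegral_smul_measure, smul_eq_mul, lintegral_map hKs hf] at this
      _ = ∫⁻ w in Metric.ball 0 R, ∫⁻ s in Set.Ioo (T + T₀) b, K s (flow hW (s - r) (x, w)).1 :=
          (lintegral_lintegral_swap hm1.aemeasurable).symm
      _ ≤ _ := lintegral_mono fun w => hF1 r hr (x, w)
  -- the first jump
  have hκ2 := hκ.ofReal_le_setLIntegral hσ z
  calc _ = ENNReal.ofReal κ * (ENNReal.ofReal m * (ENNReal.ofReal β * (ENNReal.ofReal m * η))) := by
        ring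
    _ ≤ (∫⁻ r in Set.Ioo 0 T, ENNReal.ofReal (σ (flow hW r z).1))
          * (ENNReal.ofReal m * (ENNReal.ofReal β * (ENNReal.ofReal m * η))) := by gcongr
    _ = ∫⁻ r in Set.Ioo 0 T, ENNReal.ofReal (σ (flow hW r z).1)
          * (ENNReal.ofReal m * (ENNReal.ofReal β * (ENNReal.ofReal m * η))) := by
        rw [lintegral_mul_const]
        exact hσm.comp (hΦ.comp measurable_prodMk_right).fst
    _ ≤ ∫⁻ r in Set.Ioo 0 T, ∫⁻ z', dysonTerm (flow hW) Q g 1 (b - r) z' ∂Q (flow hW r z) := by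
        refine setLIntegral_mono' measurableSet_Ioo fun r hr => ?_
        refine le_trans ?_ (le_lintegral_jumpKernel hp hR c _ (hDm 1 (b - r)))
        gcongr
        exact hspread r hr _
    _ ≤ dysonTerm (flow hW) Q g 2 b z :=
        lintegral_mono_set (Set.Ioo_subset_Ioo_right (by linarith))
    _ ≤ _ := ENNReal.le_tsum 2

/-- Averaging the control condition over the invariant `ν` turns the time integral into `T ∫ σ
dν_x`. The window for the second jump has length exactly `T`, so this quantity reappears in the
mass. -/
theorem le_minorant_univ (hW : TorusC2 W) {R T T₀ κ : ℝ} (hσ : ∀ x, 0 ≤ σ x)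
    (hκ : GeometricControl hW σ T κ) :
    ENNReal.ofReal κ * volume (Metric.ball (0 : Vel d) R)
      ≤ ∫⁻ _, 1 ∂minorant hW σ R (T + T₀) (2 * T + T₀) := by
  have hT := hκ.1
  have := isProbabilityMeasure_nuX hW
  have := isProbabilityMeasure_nu hW
  have hΦ := (continuous_flow hW).measurable
  have hσm : Measurable fun x => ENNReal.ofReal (σ x) := σ.continuous.measurable.ennreal_ofReal
  have hσz : Measurable fun z : Torus d × Vel d => ENNReal.ofReal (σ z.1) :=
    hσm.comp measurable_fst
  have h1 : ENNReal.ofReal κ ≤ ENNReal.ofReal T * ∫⁻ x, ENNReal.ofReal (σ x) ∂nuX W := by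
    have hm : Measurable fun q : (Torus d × Vel d) × ℝ =>
        ENNReal.ofReal (σ (flow hW q.2 q.1).1) :=
      hσz.comp (hΦ.comp (measurable_snd.prodMk measurable_fst))
    calc ENNReal.ofReal κ = ∫⁻ _, ENNReal.ofReal κ ∂nu W := by simp
      _ ≤ ∫⁻ z, (∫⁻ r in Set.Ioo 0 T, ENNReal.ofReal (σ (flow hW r z).1)) ∂nu W := by
          exact lintegral_mono fun z => hκ.ofReal_le_setLIntegral hσ z
      _ = ∫⁻ r in Set.Ioo 0 T, ∫⁻ z, ENNReal.ofReal (σ (flow hW r z).1) ∂nu W :=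
          lintegral_lintegral_swap hm.aemeasurable
      _ = ∫⁻ _ in Set.Ioo 0 T, ∫⁻ x, ENNReal.ofReal (σ x) ∂nuX W := by
          refine setLIntegral_congr_fun measurableSet_Ioo fun r hr => ?_
          rw [← lintegral_map hσz (measurable_flow hW r), map_flow_nu hW hr.1.le,
            lintegral_nu hW hσz]
          simp
      _ = _ := by rw [setLIntegral_const, Real.volume_Ioo, sub_zero, mul_comm]
  rw [lintegral_minorant hW σ R _ _ measurable_const]
  simp only [lintegral_const, one_mul, Measure.restrict_apply_univ, Real.volume_Ioo]
  rw [lintegral_mul_const _ hσm, show 2 * T + T₀ - (T + T₀) = T by ring]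
  calc _ ≤ ENNReal.ofReal T * (∫⁻ x, ENNReal.ofReal (σ x) ∂nuX W)
        * volume (Metric.ball (0 : Vel d) R) := mul_le_mul_left h1 _
    _ = _ := by ring

end Minorization

end LinearBoltzmann

namespace LinearBoltzmann

open ProbabilityTheory
open scoped ENNReal

/-! ### Total variation against measurable functions -/

section TotalVariation

variable {X : Type*} [MeasurableSpace X]

/-- `m` and `n` differ by at most `D` on measurable functions bounded by one. -/
def GapLE (m n : Measure X) (D : ℝ) : Prop :=
  ∀ f : X → ℝ, Measurable f → (∀ x, |f x| ≤ 1) → (∫ x, f x ∂m) - ∫ x, f x ∂n ≤ D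

theorem GapLE.nonneg {m n : Measure X} {D : ℝ} (h : GapLE m n D) : 0 ≤ D := by
  simpa using h (fun _ => 0) measurable_const (by simp)

theorem GapLE.sub_le {m n : Measure X} {D : ℝ} (h : GapLE m n D) {f : X → ℝ} (hf : Measurable f)
    {r : ℝ} (hr0 : 0 ≤ r) (hr : ∀ x, |f x| ≤ r) : (∫ x, f x ∂m) - ∫ x, f x ∂n ≤ r * D := by
  rcases hr0.eq_or_lt with h0 | h0
  · have hf0 : f = 0 := funext fun x => abs_nonpos_iff.1 ((hr x).trans_eq h0.symm)
    simp [hf0, ← h0]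
  · have h1 := h (fun x => r⁻¹ * f x) (hf.const_mul _) fun x => by
      rw [abs_mul, abs_of_pos (inv_pos.2 h0), inv_mul_le_iff₀ h0, mul_one]
      exact hr x
    rw [integral_const_mul, integral_const_mul, ← mul_sub, inv_mul_le_iff₀ h0] at h1
    exact h1

theorem tvDist_le_of_gapLE [TopologicalSpace X] [BorelSpace X] {m n : Measure X} {D : ℝ}
    (h : GapLE m n D) : tvDist m n ≤ D := by
  refine csSup_le ⟨0, 0, by simp, by simp⟩ ?_
  rintro r ⟨φ, hφ, rfl⟩
  exact h φ φ.continuous.measurable fun x => (φ.norm_coe_le_norm x).trans hφ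

/-- Bounded continuous functions are dense in `L¹(m + n)`, and clipping an approximation to `[-1,
1]` only brings it closer to a function with values there. -/
theorem gapLE_tvDist {X : Type*} [MeasurableSpace X] [PseudoMetricSpace X] [BorelSpace X]
    (m n : Measure X) [IsProbabilityMeasure m] [IsProbabilityMeasure n] :
    GapLE m n (tvDist m n) := by
  intro f hf hf1
  refine le_of_forall_pos_le_add fun ε hε => ?_
  have hfi : Integrable f (m + n) := integrable_of_abs_le hf hf1
  obtain ⟨g, hg, hgi⟩ := hfi.exists_boundedContinuous_integral_sub_le hε
  let g' : BoundedContinuousFunction X ℝ := BoundedContinuousFunction.ofNormedAddCommGroup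
    (fun x => max (-1) (min 1 (g x))) (by fun_prop) 1 fun x => by
      rw [Real.norm_eq_abs, abs_le]
      exact ⟨le_max_left _ _, max_le (by norm_num) (min_le_left _ _)⟩
  have hg'1 : ‖g'‖ ≤ 1 := BoundedContinuousFunction.norm_ofNormedAddCommGroup_le _ zero_le_one _
  have hg'm : Measurable fun x => g' x := g'.continuous.measurable
  have hg'b : ∀ x, |g' x| ≤ 1 := fun x => (g'.norm_coe_le_norm x).trans hg'1
  have hle : ∀ x, |f x - g' x| ≤ ‖f x - g x‖ := by
    intro x
    have h1 := abs_le.1 (hf1 x)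
    change |f x - max (-1) (min 1 (g x))| ≤ |f x - g x|
    rcases max_cases (-1 : ℝ) (min 1 (g x)) with h2 | h2 <;>
      rcases min_cases (1 : ℝ) (g x) with h3 | h3 <;>
      rcases abs_cases (f x - max (-1) (min 1 (g x))) with h4 | h4 <;>
      rcases abs_cases (f x - g x) with h5 | h5 <;> linarith
  have hdm : Measurable fun x => |f x - g' x| := (hf.sub hg'm).abs
  have hdb : ∀ x, |(|f x - g' x|)| ≤ 2 := fun x => by
    rw [abs_abs]
    refine (abs_sub _ _).trans ?_
    linarith [hf1 x, hg'b x]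
  have hint : (∫ x, |f x - g' x| ∂m) + ∫ x, |f x - g' x| ∂n ≤ ε := by
    rw [← integral_add_measure (integrable_of_abs_le hdm hdb) (integrable_of_abs_le hdm hdb)]
    exact (integral_mono (integrable_of_abs_le hdm hdb) (hfi.sub hgi).norm hle).trans hg
  have hm1 : (∫ x, f x ∂m) - ∫ x, g' x ∂m ≤ ∫ x, |f x - g' x| ∂m := by
    rw [← integral_sub (integrable_of_abs_le hf hf1) (integrable_of_abs_le hg'm hg'b)]
    exact (le_abs_self _).trans abs_integral_le_integral_abs
  have hn1 : (∫ x, g' x ∂n) - ∫ x, f x ∂n ≤ ∫ x, |f x - g' x| ∂n := by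
    rw [← integral_sub (integrable_of_abs_le hg'm hg'b) (integrable_of_abs_le hf hf1)]
    refine (le_abs_self _).trans (abs_integral_le_integral_abs.trans_eq ?_)
    simp only [abs_sub_comm]
  have hsup : (∫ x, g' x ∂m) - ∫ x, g' x ∂n ≤ tvDist m n := by
    refine le_csSup ⟨2, ?_⟩ ⟨g', hg'1, rfl⟩
    rintro r ⟨φ, hφ, rfl⟩
    have h1 : ∀ x, |φ x| ≤ 1 := fun x => (φ.norm_coe_le_norm x).trans hφ
    have h2 := abs_integral_le_of_abs_le (μ := m) h1
    have h3 := abs_integral_le_of_abs_le (μ := n) h1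
    rw [abs_le] at h2 h3
    linarith [h2.2, h3.1]
  linarith

/-- A positive operator `V` with `V 1 = E` which is bounded from below by a measure of total mass
at least `b` contracts the total variation by the factor `1 - b / E`. -/
theorem GapLE.contract {m n m' n' η : Measure X} [IsProbabilityMeasure m] [IsProbabilityMeasure n]
    [IsProbabilityMeasure m'] [IsProbabilityMeasure n'] {V : (X → ℝ≥0∞) → X → ℝ≥0∞} {E b D : ℝ}
    (hE : 0 < E) (hb : 0 ≤ b)
    (hVm : ∀ g, Measurable g → Measurable (V g))
    (hVadd : ∀ g h, Measurable g → Measurable h → ∀ x, V (fun x => g x + h x) x = V g x + V h x)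
    (hV1 : ∀ x, V (fun _ => 1) x = ENNReal.ofReal E)
    (hη : ∀ g, Measurable g → ∀ x, ∫⁻ x, g x ∂η ≤ V g x) (hηb : ENNReal.ofReal b ≤ η Set.univ)
    (hm : ∀ g, Measurable g → (∀ x, g x ≤ 1) →
      ENNReal.ofReal E * ∫⁻ x, g x ∂m' = ∫⁻ x, V g x ∂m)
    (hn : ∀ g, Measurable g → (∀ x, g x ≤ 1) →
      ENNReal.ofReal E * ∫⁻ x, g x ∂n' = ∫⁻ x, V g x ∂n)
    (hD : GapLE m n D) : GapLE m' n' ((1 - b / E) * D) := by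
  intro f hf hf1
  obtain ⟨x₀⟩ : Nonempty X := m.nonempty_of_neZero
  have hf' : ∀ x, -1 ≤ f x ∧ f x ≤ 1 := fun x => abs_le.1 (hf1 x)
  -- The operator acts on nonnegative functions only, so `f` is replaced by `(1 + f) / 2` and its
  -- complement `(1 - f) / 2`.
  set g₁ : X → ℝ≥0∞ := fun x => ENNReal.ofReal ((1 + f x) / 2) with hg₁
  set g₂ : X → ℝ≥0∞ := fun x => ENNReal.ofReal ((1 - f x) / 2) with hg₂
  have hg₁m : Measurable g₁ := by fun_prop
  have hg₂m : Measurable g₂ := by fun_prop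
  have hsum : (fun x => g₁ x + g₂ x) = fun _ => 1 := funext fun x => by
    rw [hg₁, hg₂, ← ENNReal.ofReal_add (by linarith [(hf' x).1]) (by linarith [(hf' x).2]),
      ← ENNReal.ofReal_one]
    congr 1; ring
  have hVsum : ∀ x, V g₁ x + V g₂ x = ENNReal.ofReal E := fun x => by
    rw [← hVadd g₁ g₂ hg₁m hg₂m, hsum, hV1]
  have hηsum : (∫⁻ x, g₁ x ∂η) + ∫⁻ x, g₂ x ∂η = η Set.univ := by
    rw [← lintegral_add_left hg₁m, hsum, lintegral_one]
  have hfin₁ : ∀ x, V g₁ x ≠ ∞ := fun x =>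
    ne_top_of_le_ne_top ENNReal.ofReal_ne_top (le_self_add.trans_eq (hVsum x))
  have hfin₂ : ∀ x, V g₂ x ≠ ∞ := fun x =>
    ne_top_of_le_ne_top ENNReal.ofReal_ne_top (le_add_self.trans_eq (hVsum x))
  have hA₁t : ∫⁻ x, g₁ x ∂η ≠ ∞ := ne_top_of_le_ne_top (hfin₁ x₀) (hη g₁ hg₁m x₀)
  have hA₂t : ∫⁻ x, g₂ x ∂η ≠ ∞ := ne_top_of_le_ne_top (hfin₂ x₀) (hη g₂ hg₂m x₀)
  set A₁ := (∫⁻ x, g₁ x ∂η).toReal with hA₁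
  set A₂ := (∫⁻ x, g₂ x ∂η).toReal with hA₂
  have hAb : b ≤ A₁ + A₂ := by
    rw [hA₁, hA₂, ← ENNReal.toReal_add hA₁t hA₂t, hηsum, ← ENNReal.toReal_ofReal hb]
    refine ENNReal.toReal_mono ?_ hηb
    rw [← hηsum]
    exact ENNReal.add_ne_top.2 ⟨hA₁t, hA₂t⟩
  set u : X → ℝ := fun x => (V g₁ x).toReal with hu
  have hum : Measurable u := (hVm g₁ hg₁m).ennreal_toReal
  have hu1 : ∀ x, A₁ ≤ u x := fun x => ENNReal.toReal_mono (hfin₁ x) (hη g₁ hg₁m x)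
  have hu2 : ∀ x, u x + A₂ ≤ E := fun x => by
    have h1 : (V g₁ x).toReal + (V g₂ x).toReal = E := by
      rw [← ENNReal.toReal_add (hfin₁ x) (hfin₂ x), hVsum, ENNReal.toReal_ofReal hE.le]
    have h2 : A₂ ≤ (V g₂ x).toReal := ENNReal.toReal_mono (hfin₂ x) (hη g₂ hg₂m x)
    linarith
  have hub : ∀ x, |u x| ≤ E := fun x => by
    rw [abs_of_nonneg ENNReal.toReal_nonneg]
    linarith [hu2 x, show 0 ≤ A₂ from ENNReal.toReal_nonneg]
  -- The minorisation of both halves confines `u` to `[A₁, E - A₂]`. Subtracting the midpoint does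
  -- not alter a difference of two probability averages, so only half the length of this interval
  -- counts.
  have hmid : ∀ x, |u x - (A₁ + E - A₂) / 2| ≤ (E - A₁ - A₂) / 2 := fun x => by
    rw [abs_le]; constructor <;> linarith [hu1 x, hu2 x]
  have hg1 : ∀ x, g₁ x ≤ 1 := fun x => by
    rw [← ENNReal.ofReal_one]
    exact ENNReal.ofReal_le_ofReal (by linarith [(hf' x).2])
  have key : ∀ (k k' : Measure X) [IsProbabilityMeasure k] [IsProbabilityMeasure k'],
      ENNReal.ofReal E * ∫⁻ x, g₁ x ∂k' = ∫⁻ x, V g₁ x ∂k →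
      E * ((1 + ∫ x, f x ∂k') / 2) = ∫ x, u x ∂k := by
    intro k k' _ _ hk
    have hfi : Integrable f k' := integrable_of_abs_le hf hf1
    have h1 : ∫ x, (1 + f x) / 2 ∂k' = (1 + ∫ x, f x ∂k') / 2 := by
      rw [integral_div, integral_add (integrable_const _) hfi]
      simp
    have h2 : ∫ x, (1 + f x) / 2 ∂k' = (∫⁻ x, g₁ x ∂k').toReal :=
      integral_eq_lintegral_of_nonneg_ae
        (Filter.Eventually.of_forall fun x => by
          simp only [Pi.zero_apply]; linarith [(hf' x).1])
        (by fun_prop)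
    rw [integral_toReal (hVm g₁ hg₁m).aemeasurable
      (Filter.Eventually.of_forall fun x => (hfin₁ x).lt_top), ← hk, ENNReal.toReal_mul,
      ENNReal.toReal_ofReal hE.le, ← h2, h1]
  have hkm := key m m' (hm g₁ hg₁m hg1)
  have hkn := key n n' (hn g₁ hg₁m hg1)
  have hgap := hD.sub_le (hum.sub_const _) (by linarith [hu1 x₀, hu2 x₀]) hmid
  have hui : ∀ (k : Measure X) [IsProbabilityMeasure k],
      ∫ x, (u x - (A₁ + E - A₂) / 2) ∂k = (∫ x, u x ∂k) - (A₁ + E - A₂) / 2 := by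
    intro k _
    rw [integral_sub (integrable_of_abs_le hum hub) (integrable_const _)]
    simp
  rw [hui m, hui n, ← hkm, ← hkn] at hgap
  have hD0 := hD.nonneg
  have hfinal : E * ((∫ x, f x ∂m') - ∫ x, f x ∂n') ≤ (E - b) * D := by
    nlinarith
  rw [one_sub_div hE.ne', div_mul_eq_mul_div, le_div_iff₀ hE]
  linarith

end TotalVariation

/-! ### Normalised mild solutions -/

section Normalised

variable {Z : Type*} [MeasurableSpace Z] {Φ : ℝ → Z → Z} {Q : Kernel Z Z} {κ : Kernel ℝ Z}

/-- The Dyson expansion restarted at `t₀`, with the common factor `e^{c t₀}` cancelled. -/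
theorem IsMild.exp_mul_lintegral_eq [IsSFiniteKernel Q] [IsMarkovKernel κ] {c : ℝ} (hc : 0 ≤ c)
    (hκ : IsMild Φ Q (expKernel c κ)) (hΦ : Measurable fun q : ℝ × Z => Φ q.1 q.2)
    (hadd : ∀ s t z, Φ (s + t) z = Φ s (Φ t z)) (hQ : ∀ z, Q z Set.univ = ENNReal.ofReal c)
    {t₀ t : ℝ} (ht₀ : 0 ≤ t₀) (ht : 0 ≤ t) {g : Z → ℝ≥0∞} (hg : Measurable g)
    (hg1 : ∀ z, g z ≤ 1) :
    ENNReal.ofReal (Real.exp (c * t)) * ∫⁻ z, g z ∂κ (t₀ + t)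
      = ∫⁻ z, dysonSeries Φ Q g t z ∂κ t₀ := by
  have h := (hκ.shift hΦ hadd ht₀).lintegral_eq_dysonSeries hΦ hc hQ
    (B := Real.exp (c * (t₀ + t))) ht (fun s hs => ?_) hg hg1
  · simp only [Kernel.comap_apply, add_zero] at h
    rw [lintegral_expKernel _ _ _ hg, lintegral_expKernel _ _ _ (measurable_dysonSeries hΦ hg t),
      mul_add, Real.exp_add, ENNReal.ofReal_mul (Real.exp_pos _).le, mul_assoc] at h
    exact (ENNReal.mul_right_inj (by simpa using Real.exp_pos _) ENNReal.ofReal_ne_top).1 h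
  · rw [Kernel.comap_apply, expKernel_apply, Measure.smul_apply, measure_univ, smul_eq_mul, mul_one]
    refine ENNReal.ofReal_le_ofReal (Real.exp_le_exp.2 ?_)
    exact mul_le_mul_of_nonneg_left (by linarith [hs.2]) hc

end Normalised

end LinearBoltzmann

namespace LinearBoltzmann

open ProbabilityTheory
open scoped ENNReal

/-! ### Exponential convergence in total variation. -/

section Convergence

variable {d : ℕ} {W : Torus d → ℝ} {σ : C(Torus d, ℝ)} {p : Vel d → Vel d → ℝ}
  {μ₀ : ProbabilityMeasure (Torus d × Vel d)} {μ : ℝ → ProbabilityMeasure (Torus d × Vel d)}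

theorem GeometricControl.le_mul_norm {hW : TorusC2 W} {T κ : ℝ} (hκ : GeometricControl hW σ T κ) :
    κ ≤ T * ‖σ‖ := by
  have h := intervalIntegral.norm_integral_le_of_norm_le_const (a := 0) (b := T) (C := ‖σ‖)
    (f := fun t => σ (flow hW t (0, 0)).1) fun t _ => σ.norm_coe_le_norm _
  rw [sub_zero, abs_of_pos hκ.1] at h
  linarith [hκ.2.2 (0, 0), (Real.le_norm_self _).trans h]

/-- With `x = T ‖σ‖` and `y` at least twice that, this keeps the argument of the logarithm in the
rate positive, whatever the size of `σ`. -/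
theorem sq_mul_exp_neg_le_one {κ x y : ℝ} (hκ : 0 ≤ κ) (hx : κ ≤ x) (hy : 2 * x ≤ y) :
    κ ^ 2 * Real.exp (-y) ≤ 1 := by
  have h1 : x ≤ Real.exp x := by linarith [Real.add_one_le_exp x]
  have h2 : Real.exp (-y) ≤ Real.exp (-(2 * x)) := Real.exp_le_exp.2 (by linarith)
  calc κ ^ 2 * Real.exp (-y) ≤ Real.exp x ^ 2 * Real.exp (-(2 * x)) := by
        gcongr; linarith
    _ = 1 := by rw [← Real.exp_nat_mul, ← Real.exp_add]; simp

/-- The solution and the equilibrium are transported by the same Dyson operator, whose value at `1`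
is `e^{‖σ‖ t}`; dividing the minorising mass by it produces the exponential loss. -/
theorem gapLE_nu_add (hW : TorusC2 W) (hp : IsScatteringKernel p) (hM : PreservesMaxwellian p)
    (hσ : ∀ x, 0 ≤ σ x) (hμ : IsMeasureSolution W σ p μ₀ μ) {s t D b : ℝ} (hs : 0 ≤ s) (ht : 0 ≤ t)
    (hb : 0 ≤ b) {η : Measure (Torus d × Vel d)}
    (hη : ∀ g, Measurable g → ∀ z,
      ∫⁻ z, g z ∂η ≤ dysonSeries (flow hW) (jumpKernel σ p ‖σ‖) g t z)
    (hηb : ENNReal.ofReal b ≤ η Set.univ) (hD : GapLE (μ s : Measure _) (nu W) D) :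
    GapLE (μ (s + t) : Measure _) (nu W) ((1 - b * Real.exp (-(t * ‖σ‖))) * D) := by
  have := isProbabilityMeasure_nu hW
  have hc : ∀ x, σ x ≤ ‖σ‖ := fun x => le_of_abs_le (abs_sigma_le σ x)
  have hc0 := norm_nonneg σ
  have hΦ := (continuous_flow hW).measurable
  have hadd : ∀ s t z, flow hW (s + t) z = flow hW s (flow hW t z) := flow_add hW
  have hQ := hp.jumpKernel_univ hσ hc
  have h1 := (hμ.isMild hW hp hσ hc)
  have h2 := isMild_nu hW hp hM hσ hc0 hc
  have h := GapLE.contract (V := fun g => dysonSeries (flow hW) (jumpKernel σ p ‖σ‖) g t)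
    (m' := (μ (s + t) : Measure _)) (n' := nu W) (Real.exp_pos (‖σ‖ * t)) hb
    (fun g hg => measurable_dysonSeries hΦ hg t)
    (fun g h hg _ z => dysonSeries_add hΦ hg t z) (fun z => dysonSeries_one hc0 hQ ht z) hη hηb
    (fun g hg hg1 => ?_) (fun g hg hg1 => ?_) hD
  · have e : b / Real.exp (‖σ‖ * t) = b * Real.exp (-(t * ‖σ‖)) := by
      rw [Real.exp_neg, mul_comm t, div_eq_mul_inv]
    rwa [e] at h
  · have h3 := h1.exp_mul_lintegral_eq hc0 hΦ hadd hQ hs ht hg hg1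
    rwa [curveKernel_apply, curveKernel_apply, max_eq_left hs, max_eq_left (add_nonneg hs ht)] at h3
  · have h3 := h2.exp_mul_lintegral_eq hc0 hΦ hadd hQ hs ht hg hg1
    rwa [Kernel.const_apply, Kernel.const_apply] at h3

theorem tvDist_nu_le (hW : TorusC2 W) (hp : IsScatteringKernel p) (hM : PreservesMaxwellian p)
    (hσ : ∀ x, 0 ≤ σ x) (hμ : IsMeasureSolution W σ p μ₀ μ) {t₀ b : ℝ} (ht₀ : 0 < t₀)
    (hb : 0 ≤ b) (hb1 : b * Real.exp (-(t₀ * ‖σ‖)) < 1) {η : Measure (Torus d × Vel d)}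
    (hη : ∀ g, Measurable g → ∀ z,
      ∫⁻ z, g z ∂η ≤ dysonSeries (flow hW) (jumpKernel σ p ‖σ‖) g t₀ z)
    (hηb : ENNReal.ofReal b ≤ η Set.univ) {t : ℝ} (ht : 0 ≤ t) :
    tvDist (μ t : Measure _) (nu W)
      ≤ Real.exp (Real.log (1 - b * Real.exp (-(t₀ * ‖σ‖))) / t₀ * (t - t₀))
        * tvDist (μ₀ : Measure _) (nu W) := by
  have := isProbabilityMeasure_nu hW
  set α := b * Real.exp (-(t₀ * ‖σ‖)) with hα
  have hα0 : 0 ≤ α := by positivity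
  set D := tvDist (μ₀ : Measure _) (nu W) with hDdef
  have h0 : GapLE (μ 0 : Measure _) (nu W) D := by
    rw [hμ.initial_eq hW hp hσ]; exact gapLE_tvDist _ _
  have hn : ∀ n : ℕ, GapLE (μ (n * t₀) : Measure _) (nu W) ((1 - α) ^ n * D) := by
    intro n
    induction n with
    | zero => simpa using h0
    | succ n ih =>
      have h := gapLE_nu_add hW hp hM hσ hμ (by positivity) ht₀.le hb hη hηb ih
      rw [← mul_assoc, ← pow_succ'] at h
      rw [Nat.cast_succ, add_mul, one_mul]
      exact h
  -- The number of complete periods. As `n * t₀ ≥ t - t₀`, the incomplete one costs the delay `t₀`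
  -- in the exponent.
  set n := ⌊t / t₀⌋₊ with hndef
  have hnt : n * t₀ ≤ t := by
    rw [← le_div_iff₀ ht₀]; exact Nat.floor_le (by positivity)
  have hnt' : t - t₀ ≤ n * t₀ := by
    have := Nat.lt_floor_add_one (t / t₀)
    rw [div_lt_iff₀ ht₀] at this
    linarith
  -- With the zero minorant the contraction factor is `1`: over the incomplete period the distance
  -- does not increase.
  have ht' := gapLE_nu_add hW hp hM hσ hμ (s := n * t₀) (t := t - n * t₀) (by positivity)
    (sub_nonneg.2 hnt) le_rfl (η := 0) (fun g _ z => by simp) (by simp) (hn n)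
  rw [zero_mul, sub_zero, one_mul, add_sub_cancel] at ht'
  refine (tvDist_le_of_gapLE ht').trans (mul_le_mul_of_nonneg_right ?_ h0.nonneg)
  have hpos : 0 < 1 - α := sub_pos.2 hb1
  rw [← Real.exp_log (pow_pos hpos n), Real.log_pow]
  refine Real.exp_le_exp.2 ?_
  have hlog : Real.log (1 - α) ≤ 0 := Real.log_nonpos hpos.le (by linarith)
  rw [div_mul_eq_mul_div, le_div_iff₀ ht₀]
  nlinarith

end Convergence

end LinearBoltzmann

/-! ### Choice of the constants and conclusion. -/

theorem theorem2 (d : ℕ) (W : Torus d → ℝ) (hW : TorusC2 W) :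
    ∃ T₀ : ℝ, 0 < T₀ ∧
      ∀ M : ℝ → ℝ, (∀ r, 0 ≤ r → 0 < M r) → AntitoneOn M (Set.Ici 0) →
      ∀ T : ℝ, 0 < T →
        ∃ β : ℝ, 0 < β ∧ β < 1 ∧
          (∀ t ∈ Set.Icc T₀ (T₀ + T), ∀ x₀ : Torus d,
            ENNReal.ofReal β • nuX W
              ≤ (transport hW t ((Measure.dirac x₀).prod (nuV d))).map Prod.fst) ∧
          ∀ p : Vel d → Vel d → ℝ, IsScatteringKernel p → PreservesMaxwellian p →
            (∀ v v' : Vel d, M ‖v‖ ≤ p v v') →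
          ∀ σ : C(Torus d, ℝ), (∀ x, 0 ≤ σ x) →
          ∀ κ : ℝ, GeometricControl hW σ T κ →
            0 < decayRate T T₀ β κ ‖σ‖ ∧
            ∀ (μ₀ : ProbabilityMeasure (Torus d × Vel d))
              (μ : ℝ → ProbabilityMeasure (Torus d × Vel d)),
              IsMeasureSolution W σ p μ₀ μ →
              ∀ t : ℝ, 0 ≤ t →
                tvDist (μ t : Measure (Torus d × Vel d)) (nu W)
                  ≤ Real.exp (-decayRate T T₀ β κ ‖σ‖ * (t - 2 * T - T₀))
                    * tvDist (μ₀ : Measure (Torus d × Vel d)) (nu W) := by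
  -- Positions spread over the torus in any positive time, so every positive `T₀` would do.
  refine ⟨1, one_pos, fun M hM hanti T hT => ?_⟩
  obtain ⟨β₁, hβ₁, hβ₁'⟩ := exists_le_map_fst_transport hW one_pos (show (1 : ℝ) ≤ 1 + T by linarith)
  -- The interval `[1, 2 * T + 1]` contains all possible delays between the two jumps. The radius
  -- found here fixes the value `M R` of the scattering bound.
  obtain ⟨R, β₂, hR, hβ₂, hβ₂'⟩ :=
    exists_le_map_flow hW one_pos (show (1 : ℝ) ≤ 2 * T + 1 by linarith)
  have hMR : 0 < M R := hM R hR.le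
  set V : ℝ := (volume (Metric.ball (0 : Vel d) R)).toReal with hV
  have hVt : volume (Metric.ball (0 : Vel d) R) ≠ ⊤ := measure_ball_lt_top.ne
  have hV0 : 0 < V := ENNReal.toReal_pos (Metric.measure_ball_pos _ _ hR).ne' hVt
  have hV' : ENNReal.ofReal V = volume (Metric.ball (0 : Vel d) R) := ENNReal.ofReal_toReal hVt
  -- The first entry serves the bound on the marginal. In the second, each jump contributes `M R`,
  -- the spreading `β₂` and the final velocities the volume `V`. The third makes `β < 1` and the
  -- argument of the logarithm positive.
  set β : ℝ := min β₁ (min (M R * M R * β₂ * V) (1 / 2)) with hβ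
  have hβ0 : 0 < β := by positivity
  have hβle₁ : β ≤ β₁ := min_le_left _ _
  have hβle₂ : β ≤ M R * M R * β₂ * V := (min_le_right _ _).trans (min_le_left _ _)
  have hβle₃ : β ≤ 1 / 2 := (min_le_right _ _).trans (min_le_right _ _)
  refine ⟨β, hβ0, by linarith, fun t ht x₀ => ?_, fun p hp hpM hpR σ hσ κ hκ => ?_⟩
  · refine le_trans ?_ (hβ₁' t ht x₀)
    refine Measure.le_iff.2 fun s _ => ?_
    rw [Measure.smul_apply, Measure.smul_apply]
    exact mul_le_mul_left (ENNReal.ofReal_le_ofReal hβle₁) _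
  have hκ0 : 0 < κ := hκ.2.1
  have ht₀ : 0 < 2 * T + 1 := by linarith
  have hball : ∀ w ∈ Metric.ball (0 : Vel d) R, ∀ v, M R ≤ p w v := fun w hw v =>
    (hanti (norm_nonneg w) hR.le (mem_ball_zero_iff.1 hw).le).trans (hpR w v)
  have hα : β * κ ^ 2 * Real.exp (-(2 * T + 1) * ‖σ‖) < 1 := by
    have h := sq_mul_exp_neg_le_one (y := (2 * T + 1) * ‖σ‖) hκ0.le hκ.le_mul_norm
      (by nlinarith [norm_nonneg σ])
    rw [neg_mul, mul_assoc]
    nlinarith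
  have hα0 : 0 < β * κ ^ 2 * Real.exp (-(2 * T + 1) * ‖σ‖) := by positivity
  have hlog : Real.log (1 - β * κ ^ 2 * Real.exp (-(2 * T + 1) * ‖σ‖)) < 0 :=
    Real.log_neg (by linarith) (by linarith)
  refine ⟨?_, fun μ₀ μ hμ t ht => ?_⟩
  · rw [decayRate, neg_mul, neg_pos]
    exact mul_neg_of_pos_of_neg (by positivity) hlog
  have hη : ∀ g : Torus d × Vel d → ENNReal, Measurable g → ∀ z,
      ∫⁻ z, g z ∂(ENNReal.ofReal (κ * (M R * M R * β₂)) • minorant hW σ R (T + 1) (2 * T + 1))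
        ≤ dysonSeries (flow hW) (jumpKernel σ p ‖σ‖) g (2 * T + 1) z := by
    intro g hg z
    refine le_trans (le_of_eq ?_) (ofReal_mul_minorant_le_dysonSeries hW hp one_pos hball hβ₂' hσ hκ hg z)
    rw [lintegral_smul_measure, smul_eq_mul, ENNReal.ofReal_mul hκ0.le,
      ENNReal.ofReal_mul (by positivity), ENNReal.ofReal_mul hMR.le]
    ring
  have hηb : ENNReal.ofReal (β * κ ^ 2)
      ≤ (ENNReal.ofReal (κ * (M R * M R * β₂)) • minorant hW σ R (T + 1) (2 * T + 1)) Set.univ := by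
    have h := le_minorant_univ (R := R) (T₀ := 1) hW hσ hκ
    rw [lintegral_one] at h
    rw [Measure.smul_apply, smul_eq_mul]
    refine le_trans ?_ (mul_le_mul_right h _)
    rw [← hV', ← ENNReal.ofReal_mul hκ0.le, ← ENNReal.ofReal_mul (by positivity)]
    refine ENNReal.ofReal_le_ofReal ?_
    nlinarith [mul_le_mul_of_nonneg_right hβle₂ (sq_nonneg κ)]
  have h := tvDist_nu_le hW hp hpM hσ hμ ht₀ (by positivity) (by rwa [neg_mul] at hα) hη hηb ht
  refine h.trans_eq ?_
  rw [decayRate, neg_mul (2 * T + 1)]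
  congr 2
  field_simp
  ring
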